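/- For $x>0$ and $\mu\in\mathbb C$ let $J_\mu(x)=\sum_{k\ge0}\frac{(-1)^k}{k!\,\Gamma(\mu+k+1)}(x/2)^{\mu+2k}$ and $I_\mu(x)=\sum_{k\ge0}\frac{1}{k!\,\Gamma(\mu+k+1)}(x/2)^{\mu+2k}$ be the Bessel function and the modified Bessel function of the first kind, and let $K_\mu(x)=\frac{\pi}{2}\,\frac{I_{-\mu}(x)-I_\mu(x)}{\sin(\mu\pi)}$ (with the limiting value at integer $\mu$) be the modified Bessel function of the second kind. Let $\alpha,\beta$ be real. Then the following hold, in the distributional sense in $(\alpha,\beta)$, with the left-hand sides defined as the limits $\nu\to1^-$ of the integrals with $x^{-\nu}$ in place of $x^{-1}$. (1) On $\mathbb R^2\setminus\{(0,0)\}$, $$\int_0^\infty\frac{dx}{x}K_{i\alpha}(x)K_{i\beta}(x)=\frac{\pi^2}{2\alpha\sinh(\alpha\pi)}\bigl(\delta(\alpha-\beta)+\delta(\alpha+\beta)\bigr).$$ That is, $R^K_\nu(\alpha,\beta)=\int_0^\infty x^{-\nu}K_{i\alpha}(x)K_{i\beta}(x)\,dx$ converges absolutely for all real $\alpha,\beta$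 and $\nu<1$, and for every smooth complex-valued $f$ with compact support in $\mathbb R^2\setminus\{(0,0)\}$ the function $R^K_\nu f$ is integrable on $\mathbb R^2$ for $\nu<1$ and $$\lim_{\nu\to1^-}\iint R^K_\nu(\alpha,\beta)f(\alpha,\beta)\,d\alpha\,d\beta=\int_{-\infty}^\infty\frac{\pi^2}{2\alpha\sinh(\alpha\pi)}\bigl(f(\alpha,\alpha)+f(\alpha,-\alpha)\bigr)\,d\alpha .$$ (2) On $\mathbb R^2$, $$\int_0^\infty\frac{dx}{x}J_{i\alpha}(x)J_{i\beta}(x)=2\sinh\!\Bigl((\alpha-\beta)\frac{\pi}{2}\Bigr)\left(\frac{\delta(\alpha+\beta)}{\alpha-\beta}-\mathrm{PV}\,\frac{i}{\pi(\alpha^2-\beta^2)}\right),$$ where $g(\alpha,\beta)=2\sinh((\alpha-\beta)\pi/2)/(\alpha-\beta)$ is the smooth function with value $\pi$ at $\alpha=\beta$, and the right-hand side means $g\cdot\bigl(\delta(\alpha+\beta)-\frac{i}{\pi}\mathrm{PV}\frac1{\alpha+\beta}\bigr)$. That is, $R^J_\nu(\alpha,\beta)=\int_0^\infty x^{-\nu}J_{i\alpha}(x)J_{i\beta}(x)\,dx$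 converges absolutely for all real $\alpha,\beta$ and $0<\nu<1$, and for every smooth compactly supported $f:\mathbb R^2\to\mathbb C$ the function $R^J_\nu f$ is integrable on $\mathbb R^2$ for $0<\nu<1$ and, with $h=gf$, $$\lim_{\nu\to1^-}\iint R^J_\nu f\,d\alpha\,d\beta=\int_{-\infty}^\infty h(\alpha,-\alpha)\,d\alpha-\frac{i}{\pi}\int_{-\infty}^\infty\int_0^\infty\frac{h(y-\beta,\beta)-h(-y-\beta,\beta)}{y}\,dy\,d\beta .$$ -/

import Mathlib

open MeasureTheory Set Filter Topology TopologicalSpace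
open scoped Distributions

noncomputable section

/-- The Bessel function of the first kind `J_μ(x)` of complex order `μ`, for `x > 0`:
`J_μ(x) = ∑ₖ (-1)ᵏ / (k! Γ(μ + k + 1)) (x / 2)^(μ + 2k)`. -/
def besselJ (μ : ℂ) (x : ℝ) : ℂ :=
  ∑' k : ℕ, (-1 : ℂ) ^ k / ((k.factorial : ℂ) * Complex.Gamma (μ + k + 1)) *
    ((x : ℂ) / 2) ^ (μ + 2 * (k : ℂ))

/-- The modified Bessel function of the first kind `I_μ(x)` of complex order `μ`, for `x > 0`:
`I_μ(x) = exp(-iμπ/2) J_μ(ix) = ∑ₖ 1 / (k! Γ(μ + k + 1)) (x / 2)^(μ + 2k)`. -/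
def besselI (μ : ℂ) (x : ℝ) : ℂ :=
  ∑' k : ℕ, 1 / ((k.factorial : ℂ) * Complex.Gamma (μ + k + 1)) *
    ((x : ℂ) / 2) ^ (μ + 2 * (k : ℂ))

/-- The quotient `(π / 2) (I_{-μ}(x) - I_μ(x)) / sin(μπ)`, meaningful for non-integer `μ`. -/
def besselKQuot (μ : ℂ) (x : ℝ) : ℂ :=
  (Real.pi : ℂ) / 2 * ((besselI (-μ) x - besselI μ x) / Complex.sin (μ * Real.pi))

open Classical in
/-- The modified Bessel function of the second kind (Macdonald function)
`K_μ(x) = (π / 2) (I_{-μ}(x) - I_μ(x)) / sin(μπ)`, for `x > 0`; at integer orders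
(where `sin(μπ) = 0`) it is the limit of this quotient, as usual. -/
def besselK (μ : ℂ) (x : ℝ) : ℂ :=
  if Complex.sin (μ * Real.pi) = 0 then limUnder (𝓝[≠] μ) (fun s => besselKQuot s x)
  else besselKQuot μ x

/-- The integrand `x^{-ν} K_{iα}(x) K_{iβ}(x)`. -/
def kernelKK (ν α β x : ℝ) : ℂ :=
  ((x ^ (-ν) : ℝ) : ℂ) * besselK (Complex.I * α) x * besselK (Complex.I * β) x

/-- The integrand `x^{-ν} J_{iα}(x) J_{iβ}(x)`. -/
def kernelJJ (ν α β x : ℝ) : ℂ :=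
  ((x ^ (-ν) : ℝ) : ℂ) * besselJ (Complex.I * α) x * besselJ (Complex.I * β) x

/-- The regularised integral `∫₀^∞ x^{-ν} K_{iα}(x) K_{iβ}(x) dx`. -/
def regKK (ν α β : ℝ) : ℂ := ∫ x in Ioi (0 : ℝ), kernelKK ν α β x

/-- The regularised integral `∫₀^∞ x^{-ν} J_{iα}(x) J_{iβ}(x) dx`. -/
def regJJ (ν α β : ℝ) : ℂ := ∫ x in Ioi (0 : ℝ), kernelJJ ν α β x

/-- The distribution `δ(α - β)` on the `(α, β)`-plane: `∬ δ(α - β) f(α, β) dα dβ`. -/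
def deltaDiff (f : ℝ × ℝ → ℂ) : ℂ := ∫ a : ℝ, f (a, a)

/-- The distribution `δ(α + β)` on the `(α, β)`-plane: `∬ δ(α + β) f(α, β) dα dβ`. -/
def deltaSum (f : ℝ × ℝ → ℂ) : ℂ := ∫ a : ℝ, f (a, -a)

/-- The Cauchy principal value distribution `PV 1/y` on the line:
`∫ [PV 1/y] f(y) dy = ∫₀^∞ (f(y) - f(-y)) / y dy`. -/
def pvInv (f : ℝ → ℂ) : ℂ := ∫ y in Ioi (0 : ℝ), (f y - f (-y)) / (y : ℂ)

/-- The distribution `PV 1/(α + β)` on the `(α, β)`-plane: for each `β`, substitute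
`y = α + β` and apply `PV 1/y`; then integrate over `β`. -/
def pvInvSum (f : ℝ × ℝ → ℂ) : ℂ := ∫ b : ℝ, pvInv (fun y => f (y - b, b))

open Classical in
/-- The smooth function `2 sinh((α - β)π/2) / (α - β)`, with its limiting value `π`
at `α = β`. -/
def sinhQuot (p : ℝ × ℝ) : ℂ :=
  if p.1 = p.2 then (Real.pi : ℂ)
  else ((2 * Real.sinh ((p.1 - p.2) * Real.pi / 2) / (p.1 - p.2) : ℝ) : ℂ)

/-- The distribution `π² / (2α sinh(απ)) (δ(α - β) + δ(α + β))` on the plane without the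
origin. -/
def limitKK (f : ℝ × ℝ → ℂ) : ℂ :=
  let c : ℝ × ℝ → ℂ := fun p =>
    ((Real.pi ^ 2 / (2 * p.1 * Real.sinh (p.1 * Real.pi)) : ℝ) : ℂ)
  deltaDiff (fun p => c p * f p) + deltaSum (fun p => c p * f p)

/-- The distribution `2 sinh((α - β)π/2) (δ(α + β) / (α - β) - i PV 1/(π (α² - β²)))`. As
`α² - β² = (α - β)(α + β)` and `sinh((α - β)π/2) / (α - β)` is smooth, it is the product of
the smooth function `sinhQuot` with `δ(α + β) - (i/π) PV 1/(α + β)`. -/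
def limitJJ (f : ℝ × ℝ → ℂ) : ℂ :=
  deltaSum (fun p => sinhQuot p * f p) -
    Complex.I / (Real.pi : ℂ) * pvInvSum (fun p => sinhQuot p * f p)

/-- The plane with the origin removed, as an open set. -/
def puncturedPlane : Opens (ℝ × ℝ) := ⟨{(0, 0)}ᶜ, isOpen_compl_singleton⟩

end

open scoped FourierTransform

/-- The entire function `∑ₖ (-z)ᵏ / (k! Γ(σ + k + 1))`, the regular part of the Bessel function. -/
noncomputable def besselF (σ z : ℂ) : ℂ :=
  ∑' k : ℕ, (-z) ^ k / ((k.factorial : ℂ) * Complex.Gamma (σ + k + 1))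

theorem norm_inv_Gamma_add_nat_le {μ : ℂ} (hμ : -(1 / 2) ≤ μ.re) (k : ℕ) :
    ‖(Complex.Gamma (μ + k + 1))⁻¹‖ ≤ 2 ^ k / k.factorial * ‖(Complex.Gamma (μ + 1))⁻¹‖ := by
  induction k with
  | zero => simp
  | succ k ih =>
    have hre : (k + 1 : ℝ) / 2 ≤ (μ + k + 1).re := by
      simp only [Complex.add_re, Complex.natCast_re, Complex.one_re]
      have : (0 : ℝ) ≤ k := k.cast_nonneg
      linarith
    have hn : (k + 1 : ℝ) / 2 ≤ ‖μ + k + 1‖ := hre.trans (Complex.re_le_norm _)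
    have hk : (0 : ℝ) < (k + 1 : ℝ) / 2 := by positivity
    have h0 : μ + k + 1 ≠ 0 := norm_pos_iff.mp (hk.trans_le hn)
    have e : μ + ((k + 1 : ℕ) : ℂ) + 1 = (μ + k + 1) + 1 := by push_cast; ring
    rw [e, Complex.Gamma_add_one _ h0, mul_inv, norm_mul, norm_inv]
    calc ‖μ + k + 1‖⁻¹ * ‖(Complex.Gamma (μ + k + 1))⁻¹‖
        ≤ ((k + 1 : ℝ) / 2)⁻¹ * (2 ^ k / k.factorial * ‖(Complex.Gamma (μ + 1))⁻¹‖) := by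
          gcongr
      _ = _ := by
          rw [Nat.factorial_succ]; push_cast; field_simp; ring

theorem norm_besselF_term_le {μ : ℂ} (hμ : -(1 / 2) ≤ μ.re) (z : ℂ) (k : ℕ) :
    ‖(-z) ^ k / ((k.factorial : ℂ) * Complex.Gamma (μ + k + 1))‖ ≤
      ‖(Complex.Gamma (μ + 1))⁻¹‖ * ((2 * ‖z‖) ^ k / k.factorial) := by
  rw [div_eq_mul_inv, mul_inv, norm_mul, norm_mul, norm_pow, norm_neg, norm_inv,
    Complex.norm_natCast]
  have h1 : (1 : ℝ) ≤ k.factorial := by exact_mod_cast k.factorial_pos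
  calc ‖z‖ ^ k * ((k.factorial : ℝ)⁻¹ * ‖(Complex.Gamma (μ + k + 1))⁻¹‖)
      ≤ ‖z‖ ^ k * (1 * (2 ^ k / k.factorial * ‖(Complex.Gamma (μ + 1))⁻¹‖)) := by
        gcongr
        · exact inv_le_one_of_one_le₀ h1
        · exact norm_inv_Gamma_add_nat_le hμ k
    _ = _ := by rw [mul_pow]; ring

theorem summable_norm_besselF {μ : ℂ} (hμ : -(1 / 2) ≤ μ.re) (z : ℂ) :
    Summable fun k : ℕ => ‖(-z) ^ k / ((k.factorial : ℂ) * Complex.Gamma (μ + k + 1))‖ :=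
  Summable.of_nonneg_of_le (fun _ => norm_nonneg _) (norm_besselF_term_le hμ z)
    ((Real.summable_pow_div_factorial _).mul_left _)

theorem hasSum_besselF {μ : ℂ} (hμ : -(1 / 2) ≤ μ.re) (z : ℂ) :
    HasSum (fun k : ℕ => (-z) ^ k / ((k.factorial : ℂ) * Complex.Gamma (μ + k + 1)))
      (besselF μ z) :=
  (summable_norm_besselF hμ z).of_norm.hasSum

theorem norm_besselF_le {μ : ℂ} (hμ : -(1 / 2) ≤ μ.re) (z : ℂ) :
    ‖besselF μ z‖ ≤ ‖(Complex.Gamma (μ + 1))⁻¹‖ * Real.exp (2 * ‖z‖) := by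
  refine tsum_of_norm_bounded ?_ (norm_besselF_term_le hμ z)
  rw [Real.exp_eq_exp_ℝ]
  exact (NormedSpace.expSeries_div_hasSum_exp (2 * ‖z‖)).mul_left _

theorem cpow_add_two_mul_natCast {y : ℂ} (hy : y ≠ 0) (μ : ℂ) (k : ℕ) :
    y ^ (μ + 2 * (k : ℂ)) = y ^ μ * (y ^ 2) ^ k := by
  rw [Complex.cpow_add _ _ hy, ← pow_mul]
  congr 1
  rw [← Complex.cpow_natCast]
  push_cast
  rfl

theorem besselJ_eq {x : ℝ} (hx : 0 < x) (μ : ℂ) :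
    besselJ μ x = ((x : ℂ) / 2) ^ μ * besselF μ (((x : ℂ) / 2) ^ 2) := by
  have hy : ((x : ℂ) / 2) ≠ 0 := by
    simp [hx.ne']
  rw [besselJ, besselF, ← tsum_mul_left]
  congr 1; ext k
  rw [cpow_add_two_mul_natCast hy, neg_pow (((x : ℂ) / 2) ^ 2)]
  ring

theorem besselI_eq {x : ℝ} (hx : 0 < x) (μ : ℂ) :
    besselI μ x = ((x : ℂ) / 2) ^ μ * besselF μ (-((x : ℂ) / 2) ^ 2) := by
  have hy : ((x : ℂ) / 2) ≠ 0 := by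
    simp [hx.ne']
  rw [besselI, besselF, ← tsum_mul_left]
  congr 1; ext k
  rw [cpow_add_two_mul_natCast hy, neg_neg]
  ring

theorem hasDerivAt_besselF {μ : ℂ} (hμ : -(1 / 2) ≤ μ.re) (z : ℂ) :
    HasDerivAt (besselF μ) (-besselF (μ + 1) z) z := by
  let R : ℝ := ‖z‖ + 1
  have hμ1 : -(1 / 2) ≤ (μ + 1).re := by simp; linarith
  let g : ℕ → ℂ → ℂ := fun k w => (-w) ^ k / ((k.factorial : ℂ) * Complex.Gamma (μ + k + 1))
  let g' : ℕ → ℂ → ℂ := fun k w =>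
    -(k * (-w) ^ (k - 1)) / ((k.factorial : ℂ) * Complex.Gamma (μ + k + 1))
  have hshift : ∀ k w, g' (k + 1) w =
      -((-w) ^ k / ((k.factorial : ℂ) * Complex.Gamma (μ + 1 + k + 1))) := by
    intro k w
    have e : μ + ((k + 1 : ℕ) : ℂ) + 1 = μ + 1 + k + 1 := by push_cast; ring
    have hf : (k.factorial : ℂ) ≠ 0 := by exact_mod_cast k.factorial_ne_zero
    have hk : (k : ℂ) + 1 ≠ 0 := by exact_mod_cast k.succ_ne_zero
    simp only [g', e, Nat.factorial_succ, Nat.add_sub_cancel]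
    push_cast
    rw [neg_div, mul_assoc, mul_div_mul_left _ _ hk]
  have hg : ∀ k w, HasDerivAt (g k) (g' k w) w := by
    intro k w
    have h := ((hasDerivAt_id w).neg.pow k).div_const
      ((k.factorial : ℂ) * Complex.Gamma (μ + k + 1))
    refine h.congr_deriv ?_
    simp only [g', Pi.neg_apply, id]
    ring
  let C := ‖(Complex.Gamma (μ + 1 + 1))⁻¹‖
  let u : ℕ → ℝ := fun k => match k with
    | 0 => 0
    | k + 1 => C * ((2 * R) ^ k / k.factorial)
  have hu : Summable u := (summable_nat_add_iff 1).mp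
    ((Real.summable_pow_div_factorial _).mul_left C)
  have hbound : ∀ k, ∀ w ∈ Metric.ball (0 : ℂ) R, ‖g' k w‖ ≤ u k := by
    intro k w hw
    rw [mem_ball_zero_iff] at hw
    cases k with
    | zero => simp [g', u]
    | succ k =>
      rw [hshift, norm_neg]
      refine (norm_besselF_term_le hμ1 w k).trans ?_
      simp only [u, C]
      gcongr
  have hz : z ∈ Metric.ball (0 : ℂ) R := by simp [R]
  have h := hasDerivAt_tsum_of_isPreconnected hu Metric.isOpen_ball
    (convex_ball (0 : ℂ) R).isPreconnected (fun k w _ => hg k w) hbound hz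
    (summable_norm_besselF hμ z).of_norm hz
  have hsum : ∑' k, g' k z = -besselF (μ + 1) z := by
    rw [(Summable.of_norm_bounded hu fun k => hbound k z hz).tsum_eq_zero_add]
    simp only [hshift, tsum_neg]
    simp [g', besselF]
  rw [hsum] at h
  exact h

theorem besselF_contiguous {μ : ℂ} (hμ : -(1 / 2) ≤ μ.re) (z : ℂ) :
    z * besselF (μ + 2) z - (μ + 1) * besselF (μ + 1) z + besselF μ z = 0 := by
  have h0 := hasSum_besselF hμ z
  have h1 := hasSum_besselF (μ := μ + 1) (by simp; linarith) z
  have h2 := hasSum_besselF (μ := μ + 2) (by simp; linarith) z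
  have h3 : HasSum (fun k : ℕ => (μ + 1) * ((-z) ^ k /
      ((k.factorial : ℂ) * Complex.Gamma (μ + 1 + k + 1))) -
      (-z) ^ k / ((k.factorial : ℂ) * Complex.Gamma (μ + k + 1)))
      ((μ + 1) * besselF (μ + 1) z - besselF μ z) := (h1.mul_left (μ + 1)).sub h0
  have hterm : ∀ k : ℕ, (μ + 1) * ((-z) ^ k /
      ((k.factorial : ℂ) * Complex.Gamma (μ + 1 + k + 1))) -
      (-z) ^ k / ((k.factorial : ℂ) * Complex.Gamma (μ + k + 1)) =
      -(k : ℂ) * (-z) ^ k / ((k.factorial : ℂ) * Complex.Gamma (μ + k + 2)) := by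
    intro k
    have hre : 0 < (μ + k + 1).re := by
      simp only [Complex.add_re, Complex.natCast_re, Complex.one_re]
      have : (0 : ℝ) ≤ k := k.cast_nonneg
      linarith
    have hne : μ + k + 1 ≠ 0 := fun h => by simp [h] at hre
    have hG := Complex.Gamma_ne_zero_of_re_pos hre
    have e1 : μ + 1 + k + 1 = (μ + k + 1) + 1 := by ring
    have e2 : μ + k + 2 = (μ + k + 1) + 1 := by ring
    rw [e1, e2, Complex.Gamma_add_one _ hne]
    have hf : (k.factorial : ℂ) ≠ 0 := by exact_mod_cast k.factorial_ne_zero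
    field_simp
    ring
  simp only [hterm] at h3
  have h4 := (hasSum_nat_add_iff' 1).mpr h3
  rw [Finset.sum_range_one, Nat.cast_zero, neg_zero, zero_mul, zero_div, sub_zero] at h4
  have h5 : ∀ k : ℕ, -((k + 1 : ℕ) : ℂ) * (-z) ^ (k + 1) /
      (((k + 1).factorial : ℂ) * Complex.Gamma (μ + ((k + 1 : ℕ) : ℂ) + 2)) =
      z * ((-z) ^ k / ((k.factorial : ℂ) * Complex.Gamma (μ + 2 + k + 1))) := by
    intro k
    have e : μ + ((k + 1 : ℕ) : ℂ) + 2 = μ + 2 + k + 1 := by push_cast; ring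
    have hk : (k : ℂ) + 1 ≠ 0 := by exact_mod_cast k.succ_ne_zero
    rw [e, Nat.factorial_succ, pow_succ]
    push_cast
    rw [mul_assoc (k + 1 : ℂ), neg_mul_comm, mul_div_mul_left _ _ hk]
    ring
  simp only [h5] at h4
  rw [(h2.mul_left z).unique h4]
  ring

theorem continuous_inv_Gamma {X : Type*} [TopologicalSpace X] {f : X → ℂ} (hf : Continuous f) :
    Continuous fun x => (Complex.Gamma (f x))⁻¹ :=
  Complex.differentiable_one_div_Gamma.continuous.comp hf

theorem continuousOn_besselF_order (z : ℂ) :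
    ContinuousOn (fun μ => besselF μ z) {μ : ℂ | -(1 / 2) ≤ μ.re} := by
  intro μ₀ h₀
  have hc : Continuous fun μ : ℂ => ‖(Complex.Gamma (μ + 1))⁻¹‖ :=
    (continuous_inv_Gamma (by fun_prop)).norm
  set c : ℝ := ‖(Complex.Gamma (μ₀ + 1))⁻¹‖ + 1 with hcdef
  set U : Set ℂ := {μ | ‖(Complex.Gamma (μ + 1))⁻¹‖ < c} 
  have hU : U ∈ 𝓝 μ₀ := (isOpen_lt hc continuous_const).mem_nhds (by simp [hcdef])
  have hcont : ∀ k : ℕ, ContinuousOn (fun μ : ℂ =>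
      (-z) ^ k / ((k.factorial : ℂ) * Complex.Gamma (μ + k + 1)))
      ({μ : ℂ | -(1 / 2) ≤ μ.re} ∩ U) := by
    intro k
    have : Continuous fun μ : ℂ => (Complex.Gamma (μ + k + 1))⁻¹ :=
      continuous_inv_Gamma (by fun_prop)
    simp only [div_eq_mul_inv, mul_inv]
    exact (continuous_const.mul (continuous_const.mul this)).continuousOn
  have hsum : Summable fun k : ℕ => c * ((2 * ‖z‖) ^ k / k.factorial) :=
    (Real.summable_pow_div_factorial _).mul_left _
  have h : ContinuousOn (fun μ => besselF μ z) ({μ : ℂ | -(1 / 2) ≤ μ.re} ∩ U) :=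
    continuousOn_tsum hcont hsum fun k μ hμ => (norm_besselF_term_le hμ.1 z k).trans
      (mul_le_mul_of_nonneg_right (le_of_lt hμ.2) (by positivity))
  exact (continuousWithinAt_inter hU).mp (h μ₀ ⟨h₀, mem_of_mem_nhds hU⟩)

theorem continuousOn_cpow_mul_exp_neg (a : ℂ) (w : ℝ) :
    ContinuousOn (fun y : ℝ => (y : ℂ) ^ a * Complex.exp (-(w * y))) (Ioi 0) := by
  intro y hy
  refine ContinuousAt.continuousWithinAt (ContinuousAt.mul ?_ (by fun_prop))
  exact Complex.continuousAt_ofReal_cpow_const y a (Or.inr (ne_of_gt hy))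

theorem norm_cpow_mul_exp_neg (a : ℂ) (w : ℝ) {y : ℝ} (hy : 0 < y) :
    ‖(y : ℂ) ^ a * Complex.exp (-(w * y))‖ = y ^ a.re * Real.exp (-w * y) := by
  rw [norm_mul, Complex.norm_cpow_eq_rpow_re_of_pos hy, Complex.norm_exp]
  simp

theorem integrableOn_rpow_mul_exp_neg_Ioi_one (r : ℝ) {w : ℝ} (hw : 0 < w) :
    IntegrableOn (fun y : ℝ => y ^ r * Real.exp (-w * y)) (Ioi 1) := by
  have hcont : ContinuousOn (fun y : ℝ => y ^ r * Real.exp (-w * y)) (Ici 1) := by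
    intro y hy
    have : y ≠ 0 := (zero_lt_one.trans_le hy).ne'
    exact ((Real.continuousAt_rpow_const y r (Or.inl this)).mul
      (by fun_prop)).continuousWithinAt
  refine integrable_of_isBigO_exp_neg (half_pos hw) hcont ?_
  have h4 := (isLittleO_rpow_exp_pos_mul_atTop r (half_pos hw)).isBigO.mul
    (Asymptotics.isBigO_refl (fun y : ℝ => Real.exp (-w * y)) atTop)
  refine h4.congr (fun _ => rfl) fun y => ?_
  rw [← Real.exp_add]; congr 1; ring

theorem integrableOn_cpow_mul_exp_neg_Ioi_one (a : ℂ) {w : ℝ} (hw : 0 < w) :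
    IntegrableOn (fun y : ℝ => (y : ℂ) ^ a * Complex.exp (-(w * y))) (Ioi 1) := by
  refine Integrable.mono' (integrableOn_rpow_mul_exp_neg_Ioi_one a.re hw)
    (((continuousOn_cpow_mul_exp_neg a w).mono
      (Ioi_subset_Ioi zero_le_one)).aestronglyMeasurable measurableSet_Ioi) ?_
  filter_upwards [ae_restrict_mem measurableSet_Ioi] with y hy
  exact (norm_cpow_mul_exp_neg a w (zero_lt_one.trans hy)).le

/-- The incomplete Gamma integral `∫₁^∞ y^(a-1) e^(-wy) dy`. -/
noncomputable def upperGammaInt (w : ℝ) (a : ℂ) : ℂ :=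
  ∫ y in Ioi (1 : ℝ), (y : ℂ) ^ (a - 1) * Complex.exp (-(w * y))

/-- The series `∑ⱼ (-w)ʲ / (j! (a + j))`. -/
noncomputable def lowerGammaSeries (w : ℝ) (a : ℂ) : ℂ :=
  ∑' j : ℕ, (-(w : ℂ)) ^ j / j.factorial * (a + j)⁻¹

theorem upperGammaInt_recurrence {w : ℝ} (hw : 0 < w) (a : ℂ) :
    w * upperGammaInt w (a + 1) = Complex.exp (-w) + a * upperGammaInt w a := by
  have hd : ∀ y ∈ Ici (1 : ℝ), HasDerivAt
      (fun y : ℝ => (y : ℂ) ^ a * Complex.exp (-(w * y)))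
      (a * ((y : ℂ) ^ (a - 1) * Complex.exp (-(w * y))) -
        w * ((y : ℂ) ^ (a + 1 - 1) * Complex.exp (-(w * y)))) y := by
    intro y hy
    have hy0 : (y : ℂ) ∈ Complex.slitPlane := by
      rw [Complex.ofReal_mem_slitPlane]; exact zero_lt_one.trans_le hy
    have h1 := ((hasDerivAt_id (y : ℂ)).cpow_const (c := a) hy0).comp_ofReal
    have h2 := (((hasDerivAt_id (y : ℂ)).const_mul (w : ℂ)).neg.cexp).comp_ofReal
    refine (h1.mul h2).congr_deriv ?_
    simp only [id, add_sub_cancel_right, Pi.neg_apply]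
    ring
  have i1 := integrableOn_cpow_mul_exp_neg_Ioi_one (a - 1) hw
  have i2 := integrableOn_cpow_mul_exp_neg_Ioi_one (a + 1 - 1) hw
  have hi := (i1.const_mul a).sub (i2.const_mul (w : ℂ))
  have ht : Tendsto (fun y : ℝ => (y : ℂ) ^ a * Complex.exp (-(w * y))) atTop (𝓝 0) := by
    rw [tendsto_zero_iff_norm_tendsto_zero]
    refine (tendsto_rpow_mul_exp_neg_mul_atTop_nhds_zero a.re w hw).congr' ?_
    filter_upwards [eventually_gt_atTop 0] with y hy
    exact (norm_cpow_mul_exp_neg a w hy).symm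
  have h := integral_Ioi_of_hasDerivAt_of_tendsto' hd hi ht
  rw [integral_sub (i1.const_mul a) (i2.const_mul (w : ℂ)), integral_const_mul,
    integral_const_mul] at h
  simp only [upperGammaInt]
  simp only [Complex.ofReal_one, Complex.one_cpow, mul_one, one_mul] at h
  linear_combination -h

theorem summable_lowerGammaSeries (w : ℝ) {a : ℂ} {C : ℝ} (hC : ∀ j : ℕ, ‖(a + j)⁻¹‖ ≤ C) :
    Summable fun j : ℕ => (-(w : ℂ)) ^ j / j.factorial * (a + j)⁻¹ := by
  refine Summable.of_norm_bounded ((Real.summable_pow_div_factorial |w|).mul_right C) fun j => ?_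
  rw [norm_mul, norm_div, norm_pow, norm_neg, Complex.norm_real, Complex.norm_natCast,
    Real.norm_eq_abs]
  gcongr
  exact hC j

theorem hasSum_exp_neg (w : ℂ) :
    HasSum (fun j : ℕ => (-w) ^ j / (j.factorial : ℂ)) (Complex.exp (-w)) := by
  rw [Complex.exp_eq_exp_ℂ]
  exact NormedSpace.expSeries_div_hasSum_exp (-w)

theorem lowerGammaSeries_recurrence (w : ℝ) {a : ℂ} {C : ℝ} (ha : ∀ j : ℕ, a + j ≠ 0)
    (hC : ∀ j : ℕ, ‖(a + j)⁻¹‖ ≤ C) :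
    a * lowerGammaSeries w a = Complex.exp (-w) + w * lowerGammaSeries w (a + 1) := by
  have h1 := (summable_lowerGammaSeries w hC).hasSum.mul_left a
  have hC' : ∀ j : ℕ, ‖(a + 1 + j)⁻¹‖ ≤ C := fun j => by
    have := hC (j + 1)
    rwa [show a + ((j + 1 : ℕ) : ℂ) = a + 1 + j by push_cast; ring] at this
  have h2 := (summable_lowerGammaSeries w hC').hasSum.mul_left (w : ℂ)
  have h3 := (hasSum_exp_neg (w : ℂ)).sub h1
  have hterm : ∀ j : ℕ, (-(w : ℂ)) ^ j / (j.factorial : ℂ) -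
      a * ((-(w : ℂ)) ^ j / j.factorial * (a + j)⁻¹) =
      j * ((-(w : ℂ)) ^ j / j.factorial * (a + j)⁻¹) := fun j => by
    have := ha j
    field_simp
    ring
  simp only [hterm] at h3
  have h4 := (hasSum_nat_add_iff' 1).mpr h3
  rw [Finset.sum_range_one, Nat.cast_zero, zero_mul, sub_zero] at h4
  have h5 : ∀ j : ℕ, ((j + 1 : ℕ) : ℂ) * ((-(w : ℂ)) ^ (j + 1) / (j + 1).factorial *
      (a + (j + 1 : ℕ))⁻¹) = -(w * ((-(w : ℂ)) ^ j / j.factorial * (a + 1 + j)⁻¹)) := fun j => by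
    have hk : (j : ℂ) + 1 ≠ 0 := by exact_mod_cast j.succ_ne_zero
    have hf : (j.factorial : ℂ) ≠ 0 := by exact_mod_cast j.factorial_ne_zero
    rw [show a + ((j + 1 : ℕ) : ℂ) = a + 1 + j by push_cast; ring, Nat.factorial_succ, pow_succ]
    push_cast
    field_simp
  simp only [h5] at h4
  have h6 := h4.unique h2.neg
  simp only [lowerGammaSeries]
  linear_combination -h6

theorem integral_cpow_mul_exp_neg_Ioc {w : ℝ} {a : ℂ} (ha : 0 < a.re) :
    ∫ y in Ioc (0 : ℝ) 1, (y : ℂ) ^ (a - 1) * Complex.exp (-(w * y)) = lowerGammaSeries w a := by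
  have hre : -1 < (a - 1).re := by simp [ha]
  have hnorm : IntegrableOn (fun y : ℝ => y ^ (a.re - 1)) (Ioc 0 1) := by
    rw [← intervalIntegrable_iff_integrableOn_Ioc_of_le zero_le_one]
    exact intervalIntegral.intervalIntegrable_rpow' (by linarith)
  have h := MeasureTheory.hasSum_integral_of_dominated_convergence
    (μ := volume.restrict (Ioc (0 : ℝ) 1))
    (F := fun (j : ℕ) (y : ℝ) => (y : ℂ) ^ (a - 1) * ((-(w * y : ℂ)) ^ j / j.factorial))
    (f := fun y => (y : ℂ) ^ (a - 1) * Complex.exp (-(w * y)))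
    (fun j y => y ^ (a.re - 1) * (|w| ^ j / j.factorial)) ?_ ?_ ?_ ?_ ?_
  · refine (h.tsum_eq.symm.trans ?_)
    rw [lowerGammaSeries]
    congr 1; funext j
    have e : ∀ y ∈ Ioc (0 : ℝ) 1, (y : ℂ) ^ (a - 1) * ((-(w * y : ℂ)) ^ j / j.factorial) =
        (-(w : ℂ)) ^ j / j.factorial * (y : ℂ) ^ (a + j - 1) := by
      intro y hy
      have hy0 : (y : ℂ) ≠ 0 := by exact_mod_cast hy.1.ne'
      rw [show a + j - 1 = (a - 1) + j by ring, Complex.cpow_add _ _ hy0, Complex.cpow_natCast,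
        ← neg_mul, mul_pow]
      ring
    rw [setIntegral_congr_fun measurableSet_Ioc e, integral_const_mul,
      ← intervalIntegral.integral_of_le zero_le_one, integral_cpow]
    · have hj : a + j ≠ 0 := fun h0 => by
        have := congrArg Complex.re h0
        simp at this
        linarith [(Nat.cast_nonneg j : (0 : ℝ) ≤ j)]
      simp [Complex.zero_cpow hj]
    · left
      simp
      linarith [(Nat.cast_nonneg j : (0 : ℝ) ≤ j)]
  · intro j
    refine ContinuousOn.aestronglyMeasurable (fun y hy => ?_) measurableSet_Ioc
    refine ContinuousAt.continuousWithinAt (ContinuousAt.mul ?_ (by fun_prop))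
    exact Complex.continuousAt_ofReal_cpow_const y _ (Or.inr hy.1.ne')
  · intro j
    filter_upwards [ae_restrict_mem measurableSet_Ioc] with y hy
    rw [norm_mul, norm_div, norm_pow, Complex.norm_cpow_eq_rpow_re_of_pos hy.1,
      Complex.norm_natCast, norm_neg, norm_mul, Complex.norm_real, Complex.norm_real,
      Real.norm_eq_abs, Real.norm_of_nonneg hy.1.le, Complex.sub_re, Complex.one_re]
    have := hy.1.le
    gcongr
    exact mul_le_of_le_one_right (abs_nonneg _) hy.2
  · exact ae_of_all _ fun y => (Real.summable_pow_div_factorial |w|).mul_left _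
  · simp_rw [tsum_mul_left]
    exact hnorm.mul_const _
  · exact ae_of_all _ fun y => (hasSum_exp_neg (w * y : ℂ)).mul_left _

theorem integrableOn_cpow_mul_exp_neg_Ioc {w : ℝ} {a : ℂ} (ha : 0 < a.re) :
    IntegrableOn (fun y : ℝ => (y : ℂ) ^ (a - 1) * Complex.exp (-(w * y))) (Ioc 0 1) := by
  have h : IntegrableOn (fun y : ℝ => (y : ℂ) ^ (a - 1)) (Icc 0 1) := by
    rw [integrableOn_Icc_iff_integrableOn_Ioc,
      ← intervalIntegrable_iff_integrableOn_Ioc_of_le zero_le_one]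
    exact intervalIntegral.intervalIntegrable_cpow' (by simp [ha])
  have hc : Continuous fun y : ℝ => Complex.exp (-(w * y)) := by fun_prop
  exact (h.mul_continuousOn hc.continuousOn isCompact_Icc).mono_set Ioc_subset_Icc_self

theorem upperGammaInt_of_re_pos {w : ℝ} (hw : 0 < w) {a : ℂ} (ha : 0 < a.re) :
    upperGammaInt w a = (w : ℂ) ^ (-a) * Complex.Gamma a - lowerGammaSeries w a := by
  have h := Complex.integral_cpow_mul_exp_neg_mul_Ioi (a := a) (r := w) ha (by simpa using hw)
  rw [← Ioc_union_Ioi_eq_Ioi (zero_le_one (α := ℝ)),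
    setIntegral_union Ioc_disjoint_Ioi_same measurableSet_Ioi
      (integrableOn_cpow_mul_exp_neg_Ioc ha) (integrableOn_cpow_mul_exp_neg_Ioi_one _ hw),
    integral_cpow_mul_exp_neg_Ioc ha] at h
  rw [Complex.cpow_neg, ← Complex.inv_cpow, ← one_div]
  · rw [← h, upperGammaInt]; ring
  · rw [Complex.arg_ofReal_of_nonneg hw.le]; exact Real.pi_pos.ne

theorem norm_inv_add_int_le {μ : ℂ} (h1 : |μ.re| < 1 / 2) (n : ℤ) :
    ‖(μ + n)⁻¹‖ ≤ 2 + ‖μ‖⁻¹ := by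
  by_cases hn : n = 0
  · simp [hn]
  have : 1 / 2 ≤ ‖μ + n‖ := by
    refine le_trans ?_ (Complex.abs_re_le_norm _)
    rw [Complex.add_re, Complex.intCast_re]
    have h2 : (1 : ℝ) ≤ |(n : ℝ)| := by exact_mod_cast Int.one_le_abs hn
    have h3 := abs_sub_abs_le_abs_sub (n : ℝ) (-μ.re)
    rw [abs_neg, sub_neg_eq_add, add_comm (n : ℝ)] at h3
    linarith
  rw [norm_inv]
  have h3 : ‖μ + n‖⁻¹ ≤ (1 / 2)⁻¹ := inv_anti₀ (by norm_num) this
  have : 0 ≤ ‖μ‖⁻¹ := by positivity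
  linarith

theorem add_int_ne_zero {μ : ℂ} (h1 : |μ.re| < 1 / 2) (h0 : μ ≠ 0) (n : ℤ) : μ + n ≠ 0 := by
  intro h
  have h2 := congrArg Complex.re h
  simp only [Complex.add_re, Complex.intCast_re, Complex.zero_re] at h2
  have h3 : |(n : ℝ)| < 1 := by
    rw [show (n : ℝ) = -μ.re by linarith, abs_neg]; linarith
  have h4 : n = 0 := by
    have : |n| < 1 := by exact_mod_cast h3
    exact Int.abs_lt_one_iff.mp this
  exact h0 (by simpa [h4] using h)

theorem upperGammaInt_sub_nat {w : ℝ} (hw : 0 < w) {μ : ℂ} (h1 : |μ.re| < 1 / 2) (h0 : μ ≠ 0)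
    (k : ℕ) : upperGammaInt w (μ - k) =
      (w : ℂ) ^ (-(μ - k)) * Complex.Gamma (μ - k) - lowerGammaSeries w (μ - k) := by
  have hstep : ∀ n : ℤ, upperGammaInt w (μ + n + 1) =
      (w : ℂ) ^ (-(μ + n + 1)) * Complex.Gamma (μ + n + 1) - lowerGammaSeries w (μ + n + 1) →
      upperGammaInt w (μ + n) =
        (w : ℂ) ^ (-(μ + n)) * Complex.Gamma (μ + n) - lowerGammaSeries w (μ + n) := by
    intro n hn
    have hne := add_int_ne_zero h1 h0 n
    have hw0 : (w : ℂ) ≠ 0 := by exact_mod_cast hw.ne'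
    have r1 := upperGammaInt_recurrence hw (μ + n)
    have r2 := lowerGammaSeries_recurrence w (a := μ + n) (C := 2 + ‖μ‖⁻¹)
      (fun j => by simpa [add_assoc] using add_int_ne_zero h1 h0 (n + j))
      (fun j => by simpa [add_assoc] using norm_inv_add_int_le h1 (n + j))
    have e : (w : ℂ) ^ (-(μ + n)) = w * (w : ℂ) ^ (-(μ + n + 1)) := by
      rw [show -(μ + n) = -(μ + n + 1) + 1 by ring, Complex.cpow_add _ _ hw0, Complex.cpow_one]
      ring
    rw [Complex.Gamma_add_one _ hne] at hn
    apply mul_left_cancel₀ hne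
    rw [e]
    rw [hn] at r1
    linear_combination -r1 + r2
  have key : ∀ k : ℕ, upperGammaInt w (μ + ((1 : ℤ) - k : ℤ)) =
      (w : ℂ) ^ (-(μ + ((1 : ℤ) - k : ℤ))) * Complex.Gamma (μ + ((1 : ℤ) - k : ℤ)) -
        lowerGammaSeries w (μ + ((1 : ℤ) - k : ℤ)) := by
    intro k
    induction k with
    | zero =>
      refine upperGammaInt_of_re_pos hw ?_
      have := (abs_lt.mp h1).1
      simp
      linarith
    | succ k ih =>
      apply hstep
      have e : μ + (((1 : ℤ) - ((k + 1 : ℕ) : ℤ) : ℤ) : ℂ) + 1 = μ + ((1 : ℤ) - k : ℤ) := by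
        push_cast; ring
      rw [e]; exact ih
  have := key (k + 1)
  rwa [show μ + (((1 : ℤ) - ((k + 1 : ℕ) : ℤ) : ℤ) : ℂ) = μ - k by push_cast; ring] at this

theorem hasSum_congr_of_eq {ι : Type*} {f g : ι → ℂ} {a b : ℂ} (h : HasSum f a)
    (hfg : ∀ i, g i = f i) (hab : b = a) : HasSum g b := by
  rw [hab, funext hfg]; exact h

/-- The integral `∫₁^∞ y^(μ-1) e^(-w(y + 1/y)) dy`. -/
noncomputable def halfMacdonald (w : ℝ) (μ : ℂ) : ℂ :=
  ∫ y in Ioi (1 : ℝ), (y : ℂ) ^ (μ - 1) * Complex.exp (-(w * (y + 1 / y)))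

theorem hasSum_halfMacdonald {w : ℝ} (hw : 0 < w) (μ : ℂ) :
    HasSum (fun k : ℕ => (-(w : ℂ)) ^ k / k.factorial * upperGammaInt w (μ - k))
      (halfMacdonald w μ) := by
  have h := MeasureTheory.hasSum_integral_of_dominated_convergence
    (μ := volume.restrict (Ioi (1 : ℝ)))
    (F := fun (k : ℕ) (y : ℝ) => (-(w : ℂ)) ^ k / k.factorial *
      ((y : ℂ) ^ (μ - k - 1) * Complex.exp (-(w * y))))
    (f := fun y : ℝ => (y : ℂ) ^ (μ - 1) * Complex.exp (-(w * (y + 1 / y))))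
    (fun k y => w ^ k / k.factorial * (y ^ (μ.re - 1) * Real.exp (-w * y))) ?_ ?_ ?_ ?_ ?_
  · refine hasSum_congr_of_eq h (fun k => ?_) rfl
    rw [integral_const_mul]
    rfl
  · intro k
    exact (integrableOn_cpow_mul_exp_neg_Ioi_one (μ - k - 1) hw).1.const_mul _
  · intro k
    filter_upwards [ae_restrict_mem measurableSet_Ioi] with y hy
    have hy0 : 0 < y := zero_lt_one.trans hy
    rw [norm_mul, norm_cpow_mul_exp_neg _ _ hy0, norm_div, norm_pow, norm_neg, Complex.norm_real,
      Complex.norm_natCast, Real.norm_of_nonneg hw.le]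
    gcongr
    · exact le_of_lt hy
    · simp
  · exact ae_of_all _ fun y => (Real.summable_pow_div_factorial w).mul_right _
  · simp_rw [tsum_mul_right]
    exact (integrableOn_rpow_mul_exp_neg_Ioi_one (μ.re - 1) hw).const_mul _
  · filter_upwards [ae_restrict_mem measurableSet_Ioi] with y hy
    have hy0 : (y : ℂ) ≠ 0 := by exact_mod_cast (zero_lt_one.trans hy).ne'
    have h := (hasSum_exp_neg (w / y : ℂ)).mul_left
      ((y : ℂ) ^ (μ - 1) * Complex.exp (-(w * y)))
    refine hasSum_congr_of_eq h (fun k => ?_) ?_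
    · rw [show μ - k - 1 = (μ - 1) - k by ring, Complex.cpow_sub _ _ hy0, Complex.cpow_natCast,
        ← neg_div, div_pow]
      ring
    · rw [mul_assoc, ← Complex.exp_add]
      congr 2
      ring

theorem sin_mul_pi_ne_zero {μ : ℂ} (h1 : |μ.re| < 1 / 2) (h0 : μ ≠ 0) :
    Complex.sin (μ * Real.pi) ≠ 0 := by
  rw [Complex.sin_ne_zero_iff]
  intro k hk
  have hpi : (Real.pi : ℂ) ≠ 0 := by exact_mod_cast Real.pi_ne_zero
  have h := mul_right_cancel₀ hpi hk
  exact add_int_ne_zero h1 h0 (-k) (by rw [h]; push_cast; ring)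

theorem hasSum_besselI_neg {w : ℝ} (hw : 0 < w) {μ : ℂ} (h1 : |μ.re| < 1 / 2) (h0 : μ ≠ 0) :
    HasSum (fun k : ℕ => (-(w : ℂ)) ^ k / k.factorial *
      ((w : ℂ) ^ (-(μ - k)) * Complex.Gamma (μ - k)))
      (Real.pi / Complex.sin (μ * Real.pi) * besselI (-μ) (2 * w)) := by
  have hw0 : (w : ℂ) ≠ 0 := by exact_mod_cast hw.ne'
  have hre : -(1 / 2) ≤ (-μ).re := by
    have := (abs_lt.mp h1).2
    simp; linarith
  have h := ((hasSum_besselF hre (-(w : ℂ) ^ 2)).mul_left ((w : ℂ) ^ (-μ))).mul_left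
    (Real.pi / Complex.sin (μ * Real.pi))
  rw [besselI_eq (by positivity)]
  have e2 : (((2 * w : ℝ) : ℂ) / 2) = w := by push_cast; ring
  rw [e2]
  refine hasSum_congr_of_eq h (fun k => ?_) rfl
  have hs := sin_mul_pi_ne_zero h1 h0
  have hG : Complex.Gamma (-μ + k + 1) ≠ 0 := by
    apply Complex.Gamma_ne_zero
    intro m hm
    refine add_int_ne_zero h1 h0 (-(k + 1 + m)) ?_
    push_cast
    linear_combination -hm
  have hrefl := Complex.Gamma_mul_Gamma_one_sub (μ - k)
  rw [show 1 - (μ - (k : ℂ)) = -μ + k + 1 by ring,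
    show (Real.pi : ℂ) * (μ - k) = μ * Real.pi - k * Real.pi by ring,
    Complex.sin_antiperiodic.sub_nat_mul_eq] at hrefl
  have hG2 : Complex.Gamma (μ - k) =
      Real.pi / ((-1) ^ k * Complex.sin (μ * Real.pi)) / Complex.Gamma (-μ + k + 1) := by
    rw [eq_div_iff hG, hrefl]
  rw [hG2, show -(μ - (k : ℂ)) = -μ + k by ring, Complex.cpow_add _ _ hw0, Complex.cpow_natCast,
    neg_neg, neg_pow (w : ℂ) k]
  have h3 : ((-1 : ℂ) ^ k) ≠ 0 := pow_ne_zero _ (by norm_num)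
  have hf : (k.factorial : ℂ) ≠ 0 := by exact_mod_cast k.factorial_ne_zero
  field_simp
  ring

theorem summable_doubleSeries (w : ℝ) {μ : ℂ} (h1 : |μ.re| < 1 / 2) :
    Summable fun p : ℕ × ℕ => (-(w : ℂ)) ^ p.1 / p.1.factorial *
      ((-(w : ℂ)) ^ p.2 / p.2.factorial * (μ - p.1 + p.2)⁻¹) := by
  have hs := Real.summable_pow_div_factorial |w|
  refine Summable.of_norm_bounded ((hs.mul_of_nonneg hs (fun _ => by positivity)
    (fun _ => by positivity)).mul_right (2 + ‖μ‖⁻¹)) fun p => ?_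
  have hb := norm_inv_add_int_le h1 (p.2 - p.1)
  rw [show μ + ((p.2 - p.1 : ℤ) : ℂ) = μ - p.1 + p.2 by push_cast; ring] at hb
  rw [norm_mul, norm_mul, norm_div, norm_div, norm_pow, norm_pow, norm_neg, Complex.norm_real,
    Complex.norm_natCast, Complex.norm_natCast, Real.norm_eq_abs, ← mul_assoc]
  gcongr

theorem tsum_lowerGammaSeries (w : ℝ) {μ : ℂ} (h1 : |μ.re| < 1 / 2) :
    HasSum (fun k : ℕ => (-(w : ℂ)) ^ k / k.factorial * lowerGammaSeries w (μ - k))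
      (∑' p : ℕ × ℕ, (-(w : ℂ)) ^ p.1 / p.1.factorial *
        ((-(w : ℂ)) ^ p.2 / p.2.factorial * (μ - p.1 + p.2)⁻¹)) := by
  have hk : ∀ k : ℕ, HasSum (fun j : ℕ => (-(w : ℂ)) ^ k / k.factorial *
      ((-(w : ℂ)) ^ j / j.factorial * (μ - k + j)⁻¹))
      ((-(w : ℂ)) ^ k / k.factorial * lowerGammaSeries w (μ - k)) := by
    intro k
    have hC : ∀ j : ℕ, ‖(μ - k + j)⁻¹‖ ≤ 2 + ‖μ‖⁻¹ := fun j => by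
      have hb := norm_inv_add_int_le h1 (j - k)
      rwa [show μ + ((j - k : ℤ) : ℂ) = μ - k + j by push_cast; ring] at hb
    exact (summable_lowerGammaSeries w hC).hasSum.mul_left _
  exact HasSum.prod_fiberwise (summable_doubleSeries w h1).hasSum hk

theorem tsum_doubleSeries_neg (w : ℝ) (μ : ℂ) :
    (∑' p : ℕ × ℕ, (-(w : ℂ)) ^ p.1 / p.1.factorial *
        ((-(w : ℂ)) ^ p.2 / p.2.factorial * (-μ - p.1 + p.2)⁻¹)) =
      -∑' p : ℕ × ℕ, (-(w : ℂ)) ^ p.1 / p.1.factorial *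
        ((-(w : ℂ)) ^ p.2 / p.2.factorial * (μ - p.1 + p.2)⁻¹) := by
  rw [← (Equiv.prodComm ℕ ℕ).tsum_eq, ← tsum_neg]
  congr 1; funext p
  simp only [Equiv.prodComm_apply, Prod.fst_swap, Prod.snd_swap]
  rw [show -μ - (p.2 : ℂ) + p.1 = -(μ - p.1 + p.2) by ring, inv_neg]
  ring

theorem besselKQuot_eq_halfMacdonald {w : ℝ} (hw : 0 < w) {μ : ℂ} (h1 : |μ.re| < 1 / 2)
    (h0 : μ ≠ 0) :
    besselKQuot μ (2 * w) = (halfMacdonald w μ + halfMacdonald w (-μ)) / 2 := by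
  have key : ∀ μ : ℂ, |μ.re| < 1 / 2 → μ ≠ 0 → halfMacdonald w μ =
      Real.pi / Complex.sin (μ * Real.pi) * besselI (-μ) (2 * w) -
      ∑' p : ℕ × ℕ, (-(w : ℂ)) ^ p.1 / p.1.factorial *
        ((-(w : ℂ)) ^ p.2 / p.2.factorial * (μ - p.1 + p.2)⁻¹) := by
    intro μ h1 h0
    have h := (hasSum_besselI_neg hw h1 h0).sub (tsum_lowerGammaSeries w h1)
    refine (hasSum_halfMacdonald hw μ).unique ?_
    refine hasSum_congr_of_eq h (fun k => ?_) rfl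
    rw [upperGammaInt_sub_nat hw h1 h0]
    ring
  rw [key μ h1 h0, key (-μ) (by simpa using h1) (neg_ne_zero.mpr h0), tsum_doubleSeries_neg,
    neg_neg, neg_mul, Complex.sin_neg, besselKQuot]
  have hs := sin_mul_pi_ne_zero h1 h0
  field_simp
  ring

/-- The integral `(1/2) ∫ exp(μt - x cosh t) dt`. -/
noncomputable def macdonaldInt (μ : ℂ) (x : ℝ) : ℂ :=
  (∫ t : ℝ, Complex.exp (μ * t - x * Real.cosh t)) / 2

theorem one_add_sq_div_four_le_cosh (t : ℝ) : 1 + t ^ 2 / 4 ≤ Real.cosh t := by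
  rw [← Real.cosh_abs, Real.cosh_eq]
  have h1 := Real.quadratic_le_exp_of_nonneg (abs_nonneg t)
  have h2 := Real.add_one_le_exp (-|t|)
  rw [sq_abs] at h1
  linarith

theorem integrable_exp_sub_mul_cosh (r : ℝ) {x : ℝ} (hx : 0 < x) :
    Integrable fun t : ℝ => Real.exp (r * t - x * Real.cosh t) := by
  have h0 := (integrable_cexp_quadratic (b := ((x / 4 : ℝ) : ℂ))
    (by rw [Complex.ofReal_re]; linarith) (r : ℂ) 0).norm
  refine h0.mono' ?_ (ae_of_all _ fun t => ?_)
  · exact Continuous.aestronglyMeasurable (by fun_prop)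
  · rw [Real.norm_of_nonneg (Real.exp_pos _).le, Complex.norm_exp]
    apply Real.exp_le_exp.mpr
    have h2 : (-((x / 4 : ℝ) : ℂ) * (t : ℂ) ^ 2 + r * t + 0).re = -(x / 4) * t ^ 2 + r * t := by
      norm_cast
      simp
    rw [h2]
    have := mul_le_mul_of_nonneg_left (one_add_sq_div_four_le_cosh t) hx.le
    linarith

theorem norm_cexp_sub_mul_cosh (μ : ℂ) (x t : ℝ) :
    ‖Complex.exp (μ * t - x * Real.cosh t)‖ = Real.exp (μ.re * t - x * Real.cosh t) := by
  rw [Complex.norm_exp]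
  simp only [Complex.sub_re, Complex.re_mul_ofReal, ← Complex.ofReal_mul, Complex.ofReal_re]

theorem integrable_cexp_sub_mul_cosh (μ : ℂ) {x : ℝ} (hx : 0 < x) :
    Integrable fun t : ℝ => Complex.exp (μ * t - x * Real.cosh t) := by
  refine (integrable_exp_sub_mul_cosh μ.re hx).mono'
    (Continuous.aestronglyMeasurable (by fun_prop)) (ae_of_all _ fun t => ?_)
  rw [norm_cexp_sub_mul_cosh]

theorem integral_Ioi_exp_eq_halfMacdonald (w : ℝ) (μ : ℂ) :
    ∫ t in Ioi (0 : ℝ), Complex.exp (μ * t - (2 * w : ℝ) * Real.cosh t) = halfMacdonald w μ := by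
  have himg : Real.exp '' Ioi 0 = Ioi 1 := by
    ext y
    constructor
    · rintro ⟨t, ht, rfl⟩
      exact Real.one_lt_exp_iff.mpr ht
    · intro hy
      exact ⟨Real.log y, Real.log_pos hy, Real.exp_log (zero_lt_one.trans hy)⟩
  rw [halfMacdonald, ← himg, integral_image_eq_integral_abs_deriv_smul measurableSet_Ioi
    (fun t _ => (Real.hasDerivAt_exp t).hasDerivWithinAt) Real.exp_injective.injOn]
  refine setIntegral_congr_fun measurableSet_Ioi fun t _ => ?_
  have he : Complex.exp t ≠ 0 := Complex.exp_ne_zero _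
  have hl : Complex.log (Complex.exp t) = t := by
    rw [← Complex.ofReal_exp, ← Complex.ofReal_log (Real.exp_pos t).le, Real.log_exp]
  change _ = |Real.exp t| • (((Real.exp t : ℝ) : ℂ) ^ (μ - 1) * _)
  rw [abs_of_pos (Real.exp_pos t), Complex.real_smul, Complex.ofReal_exp,
    Complex.cpow_def_of_ne_zero he, hl, Real.cosh_eq]
  rw [← mul_assoc, ← Complex.exp_add, ← Complex.exp_add, one_div, ← Complex.exp_neg]
  congr 1
  push_cast
  ring

theorem macdonaldInt_eq_halfMacdonald {w : ℝ} (hw : 0 < w) (μ : ℂ) :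
    macdonaldInt μ (2 * w) = (halfMacdonald w μ + halfMacdonald w (-μ)) / 2 := by
  have hi := integrable_cexp_sub_mul_cosh μ (x := 2 * w) (by positivity)
  rw [macdonaldInt, ← integral_Ioi_exp_eq_halfMacdonald, ← integral_Ioi_exp_eq_halfMacdonald,
    ← integral_add_compl measurableSet_Ioi hi, compl_Ioi, ← integral_comp_neg_Ioi, neg_zero]
  simp only [Complex.ofReal_neg, Real.cosh_neg, mul_neg, neg_mul]

theorem besselKQuot_eq_macdonaldInt {x : ℝ} (hx : 0 < x) {μ : ℂ} (h1 : |μ.re| < 1 / 2)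
    (h0 : μ ≠ 0) : besselKQuot μ x = macdonaldInt μ x := by
  have h := besselKQuot_eq_halfMacdonald (half_pos hx) h1 h0
  have h' := macdonaldInt_eq_halfMacdonald (half_pos hx) μ
  rw [mul_div_cancel₀ _ two_ne_zero] at h h'
  rw [h, h']

theorem continuousAt_macdonaldInt_zero {x : ℝ} (hx : 0 < x) :
    ContinuousAt (fun μ => macdonaldInt μ x) 0 := by
  have hb : Integrable fun t : ℝ => Real.exp (1 * t - x * Real.cosh t) +
      Real.exp (-1 * t - x * Real.cosh t) :=
    (integrable_exp_sub_mul_cosh 1 hx).add (integrable_exp_sub_mul_cosh (-1) hx)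
  refine ContinuousAt.div_const (continuousAt_of_dominated (bound := fun t : ℝ =>
    Real.exp (1 * t - x * Real.cosh t) + Real.exp (-1 * t - x * Real.cosh t))
    (Eventually.of_forall fun μ => (integrable_cexp_sub_mul_cosh μ hx).1) ?_ hb
    (ae_of_all _ fun t => by fun_prop)) 2
  filter_upwards [Metric.ball_mem_nhds (0 : ℂ) zero_lt_one] with μ hμ
  refine ae_of_all _ fun t => ?_
  rw [norm_cexp_sub_mul_cosh]
  have hre : |μ.re| ≤ 1 := (Complex.abs_re_le_norm μ).trans (by simpa using (mem_ball_zero_iff.mp hμ).le)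
  have h2 : μ.re * t ≤ |t| := (le_abs_self _).trans (by
    rw [abs_mul]; exact mul_le_of_le_one_left (abs_nonneg _) hre)
  rcases abs_cases t with ⟨h, _⟩ | ⟨h, _⟩ <;> rw [h] at h2
  · refine le_trans (Real.exp_le_exp.mpr ?_) (le_add_of_nonneg_right (Real.exp_pos _).le)
    linarith
  · refine le_trans (Real.exp_le_exp.mpr ?_) (le_add_of_nonneg_left (Real.exp_pos _).le)
    linarith

theorem besselK_I_mul_eq_macdonaldInt {x : ℝ} (hx : 0 < x) (α : ℝ) :
    besselK (Complex.I * α) x = macdonaldInt (Complex.I * α) x := by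
  have hre : |(Complex.I * α).re| < 1 / 2 := by simp
  by_cases hα : α = 0
  · subst hα
    rw [besselK, if_pos (by simp)]
    simp only [Complex.ofReal_zero, mul_zero]
    refine Tendsto.limUnder_eq ?_
    refine ((continuousAt_macdonaldInt_zero hx).tendsto.mono_left nhdsWithin_le_nhds).congr' ?_
    have hev : ∀ᶠ μ : ℂ in 𝓝[≠] 0, ‖μ‖ < 1 / 2 :=
      by
      filter_upwards [nhdsWithin_le_nhds (Metric.ball_mem_nhds (0 : ℂ) (half_pos one_pos))]
        with μ hμ using by simpa using hμ
    filter_upwards [hev, self_mem_nhdsWithin] with μ hμ h0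
    exact (besselKQuot_eq_macdonaldInt hx ((Complex.abs_re_le_norm μ).trans_lt hμ) h0).symm
  · have h0 : Complex.I * (α : ℂ) ≠ 0 := mul_ne_zero Complex.I_ne_zero (by exact_mod_cast hα)
    rw [besselK, if_neg (sin_mul_pi_ne_zero hre h0), besselKQuot_eq_macdonaldInt hx hre h0]

theorem exp_div_two_mul_cosh_mem (p : ℝ) : Real.exp p / (2 * Real.cosh p) ∈ Ioo (0 : ℝ) 1 := by
  have hc := Real.cosh_pos p
  refine ⟨by positivity, (div_lt_one (by positivity)).mpr ?_⟩
  rw [Real.cosh_eq]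
  linarith [Real.exp_pos (-p)]

theorem one_sub_exp_div_two_mul_cosh (p : ℝ) :
    1 - Real.exp p / (2 * Real.cosh p) = Real.exp (-p) / (2 * Real.cosh p) := by
  have hc := (Real.cosh_pos p).ne'
  field_simp
  rw [Real.cosh_eq]; ring

theorem image_exp_div_two_mul_cosh :
    (fun p : ℝ => Real.exp p / (2 * Real.cosh p)) '' univ = Ioo 0 1 := by
  ext y
  constructor
  · rintro ⟨p, -, rfl⟩
    exact exp_div_two_mul_cosh_mem p
  · rintro ⟨h0, h1⟩
    have h2 : 0 < 1 - y := by linarith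
    refine ⟨Real.log (y / (1 - y)) / 2, trivial, ?_⟩
    have he : Real.exp (Real.log (y / (1 - y)) / 2) ^ 2 = y / (1 - y) := by
      rw [← Real.exp_nat_mul]
      push_cast
      rw [mul_div_cancel₀ _ two_ne_zero, Real.exp_log (div_pos h0 h2)]
    set E := Real.exp (Real.log (y / (1 - y)) / 2) with hE
    have hEpos : 0 < E := Real.exp_pos _
    simp only [Real.cosh_eq, Real.exp_neg, ← hE]
    have : E / (2 * ((E + E⁻¹) / 2)) = E ^ 2 / (E ^ 2 + 1) := by
      field_simp
    rw [this, he]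
    field_simp
    ring

theorem hasDerivAt_exp_div_two_mul_cosh (p : ℝ) :
    HasDerivAt (fun p : ℝ => Real.exp p / (2 * Real.cosh p)) (1 / (2 * Real.cosh p ^ 2)) p := by
  have hc := (Real.cosh_pos p).ne'
  have h := (Real.hasDerivAt_exp p).div ((Real.hasDerivAt_cosh p).const_mul 2) (by positivity)
  refine h.congr_deriv ?_
  rw [div_eq_div_iff (by positivity) (by positivity)]
  have h2 : Real.exp p * (Real.cosh p - Real.sinh p) = 1 := by
    rw [Real.cosh_sub_sinh, ← Real.exp_add]; simp
  linear_combination (4 * Real.cosh p ^ 2) * h2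

theorem injective_exp_div_two_mul_cosh :
    Function.Injective (fun p : ℝ => Real.exp p / (2 * Real.cosh p)) := by
  refine StrictMono.injective (strictMono_of_deriv_pos fun p => ?_)
  rw [(hasDerivAt_exp_div_two_mul_cosh p).deriv]
  have := Real.cosh_pos p
  positivity

theorem beta_integrand_exp_div_two_mul_cosh (a b : ℂ) (p : ℝ) :
    |1 / (2 * Real.cosh p ^ 2)| • ((((Real.exp p / (2 * Real.cosh p) : ℝ) : ℂ)) ^ (a - 1) *
      (1 - ((Real.exp p / (2 * Real.cosh p) : ℝ) : ℂ)) ^ (b - 1)) =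
      2 ^ (1 - (a + b)) * (((Real.cosh p : ℝ) : ℂ) ^ (-(a + b)) * Complex.exp ((a - b) * p)) := by
  have hc := Real.cosh_pos p
  have h1 := (exp_div_two_mul_cosh_mem p).1
  have h2 : 0 < Real.exp (-p) / (2 * Real.cosh p) := by positivity
  rw [abs_of_pos (by positivity), ← Complex.ofReal_one, ← Complex.ofReal_sub,
    one_sub_exp_div_two_mul_cosh, Complex.real_smul]
  have hlc : Real.log (2 * Real.cosh p) = Real.log 2 + Real.log (Real.cosh p) :=
    Real.log_mul two_ne_zero hc.ne'
  have hsc : (1 : ℝ) / (2 * Real.cosh p ^ 2) =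
      Real.exp (-(Real.log 2 + 2 * Real.log (Real.cosh p))) := by
    rw [Real.exp_neg, Real.exp_add, Real.exp_log two_pos, two_mul (Real.log _), Real.exp_add,
      Real.exp_log hc, one_div, sq]
  have e2 : (2 : ℂ) ^ (((1 : ℝ) : ℂ) - (a + b)) =
      Complex.exp ((Real.log 2 : ℝ) * (((1 : ℝ) : ℂ) - (a + b))) := by
    rw [Complex.cpow_def_of_ne_zero two_ne_zero, Complex.ofReal_log zero_le_two]; norm_num
  rw [hsc, e2, Complex.cpow_def_of_ne_zero (by exact_mod_cast h1.ne'),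
    Complex.cpow_def_of_ne_zero (by exact_mod_cast h2.ne'),
    Complex.cpow_def_of_ne_zero (by exact_mod_cast hc.ne'), ← Complex.ofReal_log h1.le,
    ← Complex.ofReal_log h2.le, ← Complex.ofReal_log hc.le,
    Real.log_div (Real.exp_pos _).ne' (by positivity),
    Real.log_div (Real.exp_pos _).ne' (by positivity), Real.log_exp, Real.log_exp, hlc,
    Complex.ofReal_exp, ← Complex.exp_add, ← Complex.exp_add, ← Complex.exp_add,
    ← Complex.exp_add]
  congr 1
  push_cast
  ring

theorem integrable_cosh_cpow_mul_exp {a b : ℂ} (ha : 0 < a.re) (hb : 0 < b.re) :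
    Integrable fun p : ℝ =>
      ((Real.cosh p : ℝ) : ℂ) ^ (-(a + b)) * Complex.exp ((a - b) * p) := by
  have h := Complex.betaIntegral_convergent ha hb
  rw [intervalIntegrable_iff_integrableOn_Ioo_of_le zero_le_one, ← image_exp_div_two_mul_cosh,
    integrableOn_image_iff_integrableOn_abs_deriv_smul MeasurableSet.univ
    (fun p _ => (hasDerivAt_exp_div_two_mul_cosh p).hasDerivWithinAt)
    injective_exp_div_two_mul_cosh.injOn, integrableOn_univ] at h
  simp only [beta_integrand_exp_div_two_mul_cosh] at h
  have h2 := h.const_mul ((2 : ℂ) ^ (1 - (a + b)))⁻¹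
  refine h2.congr (ae_of_all _ fun p => ?_)
  have : (2 : ℂ) ^ (1 - (a + b)) ≠ 0 := by simp [Complex.cpow_eq_zero_iff]
  simp only
  rw [inv_mul_cancel_left₀ this]

theorem integral_cosh_cpow_mul_exp {a b : ℂ} (ha : 0 < a.re) (hb : 0 < b.re) :
    ∫ p : ℝ, ((Real.cosh p : ℝ) : ℂ) ^ (-(a + b)) * Complex.exp ((a - b) * p) =
      2 ^ (a + b - 1) * (Complex.Gamma a * Complex.Gamma b / Complex.Gamma (a + b)) := by
  have h := Complex.betaIntegral_eq_Gamma_mul_div a b ha hb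
  rw [Complex.betaIntegral, intervalIntegral.integral_of_le zero_le_one,
    integral_Ioc_eq_integral_Ioo, ← image_exp_div_two_mul_cosh,
    integral_image_eq_integral_abs_deriv_smul MeasurableSet.univ
    (fun p _ => (hasDerivAt_exp_div_two_mul_cosh p).hasDerivWithinAt)
    injective_exp_div_two_mul_cosh.injOn] at h
  simp only [beta_integrand_exp_div_two_mul_cosh, setIntegral_univ] at h
  rw [integral_const_mul] at h
  rw [← h, ← mul_assoc, ← Complex.cpow_add _ _ two_ne_zero]
  simp

/-- The linear map `(p, q) ↦ (p + q, p - q)`. -/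
noncomputable def sumDiffMap : ℝ × ℝ →ₗ[ℝ] ℝ × ℝ :=
  Matrix.toLin (Module.Basis.finTwoProd ℝ) (Module.Basis.finTwoProd ℝ) !![1, 1; 1, -1]

theorem sumDiffMap_apply (z : ℝ × ℝ) : sumDiffMap z = (z.1 + z.2, z.1 - z.2) := by
  rw [sumDiffMap, Matrix.toLin_finTwoProd_apply]
  ext <;> simp [sub_eq_add_neg]

theorem map_sumDiffMap :
    Measure.map sumDiffMap (volume : Measure (ℝ × ℝ)) = ENNReal.ofReal (1 / 2) • volume := by
  have hd : LinearMap.det sumDiffMap = -2 := by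
    rw [sumDiffMap, LinearMap.det_toLin, Matrix.det_fin_two_of]; norm_num
  rw [Measure.map_linearMap_addHaar_eq_smul_addHaar _ (by rw [hd]; norm_num), hd]
  norm_num

theorem integrable_of_sumDiff {f : ℝ × ℝ → ℂ} (hf : Continuous f)
    (hi : Integrable fun z : ℝ × ℝ => f (z.1 + z.2, z.1 - z.2)) : Integrable f := by
  have hc : Continuous sumDiffMap := LinearMap.continuous_of_finiteDimensional _
  have h1 : Integrable f (Measure.map sumDiffMap volume) := by
    rw [integrable_map_measure hf.aestronglyMeasurable hc.aemeasurable]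
    refine hi.congr (ae_of_all _ fun z => ?_)
    simp [sumDiffMap_apply]
  rw [map_sumDiffMap] at h1
  exact (integrable_smul_measure (by simp) (by simp)).mp h1

theorem integral_eq_sumDiff {f : ℝ × ℝ → ℂ} (hf : Continuous f) :
    ∫ z, f z = 2 * ∫ z : ℝ × ℝ, f (z.1 + z.2, z.1 - z.2) := by
  have hc : Continuous sumDiffMap := LinearMap.continuous_of_finiteDimensional _
  have h := integral_map hc.aemeasurable (hf.aestronglyMeasurable
    (μ := Measure.map sumDiffMap (volume : Measure (ℝ × ℝ))))
  rw [map_sumDiffMap, integral_smul_measure] at h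
  simp only [sumDiffMap_apply] at h
  rw [← h, ENNReal.toReal_ofReal (by norm_num), Complex.real_smul]
  push_cast
  ring

theorem cosh_add_add_cosh_sub (p q : ℝ) :
    Real.cosh (p + q) + Real.cosh (p - q) = 2 * (Real.cosh p * Real.cosh q) := by
  rw [Real.cosh_add, Real.cosh_sub]; ring

/-- The function `e^{i(αt + βu)} (cosh t + cosh u)^{-ε}`. -/
noncomputable def coshSumKernel (ε α β : ℝ) (z : ℝ × ℝ) : ℂ :=
  Complex.exp (Complex.I * α * z.1 + Complex.I * β * z.2) *
    (((Real.cosh z.1 + Real.cosh z.2) ^ (-ε) : ℝ) : ℂ)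

theorem cosh_add_cosh_pos (t u : ℝ) : 0 < Real.cosh t + Real.cosh u :=
  add_pos (Real.cosh_pos _) (Real.cosh_pos _)

theorem continuous_coshSumKernel (ε α β : ℝ) : Continuous (coshSumKernel ε α β) := by
  refine Continuous.mul (by fun_prop) (Complex.continuous_ofReal.comp ?_)
  exact Continuous.rpow_const (by fun_prop) fun z => Or.inl (cosh_add_cosh_pos _ _).ne'

theorem coshSumKernel_sumDiff (ε α β : ℝ) (z : ℝ × ℝ) :
    coshSumKernel ε α β (z.1 + z.2, z.1 - z.2) = 2 ^ (-ε : ℂ) *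
      ((((Real.cosh z.1 : ℝ) : ℂ) ^ (-((ε + Complex.I * (α + β)) / 2 +
          (ε - Complex.I * (α + β)) / 2)) *
        Complex.exp (((ε + Complex.I * (α + β)) / 2 - (ε - Complex.I * (α + β)) / 2) * z.1)) *
      (((Real.cosh z.2 : ℝ) : ℂ) ^ (-((ε + Complex.I * (α - β)) / 2 +
          (ε - Complex.I * (α - β)) / 2)) *
        Complex.exp (((ε + Complex.I * (α - β)) / 2 - (ε - Complex.I * (α - β)) / 2) * z.2))) := by
  have h1 := Real.cosh_pos z.1
  have h2 := Real.cosh_pos z.2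
  simp only [coshSumKernel]
  rw [cosh_add_add_cosh_sub, Real.mul_rpow zero_le_two (by positivity),
    Real.mul_rpow h1.le h2.le]
  rw [show -((ε + Complex.I * (α + β)) / 2 + (ε - Complex.I * (α + β)) / 2) = ((-ε : ℝ) : ℂ) by
    push_cast; ring, show -((ε + Complex.I * (α - β)) / 2 + (ε - Complex.I * (α - β)) / 2) =
    ((-ε : ℝ) : ℂ) by push_cast; ring, ← Complex.ofReal_cpow h1.le, ← Complex.ofReal_cpow h2.le]
  have e : (2 : ℂ) ^ (-ε : ℂ) = ((2 ^ (-ε) : ℝ) : ℂ) := by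
    rw [Complex.ofReal_cpow zero_le_two]; push_cast; rfl
  have e2 : Complex.exp (Complex.I * α * ((z.1 + z.2 : ℝ) : ℂ) +
      Complex.I * β * ((z.1 - z.2 : ℝ) : ℂ)) =
      Complex.exp (((ε + Complex.I * (α + β)) / 2 - (ε - Complex.I * (α + β)) / 2) * z.1) *
      Complex.exp (((ε + Complex.I * (α - β)) / 2 - (ε - Complex.I * (α - β)) / 2) * z.2) := by
    rw [← Complex.exp_add]; congr 1; push_cast; ring
  rw [e, e2]
  push_cast
  ring

theorem re_half_add_pos {ε : ℝ} (hε : 0 < ε) (s : ℝ) : 0 < ((ε + Complex.I * s) / 2).re := by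
  simp [hε]

theorem re_half_sub_pos {ε : ℝ} (hε : 0 < ε) (s : ℝ) : 0 < ((ε - Complex.I * s) / 2).re := by
  simp [hε]

theorem integrable_coshSumKernel {ε : ℝ} (hε : 0 < ε) (α β : ℝ) :
    Integrable (coshSumKernel ε α β) := by
  refine integrable_of_sumDiff (continuous_coshSumKernel _ _ _) ?_
  simp only [coshSumKernel_sumDiff]
  refine Integrable.const_mul (Integrable.mul_prod
    (integrable_cosh_cpow_mul_exp (a := (ε + Complex.I * (α + β)) / 2)
      (b := (ε - Complex.I * (α + β)) / 2) ?_ ?_)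
    (integrable_cosh_cpow_mul_exp (a := (ε + Complex.I * (α - β)) / 2)
      (b := (ε - Complex.I * (α - β)) / 2) ?_ ?_)) _
  · simpa using re_half_add_pos hε (α + β)
  · simpa using re_half_sub_pos hε (α + β)
  · simpa using re_half_add_pos hε (α - β)
  · simpa using re_half_sub_pos hε (α - β)

theorem integral_coshSumKernel {ε : ℝ} (hε : 0 < ε) (α β : ℝ) :
    ∫ z, coshSumKernel ε α β z = 2 ^ (ε - 1 : ℂ) / Complex.Gamma ε ^ 2 *
      (Complex.Gamma ((ε + Complex.I * (α + β)) / 2) *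
        Complex.Gamma ((ε - Complex.I * (α + β)) / 2) *
      (Complex.Gamma ((ε + Complex.I * (α - β)) / 2) *
        Complex.Gamma ((ε - Complex.I * (α - β)) / 2))) := by
  rw [integral_eq_sumDiff (continuous_coshSumKernel _ _ _)]
  simp only [coshSumKernel_sumDiff]
  rw [integral_const_mul, Measure.volume_eq_prod, integral_prod_mul (μ := volume) (ν := volume)
    (fun p : ℝ => ((Real.cosh p : ℝ) : ℂ) ^ (-((ε + Complex.I * (α + β)) / 2 +
          (ε - Complex.I * (α + β)) / 2)) *
        Complex.exp (((ε + Complex.I * (α + β)) / 2 - (ε - Complex.I * (α + β)) / 2) * p))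
    (fun p : ℝ => ((Real.cosh p : ℝ) : ℂ) ^ (-((ε + Complex.I * (α - β)) / 2 +
          (ε - Complex.I * (α - β)) / 2)) *
        Complex.exp (((ε + Complex.I * (α - β)) / 2 - (ε - Complex.I * (α - β)) / 2) * p)),
    integral_cosh_cpow_mul_exp (by simpa using re_half_add_pos hε (α + β))
      (by simpa using re_half_sub_pos hε (α + β)),
    integral_cosh_cpow_mul_exp (by simpa using re_half_add_pos hε (α - β))
      (by simpa using re_half_sub_pos hε (α - β)),
    show (ε + Complex.I * (α + β)) / 2 + (ε - Complex.I * (α + β)) / 2 = (ε : ℂ) by ring,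
    show (ε + Complex.I * (α - β)) / 2 + (ε - Complex.I * (α - β)) / 2 = (ε : ℂ) by ring]
  have e : 2 * (2 : ℂ) ^ (-ε : ℂ) * 2 ^ (ε - 1 : ℂ) = 1 := by
    rw [mul_assoc, ← Complex.cpow_add _ _ two_ne_zero,
      show (-ε : ℂ) + (ε - 1) = -1 by ring, Complex.cpow_neg_one]
    norm_num
  linear_combination (2 ^ (ε - 1 : ℂ) / Complex.Gamma ε ^ 2 *
      (Complex.Gamma ((ε + Complex.I * (α + β)) / 2) *
        Complex.Gamma ((ε - Complex.I * (α + β)) / 2) *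
      (Complex.Gamma ((ε + Complex.I * (α - β)) / 2) *
        Complex.Gamma ((ε - Complex.I * (α - β)) / 2)))) * e

/-- The integrand of the triple integral representation of `∫ x^(ε-1) K_{iα}(x) K_{iβ}(x) dx`. -/
noncomputable def tripleKK (ε α β : ℝ) (w : ℝ × ℝ × ℝ) : ℂ :=
  ((w.1 ^ (ε - 1) : ℝ) : ℂ) / 4 *
    (Complex.exp (Complex.I * α * w.2.1 - w.1 * Real.cosh w.2.1) *
      Complex.exp (Complex.I * β * w.2.2 - w.1 * Real.cosh w.2.2))

theorem measurable_tripleKK (ε α β : ℝ) : Measurable (tripleKK ε α β) := by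
  refine Measurable.mul ?_ (Continuous.measurable (by fun_prop))
  exact (Complex.measurable_ofReal.comp (measurable_fst.pow_const _)).div_const _

theorem tripleKK_eq (ε α β : ℝ) (w : ℝ × ℝ × ℝ) :
    tripleKK ε α β w = Complex.exp (Complex.I * α * w.2.1 + Complex.I * β * w.2.2) / 4 *
      ((w.1 ^ (ε - 1) * Real.exp (-((Real.cosh w.2.1 + Real.cosh w.2.2) * w.1)) : ℝ) : ℂ) := by
  rw [tripleKK, ← Complex.exp_add]
  have : Complex.I * α * w.2.1 - w.1 * Real.cosh w.2.1 +
      (Complex.I * β * w.2.2 - w.1 * Real.cosh w.2.2) =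
      (Complex.I * α * w.2.1 + Complex.I * β * w.2.2) +
      ((-((Real.cosh w.2.1 + Real.cosh w.2.2) * w.1) : ℝ) : ℂ) := by
    push_cast; ring
  rw [this, Complex.exp_add]
  push_cast
  ring

theorem norm_exp_I_mul_add (α β t u : ℝ) :
    ‖Complex.exp (Complex.I * α * t + Complex.I * β * u)‖ = 1 := by
  rw [show Complex.I * α * t + Complex.I * β * u = ((α * t + β * u : ℝ) : ℂ) * Complex.I by
    push_cast; ring, Complex.norm_exp_ofReal_mul_I]

theorem norm_tripleKK (ε α β : ℝ) {w : ℝ × ℝ × ℝ} (hw : 0 < w.1) :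
    ‖tripleKK ε α β w‖ =
      w.1 ^ (ε - 1) * Real.exp (-((Real.cosh w.2.1 + Real.cosh w.2.2) * w.1)) / 4 := by
  rw [tripleKK_eq, norm_mul, norm_div, norm_exp_I_mul_add, Complex.norm_real,
    Real.norm_of_nonneg (mul_nonneg (Real.rpow_nonneg hw.le _) (Real.exp_pos _).le)]
  norm_num
  ring

theorem integrable_tripleKK {ε : ℝ} (hε : 0 < ε) (α β : ℝ) :
    Integrable (tripleKK ε α β)
      ((volume.restrict (Ioi (0 : ℝ))).prod (volume : Measure (ℝ × ℝ))) := by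
  rw [integrable_prod_iff' (measurable_tripleKK ε α β).aestronglyMeasurable]
  have hint : ∀ z : ℝ × ℝ, Integrable (fun x : ℝ => x ^ (ε - 1) *
      Real.exp (-((Real.cosh z.1 + Real.cosh z.2) * x))) (volume.restrict (Ioi (0 : ℝ))) := by
    intro z
    have h := Real.integral_rpow_mul_exp_neg_mul_Ioi hε (cosh_add_cosh_pos z.1 z.2)
    refine Integrable.of_integral_ne_zero ?_
    rw [h]
    have := cosh_add_cosh_pos z.1 z.2
    have := Real.Gamma_pos_of_pos hε
    positivity
  have hnorm : ∀ z : ℝ × ℝ, ∫ x in Ioi (0 : ℝ), ‖tripleKK ε α β (x, z)‖ =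
      Real.Gamma ε / 4 * ‖coshSumKernel ε α β z‖ := by
    intro z
    have h := Real.integral_rpow_mul_exp_neg_mul_Ioi hε (cosh_add_cosh_pos z.1 z.2)
    rw [setIntegral_congr_fun measurableSet_Ioi fun x hx => norm_tripleKK ε α β (w := (x, z)) hx]
    simp only
    rw [integral_div, h, coshSumKernel, norm_mul, norm_exp_I_mul_add, Complex.norm_real,
      Real.norm_of_nonneg (Real.rpow_nonneg (cosh_add_cosh_pos _ _).le _),
      Real.rpow_neg (cosh_add_cosh_pos _ _).le, one_div, Real.inv_rpow (cosh_add_cosh_pos _ _).le]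
    ring
  constructor
  · refine ae_of_all _ fun z => ?_
    simp only [tripleKK_eq]
    exact ((hint z).ofReal (𝕜 := ℂ)).const_mul _
  · simp only [hnorm]
    exact (integrable_coshSumKernel hε α β).norm.const_mul _

theorem kernelKK_eq_integral {ν α β x : ℝ} (hx : 0 < x) :
    kernelKK ν α β x = ∫ z : ℝ × ℝ, tripleKK (1 - ν) α β (x, z) := by
  simp only [tripleKK]
  rw [integral_const_mul, Measure.volume_eq_prod, integral_prod_mul (μ := volume) (ν := volume)
    (fun t : ℝ => Complex.exp (Complex.I * α * t - x * Real.cosh t))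
    (fun t : ℝ => Complex.exp (Complex.I * β * t - x * Real.cosh t)), kernelKK,
    besselK_I_mul_eq_macdonaldInt hx, besselK_I_mul_eq_macdonaldInt hx, macdonaldInt,
    macdonaldInt, show 1 - ν - 1 = -ν by ring]
  ring

theorem integrableOn_kernelKK {ν : ℝ} (hν : ν < 1) (α β : ℝ) :
    IntegrableOn (kernelKK ν α β) (Ioi 0) := by
  have h := (integrable_tripleKK (sub_pos.mpr hν) α β).integral_prod_left
  refine h.congr ?_
  filter_upwards [ae_restrict_mem measurableSet_Ioi] with x hx
  exact (kernelKK_eq_integral hx).symm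

theorem regKK_eq {ε : ℝ} (hε : 0 < ε) (α β : ℝ) :
    regKK (1 - ε) α β = 2 ^ (ε - 3 : ℂ) / Complex.Gamma ε *
      (Complex.Gamma ((ε + Complex.I * (α + β)) / 2) *
        Complex.Gamma ((ε - Complex.I * (α + β)) / 2) *
      (Complex.Gamma ((ε + Complex.I * (α - β)) / 2) *
        Complex.Gamma ((ε - Complex.I * (α - β)) / 2))) := by
  rw [regKK, setIntegral_congr_fun measurableSet_Ioi fun x hx => kernelKK_eq_integral hx]
  simp only [sub_sub_cancel]
  rw [integral_integral_swap (f := fun x z => tripleKK ε α β (x, z)) (integrable_tripleKK hε α β)]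
  have hin : ∀ z : ℝ × ℝ, ∫ x in Ioi (0 : ℝ), tripleKK ε α β (x, z) =
      Complex.Gamma ε / 4 * coshSumKernel ε α β z := by
    intro z
    have h := Real.integral_rpow_mul_exp_neg_mul_Ioi hε (cosh_add_cosh_pos z.1 z.2)
    simp only [tripleKK_eq]
    rw [integral_const_mul, integral_complex_ofReal, h, coshSumKernel,
      Real.rpow_neg (cosh_add_cosh_pos _ _).le, one_div, Real.inv_rpow (cosh_add_cosh_pos _ _).le,
      Complex.Gamma_ofReal]
    push_cast
    ring
  simp only [hin]
  rw [integral_const_mul, integral_coshSumKernel hε]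
  have hG : Complex.Gamma ε ≠ 0 := Complex.Gamma_ne_zero_of_re_pos (by simpa using hε)
  have e : (2 : ℂ) ^ (ε - 1 : ℂ) = 2 ^ (ε - 3 : ℂ) * 4 := by
    rw [show (ε - 1 : ℂ) = (ε - 3) + 2 by ring, Complex.cpow_add _ _ two_ne_zero,
      Complex.cpow_ofNat]
    norm_num
  rw [e]
  field_simp

theorem hasDerivAt_besselF_sq {μ : ℂ} (hμ : -(1 / 2) ≤ μ.re) (x : ℝ) :
    HasDerivAt (fun x : ℝ => besselF μ (((x : ℂ) / 2) ^ 2))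
      (-besselF (μ + 1) (((x : ℂ) / 2) ^ 2) * (x / 2)) x := by
  have h1 : HasDerivAt (fun z : ℂ => (z / 2) ^ 2) ((x : ℂ) / 2) (x : ℂ) := by
    refine (((hasDerivAt_id (x : ℂ)).div_const 2).pow 2).congr_deriv ?_
    simp
    ring
  exact ((hasDerivAt_besselF hμ (((x : ℂ) / 2) ^ 2)).comp (x : ℂ) h1).comp_ofReal

theorem hasDerivAt_ofReal_cpow_pos (r : ℂ) {x : ℝ} (hx : 0 < x) :
    HasDerivAt (fun x : ℝ => (x : ℂ) ^ r) (r * (x : ℂ) ^ (r - 1)) x := by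
  have hy0 : (x : ℂ) ∈ Complex.slitPlane := by
    rw [Complex.ofReal_mem_slitPlane]; exact hx
  simpa using ((hasDerivAt_id (x : ℂ)).cpow_const (c := r) hy0).comp_ofReal

/-- The Liouville normal form `x^(μ + 1/2) F_μ(x²/4)` of the Bessel function. -/
noncomputable def besselU (μ : ℂ) (x : ℝ) : ℂ :=
  (x : ℂ) ^ (μ + 1 / 2) * besselF μ (((x : ℂ) / 2) ^ 2)

/-- The derivative of `besselU`. -/
noncomputable def besselU' (μ : ℂ) (x : ℝ) : ℂ :=
  (x : ℂ) ^ (μ - 1 / 2) * ((μ + 1 / 2) * besselF μ (((x : ℂ) / 2) ^ 2) -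
    x ^ 2 / 2 * besselF (μ + 1) (((x : ℂ) / 2) ^ 2))

theorem hasDerivAt_besselU {μ : ℂ} (hμ : -(1 / 2) ≤ μ.re) {x : ℝ} (hx : 0 < x) :
    HasDerivAt (besselU μ) (besselU' μ x) x := by
  refine ((hasDerivAt_ofReal_cpow_pos (μ + 1 / 2) hx).mul
    (hasDerivAt_besselF_sq hμ x)).congr_deriv ?_
  have hx0 : (x : ℂ) ≠ 0 := by exact_mod_cast hx.ne'
  rw [besselU', show μ + 1 / 2 = (μ - 1 / 2) + 1 by ring, Complex.cpow_add _ _ hx0,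
    Complex.cpow_one, add_sub_cancel_right]
  ring

theorem hasDerivAt_besselU' {μ : ℂ} (hμ : -(1 / 2) ≤ μ.re) {x : ℝ} (hx : 0 < x) :
    HasDerivAt (besselU' μ) (-(1 + (1 / 4 - μ ^ 2) / x ^ 2) * besselU μ x) x := by
  have hx0 : (x : ℂ) ≠ 0 := by exact_mod_cast hx.ne'
  have hμ1 : -(1 / 2) ≤ (μ + 1).re := by simp; linarith
  have hsq : HasDerivAt (fun x : ℝ => (x : ℂ) ^ 2 / 2) (x : ℂ) x := by
    have h : HasDerivAt (fun z : ℂ => z ^ 2 / 2) (x : ℂ) (x : ℂ) := by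
      refine ((hasDerivAt_pow 2 (x : ℂ)).div_const 2).congr_deriv ?_
      simp
    exact h.comp_ofReal
  refine ((hasDerivAt_ofReal_cpow_pos (μ - 1 / 2) hx).mul
    (((hasDerivAt_besselF_sq hμ x).const_mul (μ + 1 / 2)).sub
      (hsq.mul (hasDerivAt_besselF_sq hμ1 x)))).congr_deriv ?_
  have hc := besselF_contiguous hμ (((x : ℂ) / 2) ^ 2)
  have e1 : (x : ℂ) ^ (μ - 1 / 2) = (x : ℂ) ^ (μ - 1 / 2 - 1) * x := by
    rw [Complex.cpow_sub _ 1 hx0, Complex.cpow_one, div_mul_cancel₀ _ hx0]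
  have e2 : (x : ℂ) ^ (μ + 1 / 2) = (x : ℂ) ^ (μ - 1 / 2 - 1) * x ^ 2 := by
    rw [← Complex.cpow_natCast, ← Complex.cpow_add _ _ hx0]
    congr 1; push_cast; ring
  rw [show μ + 1 + 1 = μ + 2 by ring, besselU, e1, e2]
  simp only [Pi.sub_apply, Pi.mul_apply]
  have e3 : ∀ P F : ℂ, -(1 + (1 / 4 - μ ^ 2) / (x : ℂ) ^ 2) * (P * x ^ 2 * F) =
      -P * (x ^ 2 + (1 / 4 - μ ^ 2)) * F := fun P F => by
    field_simp
  rw [e3]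
  linear_combination ((x : ℂ) ^ (μ - 1 / 2 - 1) * x ^ 2) * hc

theorem antitoneOn_besselEnergy (α : ℝ) :
    AntitoneOn (fun x : ℝ => ‖besselU' (Complex.I * α) x‖ ^ 2 +
      (1 + (1 / 4 + α ^ 2) / x ^ 2) * ‖besselU (Complex.I * α) x‖ ^ 2) (Ici 1) := by
  have hμ : -(1 / 2) ≤ (Complex.I * (α : ℂ)).re := by simp
  have hd : ∀ x : ℝ, 0 < x → HasDerivAt (fun x : ℝ => ‖besselU' (Complex.I * α) x‖ ^ 2 +
      (1 + (1 / 4 + α ^ 2) / x ^ 2) * ‖besselU (Complex.I * α) x‖ ^ 2)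
      (-(2 * (1 / 4 + α ^ 2) / x ^ 3) * ‖besselU (Complex.I * α) x‖ ^ 2) x := by
    intro x hx
    have h1 := (hasDerivAt_besselU' hμ hx).norm_sq
    have h2 := (hasDerivAt_besselU hμ hx).norm_sq
    have h3 : HasDerivAt (fun x : ℝ => 1 + (1 / 4 + α ^ 2) / x ^ 2)
        (-(2 * (1 / 4 + α ^ 2) / x ^ 3)) x := by
      refine (((hasDerivAt_const x (1 / 4 + α ^ 2)).div (hasDerivAt_pow 2 x)
        (by positivity)).const_add 1).congr_deriv ?_
      field_simp
      ring
    refine (h1.add (h3.mul h2)).congr_deriv ?_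
    have e : -(1 + (1 / 4 - (Complex.I * (α : ℂ)) ^ 2) / (x : ℂ) ^ 2) * besselU (Complex.I * α) x =
        (-(1 + (1 / 4 + α ^ 2) / x ^ 2) : ℝ) • besselU (Complex.I * α) x := by
      rw [Complex.real_smul, mul_pow, Complex.I_sq]
      push_cast
      ring
    rw [e, inner_smul_right, real_inner_comm]
    ring
  refine antitoneOn_of_deriv_nonpos (convex_Ici 1) ?_ ?_ ?_
  · exact fun x hx => (hd x (zero_lt_one.trans_le hx)).continuousAt.continuousWithinAt
  · rw [interior_Ici]
    exact fun x hx => (hd x (zero_lt_one.trans hx)).differentiableAt.differentiableWithinAt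
  · rw [interior_Ici]
    intro x hx
    have hx0 : 0 < x := zero_lt_one.trans hx
    rw [(hd x hx0).deriv, neg_mul]
    have : 0 ≤ 2 * (1 / 4 + α ^ 2) / x ^ 3 * ‖besselU (Complex.I * α) x‖ ^ 2 := by positivity
    linarith

/-- A constant, continuous in `α`, such that `|J_{iα}(x)| ≤ C min(1, x^(-1/2))`. -/
noncomputable def besselJConst (α : ℝ) : ℝ :=
  √(‖besselU' (Complex.I * α) 1‖ ^ 2 + (5 / 4 + α ^ 2) * ‖besselU (Complex.I * α) 1‖ ^ 2) +
    ‖(Complex.Gamma (Complex.I * α + 1))⁻¹‖ * Real.exp 1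

theorem continuous_besselF_I_mul (c z : ℂ) (hc : -(1 / 2) ≤ c.re) :
    Continuous fun α : ℝ => besselF (Complex.I * α + c) z := by
  refine (continuousOn_besselF_order z).comp_continuous (by fun_prop) fun α => ?_
  simpa using hc

theorem continuous_besselJConst : Continuous besselJConst := by
  have h0 := continuous_besselF_I_mul 0 (((1 : ℝ) / 2 : ℂ) ^ 2) (by simp)
  have h1 := continuous_besselF_I_mul 1 (((1 : ℝ) / 2 : ℂ) ^ 2) (by simp; norm_num)
  simp only [add_zero] at h0
  have hG : Continuous fun α : ℝ => (Complex.Gamma (Complex.I * α + 1))⁻¹ :=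
    continuous_inv_Gamma (by fun_prop)
  unfold besselJConst besselU besselU'
  simp only [Complex.ofReal_one, Complex.one_cpow, one_mul] at h0 h1 ⊢
  fun_prop

theorem besselJConst_nonneg (α : ℝ) : 0 ≤ besselJConst α := by
  unfold besselJConst; positivity

theorem norm_ofReal_cpow_I_mul {x : ℝ} (hx : 0 < x) (α : ℝ) :
    ‖((x : ℂ)) ^ (Complex.I * α)‖ = 1 := by
  rw [Complex.norm_cpow_eq_rpow_re_of_pos hx]; simp

theorem norm_besselJ_eq {x : ℝ} (hx : 0 < x) (α : ℝ) :
    ‖besselJ (Complex.I * α) x‖ = ‖besselF (Complex.I * α) (((x : ℂ) / 2) ^ 2)‖ := by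
  rw [besselJ_eq hx, norm_mul, show ((x : ℂ) / 2) = ((x / 2 : ℝ) : ℂ) by push_cast; rfl,
    norm_ofReal_cpow_I_mul (half_pos hx), one_mul]

theorem norm_besselU_eq {x : ℝ} (hx : 0 < x) (α : ℝ) :
    ‖besselU (Complex.I * α) x‖ = x ^ (1 / 2 : ℝ) * ‖besselJ (Complex.I * α) x‖ := by
  rw [norm_besselJ_eq hx, besselU, norm_mul, Complex.norm_cpow_eq_rpow_re_of_pos hx]
  norm_num

theorem norm_besselJ_le {x : ℝ} (hx : 0 < x) (α : ℝ) :
    ‖besselJ (Complex.I * α) x‖ ≤ besselJConst α * min 1 (x ^ (-(1 / 2) : ℝ)) := by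
  rcases le_total x 1 with h1 | h1
  · rw [min_eq_left (Real.one_le_rpow_of_pos_of_le_one_of_nonpos hx h1 (by norm_num)), mul_one,
      norm_besselJ_eq hx]
    have hz : ‖(((x : ℂ) / 2) ^ 2)‖ ≤ 1 / 2 := by
      rw [norm_pow, norm_div, Complex.norm_real, Real.norm_of_nonneg hx.le]
      norm_num
      nlinarith
    refine (norm_besselF_le (by simp) _).trans ?_
    refine le_trans ?_ (le_add_of_nonneg_left (Real.sqrt_nonneg _))
    gcongr
    linarith
  · rw [min_eq_right (Real.rpow_le_one_of_one_le_of_nonpos h1 (by norm_num))]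
    have hE := antitoneOn_besselEnergy α (mem_Ici.mpr le_rfl) (mem_Ici.mpr h1) h1
    simp only at hE
    have h2 : ‖besselU (Complex.I * α) x‖ ^ 2 ≤ ‖besselU' (Complex.I * α) 1‖ ^ 2 +
        (5 / 4 + α ^ 2) * ‖besselU (Complex.I * α) 1‖ ^ 2 := by
      have h3 : 0 ≤ (1 / 4 + α ^ 2) / x ^ 2 * ‖besselU (Complex.I * α) x‖ ^ 2 := by positivity
      have h4 : 0 ≤ ‖besselU' (Complex.I * α) x‖ ^ 2 := by positivity
      norm_num at hE
      linarith
    have h5 := Real.le_sqrt_of_sq_le h2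
    rw [norm_besselU_eq hx] at h5
    have h6 : ‖besselJ (Complex.I * α) x‖ =
        x ^ (1 / 2 : ℝ) * ‖besselJ (Complex.I * α) x‖ * x ^ (-(1 / 2) : ℝ) := by
      rw [mul_right_comm, ← Real.rpow_add hx]; norm_num
    rw [h6]
    refine mul_le_mul_of_nonneg_right (h5.trans ?_) (by positivity)
    exact le_add_of_nonneg_right (by positivity)

theorem continuousOn_besselJ {μ : ℂ} (hμ : -(1 / 2) ≤ μ.re) :
    ContinuousOn (besselJ μ) (Ioi 0) := by
  intro x hx
  have h1 : ContinuousAt (fun x : ℝ => ((x : ℂ) / 2) ^ μ * besselF μ (((x : ℂ) / 2) ^ 2)) x := by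
    refine ContinuousAt.mul ?_ (hasDerivAt_besselF_sq hμ x).continuousAt
    refine ContinuousAt.cpow (by fun_prop) continuousAt_const ?_
    have : 0 < x := hx
    rw [show ((x : ℂ) / 2) = ((x / 2 : ℝ) : ℂ) by push_cast; rfl, Complex.ofReal_mem_slitPlane]
    positivity
  refine (h1.congr ?_).continuousWithinAt
  filter_upwards [Ioi_mem_nhds hx] with y hy
  exact (besselJ_eq hy μ).symm

theorem continuous_besselJ_order {x : ℝ} (hx : 0 < x) :
    Continuous fun α : ℝ => besselJ (Complex.I * α) x := by
  have h0 := continuous_besselF_I_mul 0 (((x : ℂ) / 2) ^ 2) (by simp)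
  simp only [add_zero] at h0
  simp only [besselJ_eq hx]
  have hx0 : (x : ℂ) / 2 ≠ 0 := by simp [hx.ne']
  refine Continuous.mul ?_ h0
  exact Continuous.const_cpow (by fun_prop) (Or.inl hx0)

theorem integrableOn_rpow_mul_min {l : ℝ} (n : ℕ) (h1 : l < 1) (h2 : 1 < l + n / 2) :
    IntegrableOn (fun x : ℝ => x ^ (-l) * (min 1 (x ^ (-(1 / 2) : ℝ))) ^ n) (Ioi 0) := by
  have hm : Measurable fun x : ℝ => x ^ (-l) * (min 1 (x ^ (-(1 / 2) : ℝ))) ^ n := by fun_prop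
  rw [← Ioc_union_Ioi_eq_Ioi (zero_le_one (α := ℝ)), integrableOn_union]
  constructor
  · have h : IntegrableOn (fun x : ℝ => x ^ (-l)) (Ioc 0 1) := by
      rw [← intervalIntegrable_iff_integrableOn_Ioc_of_le zero_le_one]
      exact intervalIntegral.intervalIntegrable_rpow' (by linarith)
    refine h.mono' hm.aestronglyMeasurable ?_
    filter_upwards [ae_restrict_mem measurableSet_Ioc] with x hx
    have hx0 := hx.1.le
    rw [Real.norm_of_nonneg (by positivity)]
    exact mul_le_of_le_one_right (by positivity) (pow_le_one₀ (by positivity) (min_le_left _ _))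
  · have h : IntegrableOn (fun x : ℝ => x ^ (-l + -(1 / 2) * n)) (Ioi 1) :=
      integrableOn_Ioi_rpow_of_lt (by linarith) zero_lt_one
    refine h.mono' hm.aestronglyMeasurable ?_
    filter_upwards [ae_restrict_mem measurableSet_Ioi] with x hx
    have hx0 : 0 < x := zero_lt_one.trans hx
    rw [Real.norm_of_nonneg (by positivity), Real.rpow_add hx0, Real.rpow_mul_natCast hx0.le]
    gcongr
    exact min_le_right _ _

theorem norm_kernelJJ_le {ν x : ℝ} (hx : 0 < x) (α β : ℝ) :
    ‖kernelJJ ν α β x‖ ≤ besselJConst α * besselJConst β *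
      (x ^ (-ν) * (min 1 (x ^ (-(1 / 2) : ℝ))) ^ 2) := by
  rw [kernelJJ, norm_mul, norm_mul, Complex.norm_real, Real.norm_of_nonneg (by positivity)]
  calc _ ≤ x ^ (-ν) * (besselJConst α * min 1 (x ^ (-(1 / 2) : ℝ))) *
        (besselJConst β * min 1 (x ^ (-(1 / 2) : ℝ))) := by
        gcongr
        · exact mul_nonneg (by positivity) (mul_nonneg (besselJConst_nonneg _) (by positivity))
        · exact norm_besselJ_le hx α
        · exact norm_besselJ_le hx β
    _ = _ := by ring

theorem aestronglyMeasurable_kernelJJ (ν α β : ℝ) :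
    AEStronglyMeasurable (kernelJJ ν α β) (volume.restrict (Ioi 0)) := by
  have h1 : Measurable fun x : ℝ => ((x ^ (-ν) : ℝ) : ℂ) := by fun_prop
  exact (h1.aestronglyMeasurable.mul ((continuousOn_besselJ (by simp)).aestronglyMeasurable
    measurableSet_Ioi)).mul ((continuousOn_besselJ (by simp)).aestronglyMeasurable
    measurableSet_Ioi)

theorem integrableOn_kernelJJ {ν : ℝ} (h0 : 0 < ν) (h1 : ν < 1) (α β : ℝ) :
    IntegrableOn (kernelJJ ν α β) (Ioi 0) := by
  refine ((integrableOn_rpow_mul_min 2 h1 (by norm_num; linarith)).const_mul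
    (besselJConst α * besselJConst β)).mono' (aestronglyMeasurable_kernelJJ ν α β) ?_
  filter_upwards [ae_restrict_mem measurableSet_Ioi] with x hx
  exact norm_kernelJJ_le hx α β

theorem continuous_regJJ {ν : ℝ} (h0 : 0 < ν) (h1 : ν < 1) :
    Continuous fun p : ℝ × ℝ => regJJ ν p.1 p.2 := by
  rw [continuous_iff_continuousAt]
  intro p
  have hc : Continuous fun q : ℝ × ℝ => besselJConst q.1 * besselJConst q.2 :=
    (continuous_besselJConst.comp continuous_fst).mul
      (continuous_besselJConst.comp continuous_snd)
  refine continuousAt_of_dominated (bound := fun x => (besselJConst p.1 * besselJConst p.2 + 1) *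
    (x ^ (-ν) * (min 1 (x ^ (-(1 / 2) : ℝ))) ^ 2))
    (Eventually.of_forall fun q => aestronglyMeasurable_kernelJJ ν q.1 q.2) ?_
    ((integrableOn_rpow_mul_min 2 h1 (by norm_num; linarith)).const_mul _) ?_
  · filter_upwards [hc.continuousAt.eventually_lt (continuousAt_const (y := besselJConst p.1 *
      besselJConst p.2 + 1)) (lt_add_one _)] with q hq
    filter_upwards [ae_restrict_mem measurableSet_Ioi] with x hx
    have hx0 : 0 < x := hx
    exact (norm_kernelJJ_le hx0 q.1 q.2).trans (by gcongr)
  · filter_upwards [ae_restrict_mem measurableSet_Ioi] with x hx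
    have hJ := continuous_besselJ_order hx
    exact ((continuous_const.mul (hJ.comp continuous_fst)).mul
      (hJ.comp continuous_snd)).continuousAt

theorem integrable_regJJ_mul {ν : ℝ} (h0 : 0 < ν) (h1 : ν < 1) {f : ℝ × ℝ → ℂ}
    (hf : Continuous f) (hs : HasCompactSupport f) :
    Integrable fun p : ℝ × ℝ => regJJ ν p.1 p.2 * f p :=
  ((continuous_regJJ h0 h1).mul hf).integrable_of_hasCompactSupport hs.mul_left

theorem one_add_I_mul_mem_slitPlane (t : ℝ) : 1 + Complex.I * t ∈ Complex.slitPlane :=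
  Or.inl (by simp)

theorem one_sub_I_mul_mem_slitPlane (t : ℝ) : 1 - Complex.I * t ∈ Complex.slitPlane :=
  Or.inl (by simp)

/-- The function `(1 + it)^(-a) (1 - it)^(-b)`. -/
noncomputable def cauchyKernel (a b : ℂ) (t : ℝ) : ℂ :=
  (1 + Complex.I * t) ^ (-a) * (1 - Complex.I * t) ^ (-b)

theorem norm_cpow_le_mul_exp {z : ℂ} (hz : z ≠ 0) (w : ℂ) :
    ‖z ^ w‖ ≤ ‖z‖ ^ w.re * Real.exp (Real.pi * |w.im|) := by
  rw [Complex.norm_cpow_of_ne_zero hz, div_eq_mul_inv, ← Real.exp_neg]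
  gcongr
  refine (le_abs_self _).trans ?_
  rw [abs_neg, abs_mul]
  exact mul_le_mul_of_nonneg_right (Complex.abs_arg_le_pi z) (abs_nonneg _)

theorem norm_one_add_I_mul (t : ℝ) : ‖1 + Complex.I * (t : ℂ)‖ = (1 + t ^ 2) ^ (1 / 2 : ℝ) := by
  rw [← Real.sqrt_eq_rpow, mul_comm]
  have := Complex.norm_add_mul_I 1 t
  simpa using this

theorem norm_one_sub_I_mul (t : ℝ) : ‖1 - Complex.I * (t : ℂ)‖ = (1 + t ^ 2) ^ (1 / 2 : ℝ) := by
  have h := norm_one_add_I_mul (-t)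
  rwa [Complex.ofReal_neg, mul_neg, ← sub_eq_add_neg, neg_sq] at h

theorem norm_cauchyKernel_le (a b : ℂ) (t : ℝ) :
    ‖cauchyKernel a b t‖ ≤ Real.exp (Real.pi * (|a.im| + |b.im|)) *
      (1 + t ^ 2) ^ (-(a + b).re / 2) := by
  have h1 := norm_cpow_le_mul_exp (Complex.slitPlane_ne_zero (one_add_I_mul_mem_slitPlane t)) (-a)
  have h2 := norm_cpow_le_mul_exp (Complex.slitPlane_ne_zero (one_sub_I_mul_mem_slitPlane t)) (-b)
  have hp : (0 : ℝ) < 1 + t ^ 2 := by positivity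
  rw [norm_one_add_I_mul, ← Real.rpow_mul hp.le, Complex.neg_re, Complex.neg_im, abs_neg] at h1
  rw [norm_one_sub_I_mul, ← Real.rpow_mul hp.le, Complex.neg_re, Complex.neg_im, abs_neg] at h2
  rw [cauchyKernel, norm_mul]
  refine (mul_le_mul h1 h2 (norm_nonneg _) (by positivity)).trans (le_of_eq ?_)
  rw [mul_mul_mul_comm, ← Real.rpow_add hp, ← Real.exp_add, mul_comm, Complex.add_re]
  congr 2 <;> ring

theorem continuous_cauchyKernel (a b : ℂ) : Continuous (cauchyKernel a b) := by
  refine Continuous.mul ?_ ?_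
  · exact Continuous.cpow (by fun_prop) continuous_const one_add_I_mul_mem_slitPlane
  · exact Continuous.cpow (by fun_prop) continuous_const one_sub_I_mul_mem_slitPlane

theorem integrable_one_add_sq_rpow {r : ℝ} (hr : 1 < r) :
    Integrable fun t : ℝ => (1 + t ^ 2) ^ (-r / 2) := by
  have h := integrable_rpow_neg_one_add_norm_sq (E := ℝ) (μ := volume) (r := r) (by simpa using hr)
  simpa using h

theorem integrable_cauchyKernel {a b : ℂ} (h : 1 < (a + b).re) :
    Integrable (cauchyKernel a b) :=
  ((integrable_one_add_sq_rpow h).const_mul _).mono' (continuous_cauchyKernel a b).aestronglyMeasurable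
    (ae_of_all _ (norm_cauchyKernel_le a b))

theorem one_div_cpow_of_mem_slitPlane {z : ℂ} (hz : z ∈ Complex.slitPlane) (a : ℂ) :
    (1 / z) ^ a = z ^ (-a) := by
  rw [one_div, Complex.inv_cpow _ _ (Complex.slitPlane_arg_ne_pi hz), Complex.cpow_neg]

theorem integrableOn_cpow_mul_cexp_neg {a r : ℂ} (ha : 0 < a.re) (hr : 0 < r.re) :
    IntegrableOn (fun x : ℝ => (x : ℂ) ^ (a - 1) * Complex.exp (-(r * x))) (Ioi 0) := by
  have h1 := integrableOn_cpow_mul_exp_neg_Ioc (w := r.re) ha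
  have h2 := integrableOn_cpow_mul_exp_neg_Ioi_one (a - 1) (w := r.re) hr
  have h3 := h1.union h2
  rw [Ioc_union_Ioi_eq_Ioi zero_le_one] at h3
  have hc : Continuous fun x : ℝ => Complex.exp (-((r - r.re) * x)) := by fun_prop
  refine (h3.bdd_mul (c := 1) hc.aestronglyMeasurable (ae_of_all _ fun x => ?_)).congr
    (ae_of_all _ fun x => ?_)
  · rw [Complex.norm_exp, Complex.neg_re, Complex.re_mul_ofReal]
    simp
  · simp only
    rw [mul_left_comm, ← Complex.exp_add]
    congr 2
    ring

theorem hasDerivAt_integral_cpow_mul_cexp_neg {a r : ℂ} (ha : 0 < a.re) (hr : 0 < r.re) :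
    HasDerivAt (fun r : ℂ => ∫ x in Ioi (0 : ℝ), (x : ℂ) ^ (a - 1) * Complex.exp (-(r * x)))
      (∫ x in Ioi (0 : ℝ), (x : ℂ) ^ (a - 1) * (Complex.exp (-(r * x)) * -x)) r := by
  have hs : {z : ℂ | r.re / 2 < z.re} ∈ 𝓝 r :=
    (isOpen_lt continuous_const Complex.continuous_re).mem_nhds (by simp; linarith)
  have hb := (integrableOn_cpow_mul_cexp_neg (a := a + 1) (r := r / 2)
    (by simp; linarith) (by simp; linarith)).norm
  have ha' : ∀ x : ℝ, 0 < x → (x : ℂ) ^ (a + 1 - 1) = (x : ℂ) ^ (a - 1) * x := fun x hx => by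
    have hx0 : (x : ℂ) ≠ 0 := by exact_mod_cast hx.ne'
    rw [show a + 1 - 1 = (a - 1) + 1 by ring, Complex.cpow_add _ _ hx0, Complex.cpow_one]
  have hm : ∀ r : ℂ, ContinuousOn (fun x : ℝ => (x : ℂ) ^ (a - 1) *
      (Complex.exp (-(r * x)) * -x)) (Ioi 0) := by
    intro r x hx
    refine ContinuousAt.continuousWithinAt (ContinuousAt.mul ?_ (by fun_prop))
    exact Complex.continuousAt_ofReal_cpow_const x _ (Or.inr (ne_of_gt hx))
  have hm' : ∀ r : ℂ, ContinuousOn (fun x : ℝ => (x : ℂ) ^ (a - 1) *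
      Complex.exp (-(r * x))) (Ioi 0) := by
    intro r x hx
    refine ContinuousAt.continuousWithinAt (ContinuousAt.mul ?_ (by fun_prop))
    exact Complex.continuousAt_ofReal_cpow_const x _ (Or.inr (ne_of_gt hx))
  refine (hasDerivAt_integral_of_dominated_loc_of_deriv_le hs
    (Eventually.of_forall fun z => (hm' z).aestronglyMeasurable measurableSet_Ioi)
    (integrableOn_cpow_mul_cexp_neg ha hr)
    (F' := fun r x => (x : ℂ) ^ (a - 1) * (Complex.exp (-(r * x)) * -x))
    ((hm r).aestronglyMeasurable measurableSet_Ioi) ?_ hb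
    (ae_of_all _ fun x z _ => ?_)).2
  · filter_upwards [ae_restrict_mem measurableSet_Ioi] with x hx z hz
    have hx0 : 0 < x := hx
    have hz' : r.re / 2 < z.re := hz
    rw [ha' x hx0, norm_mul, norm_mul, norm_mul, norm_mul, norm_neg, mul_assoc,
      mul_comm ‖Complex.exp _‖]
    refine mul_le_mul_of_nonneg_left (mul_le_mul_of_nonneg_left ?_ (norm_nonneg _)) (norm_nonneg _)
    rw [Complex.norm_exp, Complex.norm_exp]
    apply Real.exp_le_exp.mpr
    simp only [Complex.neg_re, Complex.re_mul_ofReal]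
    have : (r / 2).re = r.re / 2 := by simp
    rw [this]
    nlinarith
  · have h1 : HasDerivAt (fun z : ℂ => -(z * x)) (-(x : ℂ)) z := by
      exact ((hasDerivAt_id z).mul_const (x : ℂ)).neg.congr_deriv (by simp)
    exact h1.cexp.const_mul _

theorem integral_cpow_mul_cexp_neg {a r : ℂ} (ha : 0 < a.re) (hr : 0 < r.re) :
    ∫ x in Ioi (0 : ℝ), (x : ℂ) ^ (a - 1) * Complex.exp (-(r * x)) =
      r ^ (-a) * Complex.Gamma a := by
  have hUo : IsOpen {z : ℂ | 0 < z.re} := isOpen_lt continuous_const Complex.continuous_re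
  have hf : AnalyticOnNhd ℂ (fun r : ℂ => ∫ x in Ioi (0 : ℝ),
      (x : ℂ) ^ (a - 1) * Complex.exp (-(r * x))) {z : ℂ | 0 < z.re} :=
    DifferentiableOn.analyticOnNhd (fun z hz => (hasDerivAt_integral_cpow_mul_cexp_neg ha
      hz).differentiableAt.differentiableWithinAt) hUo
  have hg : AnalyticOnNhd ℂ (fun r : ℂ => r ^ (-a) * Complex.Gamma a) {z : ℂ | 0 < z.re} :=
    DifferentiableOn.analyticOnNhd (fun z hz => ((((hasDerivAt_id z).cpow_const (c := -a)
      (Or.inl hz)).mul_const _).differentiableAt.differentiableWithinAt)) hUo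
  have hpre : IsPreconnected {z : ℂ | 0 < z.re} := (convex_halfSpace_re_gt 0).isPreconnected
  refine hf.eqOn_of_preconnected_of_frequently_eq hg hpre (z₀ := 1) (by simp) ?_ hr
  have ht : Tendsto (fun x : ℝ => (x : ℂ)) (𝓝[≠] 1) (𝓝[≠] 1) := by
    refine tendsto_nhdsWithin_of_tendsto_nhds_of_eventually_within _ ?_ ?_
    · have := Complex.continuous_ofReal.tendsto 1
      rw [Complex.ofReal_one] at this
      exact this.mono_left nhdsWithin_le_nhds
    · filter_upwards [self_mem_nhdsWithin] with x hx
      simpa using hx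
  refine ht.frequently (Eventually.frequently ?_)
  filter_upwards [nhdsWithin_le_nhds (Ioi_mem_nhds (zero_lt_one (α := ℝ)))] with x hx
  have hx0 : 0 < x := hx
  rw [Complex.integral_cpow_mul_exp_neg_mul_Ioi ha hx0,
    one_div_cpow_of_mem_slitPlane (Or.inl (by simpa using hx0))]

theorem integral_exp_mul_one_add_I_mul_cpow {a : ℂ} (ha : 1 < a.re) {x : ℝ} (hx : 0 < x) :
    ∫ t : ℝ, Complex.exp (Complex.I * t * x) * (1 + Complex.I * t) ^ (-a) =
      2 * Real.pi / Complex.Gamma a * ((x : ℂ) ^ (a - 1) * Complex.exp (-x)) := by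
  have ha0 : 0 < a.re := zero_lt_one.trans ha
  have hG := Complex.Gamma_ne_zero_of_re_pos ha0
  let f : ℝ → ℂ := (Ioi (0 : ℝ)).indicator fun x : ℝ => (x : ℂ) ^ (a - 1) * Complex.exp (-x)
  have hfi : Integrable f := by
    rw [integrable_indicator_iff measurableSet_Ioi]
    simpa using integrableOn_cpow_mul_cexp_neg (a := a) (r := 1) ha0 (by simp)
  have hF : 𝓕 f = fun ξ : ℝ => Complex.Gamma a * (1 + Complex.I * (2 * Real.pi * ξ : ℝ)) ^ (-a) := by
    funext ξ
    have h := integral_cpow_mul_cexp_neg (a := a)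
      (r := 1 + Complex.I * (2 * Real.pi * ξ : ℝ)) ha0 (by simp)
    rw [mul_comm, ← h, Real.fourier_real_eq_integral_exp_smul, ← integral_indicator measurableSet_Ioi]
    congr 1
    funext y
    simp only [f, indicator]
    split_ifs with hy
    · rw [smul_eq_mul, mul_left_comm, ← Complex.exp_add]
      congr 2
      push_cast
      ring
    · simp
  have hFi : Integrable (𝓕 f) := by
    rw [hF]
    have h := (integrable_cauchyKernel (a := a) (b := 0) (by simpa using ha)).comp_mul_left'
      (R := 2 * Real.pi) (by positivity)
    refine (h.const_mul (Complex.Gamma a)).congr (ae_of_all _ fun ξ => ?_)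
    simp [cauchyKernel]
  have hcont : ContinuousAt f x := by
    have hc : ContinuousAt (fun x : ℝ => (x : ℂ) ^ (a - 1) * Complex.exp (-x)) x :=
      (Complex.continuousAt_ofReal_cpow_const x _ (Or.inr hx.ne')).mul (by fun_prop)
    refine hc.congr ?_
    filter_upwards [Ioi_mem_nhds hx] with y hy
    exact (indicator_of_mem (s := Ioi (0 : ℝ)) hy
      (fun x : ℝ => (x : ℂ) ^ (a - 1) * Complex.exp (-x))).symm
  have hinv := hfi.fourierInv_fourier_eq hFi hcont
  rw [Real.fourierInv_eq', hF] at hinv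
  have hsub := Measure.integral_comp_mul_left
    (fun t : ℝ => Complex.exp (Complex.I * t * x) * (1 + Complex.I * t) ^ (-a)) (2 * Real.pi)
  have hlhs : ∫ v : ℝ, Complex.exp ((2 * Real.pi * inner ℝ v x : ℝ) * Complex.I) •
      (Complex.Gamma a * (1 + Complex.I * (2 * Real.pi * v : ℝ)) ^ (-a)) = Complex.Gamma a *
      ∫ v : ℝ, Complex.exp (Complex.I * (2 * Real.pi * v : ℝ) * x) *
        (1 + Complex.I * (2 * Real.pi * v : ℝ)) ^ (-a) := by
    rw [← integral_const_mul]
    congr 1; funext v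
    rw [smul_eq_mul, mul_left_comm]
    congr 3
    simp
    ring
  rw [hlhs, hsub] at hinv
  have hfx : f x = (x : ℂ) ^ (a - 1) * Complex.exp (-x) := indicator_of_mem (mem_Ioi.mpr hx) _
  rw [← hfx, ← hinv, abs_of_pos (by positivity), Complex.real_smul]
  have hpi : (Real.pi : ℂ) ≠ 0 := by exact_mod_cast Real.pi_ne_zero
  push_cast
  field_simp
  simp only [mul_right_comm Complex.I]

theorem integral_cauchyKernel_of_one_lt {a b : ℂ} (ha : 1 < a.re) (hb : 0 < b.re) :
    ∫ t, cauchyKernel a b t = Real.pi * 2 ^ (2 - a - b) *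
      (Complex.Gamma (a + b - 1) / (Complex.Gamma a * Complex.Gamma b)) := by
  have hGa := Complex.Gamma_ne_zero_of_re_pos (zero_lt_one.trans ha)
  have hGb := Complex.Gamma_ne_zero_of_re_pos hb
  let H : ℝ → ℝ → ℂ := fun t x =>
    (1 + Complex.I * t) ^ (-a) * ((x : ℂ) ^ (b - 1) * Complex.exp (-((1 - Complex.I * t) * x)))
  have hexp : ∀ t x : ℝ, Complex.exp (-((1 - Complex.I * t) * x)) =
      Complex.exp (-x) * Complex.exp (Complex.I * t * x) := fun t x => by
    rw [← Complex.exp_add]; congr 1; ring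
  have hHi : Integrable (Function.uncurry H) (volume.prod (volume.restrict (Ioi (0 : ℝ)))) := by
    have h1 := integrable_cauchyKernel (a := a) (b := 0) (by simpa using ha)
    have h2 : IntegrableOn (fun x : ℝ => (x : ℂ) ^ (b - 1) * Complex.exp (-x)) (Ioi 0) := by
      simpa using integrableOn_cpow_mul_cexp_neg (a := b) (r := 1) hb (by simp)
    have h3 := h1.mul_prod h2
    have hc : Continuous fun z : ℝ × ℝ => Complex.exp (Complex.I * z.1 * z.2) := by fun_prop
    have h4 := h3.bdd_mul (c := 1) hc.aestronglyMeasurable (ae_of_all _ fun z => by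
      rw [show Complex.I * (z.1 : ℂ) * z.2 = ((z.1 * z.2 : ℝ) : ℂ) * Complex.I by push_cast; ring,
        Complex.norm_exp_ofReal_mul_I])
    refine h4.congr (ae_of_all _ fun z => ?_)
    simp only [H, Function.uncurry, hexp, cauchyKernel, neg_zero, Complex.cpow_zero]
    ring
  have hswap := integral_integral_swap hHi
  have hL : ∀ t : ℝ, ∫ x in Ioi (0 : ℝ), H t x = Complex.Gamma b * cauchyKernel a b t := by
    intro t
    have h := integral_cpow_mul_cexp_neg (a := b)
      (r := 1 - Complex.I * t) hb (by simp)
    simp only [H]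
    rw [integral_const_mul, h, cauchyKernel]
    ring
  have hR : ∀ x ∈ Ioi (0 : ℝ), ∫ t : ℝ, H t x = 2 * Real.pi / Complex.Gamma a *
      ((x : ℂ) ^ (a + b - 1 - 1) * Complex.exp (-(2 * x))) := by
    intro x hx
    have h := integral_exp_mul_one_add_I_mul_cpow ha hx
    have hx0 : (x : ℂ) ≠ 0 := by exact_mod_cast (ne_of_gt hx)
    have e : ∀ t : ℝ, H t x = ((x : ℂ) ^ (b - 1) * Complex.exp (-x)) *
        (Complex.exp (Complex.I * t * x) * (1 + Complex.I * t) ^ (-a)) := fun t => by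
      simp only [H, hexp]; ring
    simp only [e]
    rw [integral_const_mul, h, show a + b - 1 - 1 = (a - 1) + (b - 1) by ring,
      Complex.cpow_add _ _ hx0, show (-(2 * x) : ℂ) = -x + -x by ring, Complex.exp_add]
    ring
  simp only [hL] at hswap
  rw [integral_const_mul, setIntegral_congr_fun measurableSet_Ioi hR, integral_const_mul,
    integral_cpow_mul_cexp_neg (a := a + b - 1) (r := 2) (by simp; linarith) (by simp)] at hswap
  have e : (2 : ℂ) ^ (2 - a - b) = 2 * 2 ^ (-(a + b - 1)) := by
    rw [show 2 - a - b = 1 + -(a + b - 1) by ring, Complex.cpow_add _ _ two_ne_zero,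
      Complex.cpow_one]
  rw [e]
  field_simp
  field_simp at hswap
  linear_combination hswap

theorem integral_cauchyKernel_recurrence {a b : ℂ} (h : 1 < (a + b).re) :
    (a + b - 1) * ∫ t, cauchyKernel a b t = 2 * a * ∫ t, cauchyKernel (a + 1) b t := by
  have hd : ∀ t : ℝ, HasDerivAt (cauchyKernel a (b - 1))
      (-Complex.I * (2 * a * cauchyKernel (a + 1) b t - (a + b - 1) * cauchyKernel a b t)) t := by
    intro t
    have h1 : HasDerivAt (fun z : ℂ => 1 + Complex.I * z) Complex.I (t : ℂ) := by
      simpa using ((hasDerivAt_id (t : ℂ)).const_mul Complex.I).const_add 1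
    have h2 : HasDerivAt (fun z : ℂ => 1 - Complex.I * z) (-Complex.I) (t : ℂ) := by
      simpa using ((hasDerivAt_id (t : ℂ)).const_mul Complex.I).const_sub 1
    have h3 := (h1.cpow_const (c := -a) (one_add_I_mul_mem_slitPlane t)).comp_ofReal
    have h4 := (h2.cpow_const (c := -(b - 1)) (one_sub_I_mul_mem_slitPlane t)).comp_ofReal
    refine (h3.mul h4).congr_deriv ?_
    have n1 := Complex.slitPlane_ne_zero (one_add_I_mul_mem_slitPlane t)
    have n2 := Complex.slitPlane_ne_zero (one_sub_I_mul_mem_slitPlane t)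
    simp only [cauchyKernel]
    rw [show -a = -(a + 1) + 1 by ring, show -(b - 1) = -b + 1 by ring,
      Complex.cpow_add _ _ n1, Complex.cpow_add _ _ n2, add_sub_cancel_right, add_sub_cancel_right,
      Complex.cpow_one, Complex.cpow_one]
    ring
  have hi1 := integrable_cauchyKernel h
  have hi2 := integrable_cauchyKernel (a := a + 1) (b := b) (by
    simp only [Complex.add_re, Complex.one_re] at h ⊢; linarith)
  have hi := ((hi2.const_mul (2 * a)).sub (hi1.const_mul (a + b - 1))).const_mul (-Complex.I)
  have hlim : ∀ l : Filter ℝ, Tendsto (fun t : ℝ => t ^ 2) l atTop →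
      Tendsto (cauchyKernel a (b - 1)) l (𝓝 0) := by
    intro l hl
    refine squeeze_zero_norm (norm_cauchyKernel_le a (b - 1)) ?_
    have hexp : 0 < (a + (b - 1)).re / 2 := by
      simp only [Complex.add_re, Complex.sub_re, Complex.one_re] at h ⊢; linarith
    have h1 := (tendsto_rpow_neg_atTop hexp).comp (tendsto_atTop_add_const_left _ 1 hl)
    have h2 := h1.const_mul (Real.exp (Real.pi * (|a.im| + |(b - 1).im|)))
    rw [mul_zero] at h2
    refine h2.congr fun t => ?_
    rw [neg_div]
    rfl
  have hT := tendsto_pow_atTop (α := ℝ) (n := 2) two_ne_zero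
  have key := integral_of_hasDerivAt_of_tendsto hd hi
    (hlim atBot ((hT.comp tendsto_neg_atBot_atTop).congr fun t => neg_sq t)) (hlim atTop hT)
  rw [integral_const_mul, integral_sub (hi2.const_mul _) (hi1.const_mul _), integral_const_mul,
    integral_const_mul, sub_zero] at key
  have := (mul_eq_zero.mp key).resolve_left (neg_ne_zero.mpr Complex.I_ne_zero)
  linear_combination -this

theorem integral_cauchyKernel {a b : ℂ} (ha : 0 < a.re) (hb : 0 < b.re) (h : 1 < (a + b).re) :
    ∫ t, cauchyKernel a b t = Real.pi * 2 ^ (2 - a - b) *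
      (Complex.Gamma (a + b - 1) / (Complex.Gamma a * Complex.Gamma b)) := by
  have hre : 0 < (a + b - 1).re := by simpa using h
  have h0 : a + b - 1 ≠ 0 := fun h0 => by simp [h0] at hre
  have ha0 : a ≠ 0 := fun h0 => by simp [h0] at ha
  have hG := Complex.Gamma_ne_zero_of_re_pos ha
  apply mul_left_cancel₀ h0
  rw [integral_cauchyKernel_recurrence h,
    integral_cauchyKernel_of_one_lt (a := a + 1) (by simpa using ha) hb,
    show a + 1 + b - 1 = (a + b - 1) + 1 by ring, Complex.Gamma_add_one _ h0,
    Complex.Gamma_add_one _ ha0]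
  have e : (2 : ℂ) ^ (2 - a - b) = 2 * 2 ^ (2 - (a + 1) - b) := by
    rw [show 2 - a - b = 1 + (2 - (a + 1) - b) by ring, Complex.cpow_add _ _ two_ne_zero,
      Complex.cpow_one]
  rw [e]
  field_simp

theorem Gamma_add_nat_eq_descPochhammer {z : ℂ} (hz : 0 ≤ z.re) (n : ℕ) :
    Complex.Gamma (z + n + 1) =
      (descPochhammer ℤ n).smeval (z + n) * Complex.Gamma (z + 1) := by
  induction n generalizing z with
  | zero => simp
  | succ n ih =>
    have hz1 : z + 1 ≠ 0 := fun h => by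
      have := congrArg Complex.re h
      simp at this
      linarith
    have h := ih (z := z + 1) (by simp; linarith)
    rw [Complex.Gamma_add_one _ hz1] at h
    rw [descPochhammer_succ_right, Polynomial.smeval_mul, Polynomial.smeval_sub,
      Polynomial.smeval_X, Polynomial.smeval_natCast,
      show z + ((n + 1 : ℕ) : ℂ) = z + 1 + n by push_cast; ring, h]
    simp
    ring

theorem sum_antidiagonal_inv_Gamma {μ ν : ℂ} (hμ : 0 ≤ μ.re) (hν : 0 ≤ ν.re) (k : ℕ) :
    ∑ p ∈ Finset.HasAntidiagonal.antidiagonal k,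
      (1 / ((p.1.factorial : ℂ) * Complex.Gamma (μ + p.1 + 1))) *
        (1 / ((p.2.factorial : ℂ) * Complex.Gamma (ν + p.2 + 1))) =
    Complex.Gamma (μ + ν + 2 * k + 1) / (k.factorial * Complex.Gamma (μ + ν + k + 1)) /
      (Complex.Gamma (μ + k + 1) * Complex.Gamma (ν + k + 1)) := by
  have hne : ∀ (z : ℂ) (n : ℕ), 0 ≤ z.re → Complex.Gamma (z + n + 1) ≠ 0 := fun z n hz => by
    apply Complex.Gamma_ne_zero_of_re_pos
    simp
    positivity
  have hσ : 0 ≤ (μ + ν).re := by simp; positivity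
  have hV := Ring.descPochhammer_smeval_add k (Commute.all (ν + k) (μ + k))
  have h1 := Gamma_add_nat_eq_descPochhammer (z := μ + ν + k) (by simp; positivity) k
  rw [show μ + ν + (k : ℂ) + k = (ν + k) + (μ + k) by ring] at h1
  rw [show μ + ν + 2 * (k : ℂ) + 1 = (ν + k) + (μ + k) + 1 by ring, h1, hV, Finset.sum_mul,
    Finset.sum_div, Finset.sum_div]
  refine Finset.sum_congr rfl fun p hp => ?_
  have hk : p.1 + p.2 = k := Finset.HasAntidiagonal.mem_antidiagonal.mp hp
  have h2 := Gamma_add_nat_eq_descPochhammer (z := ν + p.2) (by simp; positivity) p.1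
  have h3 := Gamma_add_nat_eq_descPochhammer (z := μ + p.1) (by simp; positivity) p.2
  rw [show ν + (p.2 : ℂ) + p.1 = ν + k by rw [← hk]; push_cast; ring] at h2
  rw [show μ + (p.1 : ℂ) + p.2 = μ + k by rw [← hk]; push_cast; ring] at h3
  have hc : (k.choose p.1 : ℂ) * p.1.factorial * p.2.factorial = k.factorial := by
    rw [← hk, Nat.choose_symm_add]; exact_mod_cast Nat.add_choose_mul_factorial_mul_factorial p.1 p.2
  have e2 : (descPochhammer ℤ p.1).smeval (ν + k) =
      Complex.Gamma (ν + k + 1) / Complex.Gamma (ν + p.2 + 1) := by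
    rw [eq_div_iff (hne _ _ hν)]; exact h2.symm
  have e3 : (descPochhammer ℤ p.2).smeval (μ + k) =
      Complex.Gamma (μ + k + 1) / Complex.Gamma (μ + p.1 + 1) := by
    rw [eq_div_iff (hne _ _ hμ)]; exact h3.symm
  rw [e2, e3]
  have f1 : (p.1.factorial : ℂ) ≠ 0 := by exact_mod_cast p.1.factorial_ne_zero
  have f2 : (p.2.factorial : ℂ) ≠ 0 := by exact_mod_cast p.2.factorial_ne_zero
  have f3 : (k.factorial : ℂ) ≠ 0 := by exact_mod_cast k.factorial_ne_zero
  have g1 := hne μ p.1 hμ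
  have g2 := hne ν p.2 hν
  have g3 := hne μ k hμ
  have g4 := hne ν k hν
  have g5 := hne _ k hσ
  field_simp
  linear_combination -hc

theorem hasSum_besselF_mul {μ ν : ℂ} (hμ : 0 ≤ μ.re) (hν : 0 ≤ ν.re) (z : ℂ) :
    HasSum (fun k : ℕ => (-z) ^ k * (Complex.Gamma (μ + ν + 2 * k + 1) /
      (k.factorial * Complex.Gamma (μ + ν + k + 1)) /
      (Complex.Gamma (μ + k + 1) * Complex.Gamma (ν + k + 1))))
      (besselF μ z * besselF ν z) := by
  have s1 := summable_norm_besselF (μ := μ) (by linarith) z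
  have s2 := summable_norm_besselF (μ := ν) (by linarith) z
  have h := tsum_mul_tsum_eq_tsum_sum_antidiagonal_of_summable_norm s1 s2
  have hs := (summable_norm_sum_mul_antidiagonal_of_summable_norm s1 s2).of_norm.hasSum
  rw [← h] at hs
  refine hasSum_congr_of_eq hs (fun k => ?_) rfl
  rw [← sum_antidiagonal_inv_Gamma hμ hν, Finset.mul_sum]
  refine Finset.sum_congr rfl fun p hp => ?_
  rw [← Finset.HasAntidiagonal.mem_antidiagonal.mp hp, pow_add]
  ring

theorem cauchyKernel_add_nat (a b : ℂ) (k : ℕ) (t : ℝ) :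
    cauchyKernel (a + k) (b + k) t = cauchyKernel a b t * (1 / (1 + (t : ℂ) ^ 2)) ^ k := by
  have n1 := Complex.slitPlane_ne_zero (one_add_I_mul_mem_slitPlane t)
  have n2 := Complex.slitPlane_ne_zero (one_sub_I_mul_mem_slitPlane t)
  have e : (1 + (t : ℂ) ^ 2) = (1 + Complex.I * t) * (1 - Complex.I * t) := by
    linear_combination ((t : ℂ) ^ 2) * Complex.I_sq
  rw [cauchyKernel, cauchyKernel, e, neg_add, neg_add, Complex.cpow_add _ _ n1,
    Complex.cpow_add _ _ n2, Complex.cpow_neg _ (k : ℂ), Complex.cpow_neg _ (k : ℂ),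
    Complex.cpow_natCast, Complex.cpow_natCast, one_div, inv_pow, mul_pow, mul_inv]
  ring

theorem norm_one_div_one_add_sq_le (t : ℝ) : ‖(1 : ℂ) / (1 + (t : ℂ) ^ 2)‖ ≤ 1 := by
  rw [show (1 : ℂ) / (1 + (t : ℂ) ^ 2) = ((1 / (1 + t ^ 2) : ℝ) : ℂ) by push_cast; rfl,
    Complex.norm_real, Real.norm_of_nonneg (by positivity)]
  exact div_le_one_of_le₀ (by nlinarith [sq_nonneg t]) (by positivity)

theorem besselF_mul_eq_integral {μ ν : ℂ} (hμ : 0 ≤ μ.re) (hν : 0 ≤ ν.re) (z : ℂ) :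
    besselF μ z * besselF ν z = 2 ^ (μ + ν) / Real.pi *
      ∫ t : ℝ, cauchyKernel (1 + ν) (1 + μ) t *
        besselF (μ + ν) (4 * z * (1 / (1 + (t : ℂ) ^ 2))) := by
  have hσ : -(1 / 2) ≤ (μ + ν).re := by
    simp only [Complex.add_re]; linarith
  have hre : 1 < ((1 + ν) + (1 + μ)).re := by simp; linarith
  let c : ℕ → ℂ := fun k => (-(4 * z)) ^ k / ((k.factorial : ℂ) * Complex.Gamma (μ + ν + k + 1))
  have h := MeasureTheory.hasSum_integral_of_dominated_convergence
    (μ := (volume : Measure ℝ))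
    (F := fun (k : ℕ) (t : ℝ) => c k * cauchyKernel (1 + ν + k) (1 + μ + k) t)
    (f := fun t : ℝ => cauchyKernel (1 + ν) (1 + μ) t *
        besselF (μ + ν) (4 * z * (1 / (1 + (t : ℂ) ^ 2))))
    (fun k t => ‖cauchyKernel (1 + ν) (1 + μ) t‖ *
      (‖(Complex.Gamma (μ + ν + 1))⁻¹‖ * ((2 * ‖4 * z‖) ^ k / k.factorial))) ?_ ?_ ?_ ?_ ?_
  · have h2 := h.mul_left (2 ^ (μ + ν) / (Real.pi : ℂ))
    refine (hasSum_besselF_mul hμ hν z).unique (hasSum_congr_of_eq h2 (fun k => ?_) rfl)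
    rw [integral_const_mul, integral_cauchyKernel (by simp; positivity) (by simp; positivity) (by
      simp only [Complex.add_re, Complex.one_re, Complex.natCast_re] at hre ⊢
      linarith [(Nat.cast_nonneg k : (0 : ℝ) ≤ k)])]
    have e1 : (2 : ℂ) ^ (2 - (1 + ν + k) - (1 + μ + k)) = (2 ^ (μ + ν))⁻¹ * (4 ^ k)⁻¹ := by
      rw [show 2 - (1 + ν + k) - (1 + μ + k) = -(μ + ν) + -((2 * k : ℕ) : ℂ) by push_cast; ring,
        Complex.cpow_add _ _ two_ne_zero, Complex.cpow_neg, Complex.cpow_neg, Complex.cpow_natCast,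
        pow_mul]
      norm_num
    have hpi : (Real.pi : ℂ) ≠ 0 := by exact_mod_cast Real.pi_ne_zero
    have h20 : (2 : ℂ) ^ (μ + ν) ≠ 0 := by simp [Complex.cpow_eq_zero_iff]
    rw [e1, show 1 + ν + k + (1 + μ + k) - 1 = μ + ν + 2 * k + 1 by ring,
      show 1 + ν + k = ν + k + 1 by ring, show 1 + μ + k = μ + k + 1 by ring]
    simp only [c]
    rw [← mul_neg, mul_pow]
    field_simp
  · exact fun k => (continuous_const.mul (continuous_cauchyKernel _ _)).aestronglyMeasurable
  · refine fun k => ae_of_all _ fun t => ?_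
    rw [cauchyKernel_add_nat, mul_left_comm, norm_mul, norm_mul]
    refine mul_le_mul_of_nonneg_left ?_ (norm_nonneg _)
    refine (mul_le_of_le_one_right (norm_nonneg _) ?_).trans (norm_besselF_term_le hσ _ k)
    rw [norm_pow]
    exact pow_le_one₀ (norm_nonneg _) (norm_one_div_one_add_sq_le t)
  · exact ae_of_all _ fun t =>
      ((Real.summable_pow_div_factorial _).mul_left _).mul_left _
  · simp_rw [tsum_mul_left]
    exact (integrable_cauchyKernel hre).norm.mul_const _
  · refine ae_of_all _ fun t => ?_
    refine hasSum_congr_of_eq ((hasSum_besselF hσ _).mul_left _) (fun k => ?_) rfl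
    rw [cauchyKernel_add_nat, ← neg_mul, mul_pow]
    simp only [c]
    ring

/-- The integrand `u^(p-1) (1-u)^(q-1)` of the Beta integral. -/
noncomputable def betaWeight (p q : ℂ) (u : ℝ) : ℂ :=
  (u : ℂ) ^ (p - 1) * (1 - (u : ℂ)) ^ (q - 1)

theorem integrableOn_betaWeight {p q : ℂ} (hp : 0 < p.re) (hq : 0 < q.re) :
    IntegrableOn (betaWeight p q) (Ioo 0 1) := by
  have h := Complex.betaIntegral_convergent hp hq
  rwa [intervalIntegrable_iff_integrableOn_Ioo_of_le zero_le_one] at h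

theorem integral_betaWeight {p q : ℂ} (hp : 0 < p.re) (hq : 0 < q.re) :
    ∫ u in Ioo (0 : ℝ) 1, betaWeight p q u =
      Complex.Gamma p * Complex.Gamma q / Complex.Gamma (p + q) := by
  have h := Complex.betaIntegral_eq_Gamma_mul_div p q hp hq
  rwa [Complex.betaIntegral, intervalIntegral.integral_of_le zero_le_one,
    integral_Ioc_eq_integral_Ioo] at h

theorem betaWeight_mul_cpow (p q r : ℂ) {u : ℝ} (hu : 0 < u) :
    betaWeight p q u * (u : ℂ) ^ r = betaWeight (p + r) q u := by
  have hu0 : (u : ℂ) ≠ 0 := by exact_mod_cast hu.ne'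
  rw [betaWeight, betaWeight, show p + r - 1 = (p - 1) + r by ring, Complex.cpow_add _ _ hu0]
  ring

theorem Gamma_nat_add_half_mul (k : ℕ) :
    Complex.Gamma (1 / 2 + k) * k.factorial * 4 ^ k =
      (2 * k).factorial * (Real.sqrt Real.pi : ℂ) := by
  have h := Complex.Gamma_mul_Gamma_add_half (1 / 2 + k)
  rw [show (1 / 2 + k : ℂ) + 1 / 2 = k + 1 by ring, Complex.Gamma_nat_eq_factorial,
    show 2 * (1 / 2 + k : ℂ) = ((2 * k : ℕ) : ℂ) + 1 by push_cast; ring,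
    Complex.Gamma_nat_eq_factorial,
    show (1 : ℂ) - (((2 * k : ℕ) : ℂ) + 1) = -((2 * k : ℕ) : ℂ) by ring, Complex.cpow_neg,
    Complex.cpow_natCast, pow_mul] at h
  rw [h]
  have : (4 : ℂ) ^ k ≠ 0 := pow_ne_zero _ (by norm_num)
  norm_num
  field_simp

theorem besselF_poisson {σ : ℂ} (hσ : -(1 / 2) < σ.re) (x : ℝ) :
    Real.sqrt Real.pi * Complex.Gamma (σ + 1 / 2) * besselF σ ((x : ℂ) ^ 2) =
      ∫ u in Ioo (0 : ℝ) 1, betaWeight (1 / 2) (σ + 1 / 2) u *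
        Complex.cos (2 * x * (√u : ℝ)) := by
  have hq : 0 < (σ + 1 / 2).re := by simp; linarith
  have hG := Complex.Gamma_ne_zero_of_re_pos hq
  have hw := integrableOn_betaWeight (p := 1 / 2) (q := σ + 1 / 2) (by simp) hq
  let c : ℕ → ℂ := fun k => (-1) ^ k * (2 * x : ℂ) ^ (2 * k) / (2 * k).factorial
  have hcs : Summable fun k => ‖c k‖ := by
    have h := (Complex.hasSum_cos (2 * x)).summable.norm
    exact h
  have h := MeasureTheory.hasSum_integral_of_dominated_convergence
    (μ := volume.restrict (Ioo (0 : ℝ) 1))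
    (F := fun (k : ℕ) (u : ℝ) => c k * (betaWeight (1 / 2) (σ + 1 / 2) u * (u : ℂ) ^ k))
    (f := fun u : ℝ => betaWeight (1 / 2) (σ + 1 / 2) u * Complex.cos (2 * x * (√u : ℝ)))
    (fun k u => ‖betaWeight (1 / 2) (σ + 1 / 2) u‖ * ‖c k‖) ?_ ?_ ?_ ?_ ?_
  · refine HasSum.unique ?_ h
    refine hasSum_congr_of_eq ((hasSum_besselF hσ.le ((x : ℂ) ^ 2)).mul_left
      (Real.sqrt Real.pi * Complex.Gamma (σ + 1 / 2))) (fun k => ?_) rfl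
    have e : ∀ u ∈ Ioo (0 : ℝ) 1, c k * (betaWeight (1 / 2) (σ + 1 / 2) u * (u : ℂ) ^ k) =
        c k * betaWeight (1 / 2 + k) (σ + 1 / 2) u := fun u hu => by
      rw [← Complex.cpow_natCast, betaWeight_mul_cpow _ _ _ hu.1]
    rw [setIntegral_congr_fun measurableSet_Ioo e, integral_const_mul,
      integral_betaWeight (by simp; positivity) hq,
      show 1 / 2 + (k : ℂ) + (σ + 1 / 2) = σ + k + 1 by ring]
    have hk := Gamma_nat_add_half_mul k
    have f1 : (k.factorial : ℂ) ≠ 0 := by exact_mod_cast k.factorial_ne_zero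
    have f2 : ((2 * k).factorial : ℂ) ≠ 0 := by exact_mod_cast (2 * k).factorial_ne_zero
    have hGk : Complex.Gamma (σ + k + 1) ≠ 0 := by
      apply Complex.Gamma_ne_zero_of_re_pos
      simp only [Complex.add_re, Complex.natCast_re, Complex.one_re]
      linarith [(Nat.cast_nonneg k : (0 : ℝ) ≤ k)]
    simp only [c]
    rw [pow_mul, mul_pow, mul_pow, neg_pow ((x : ℂ) ^ 2), show (2 : ℂ) ^ 2 = 4 by norm_num]
    generalize Complex.Gamma (σ + 1 / 2) = G at hG ⊢
    generalize Complex.Gamma (1 / 2 + k) = G' at hk ⊢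
    field_simp
    linear_combination ((x : ℂ) ^ 2) ^ k * hk
  · exact fun k => (hw.1.mul (Continuous.aestronglyMeasurable (by fun_prop))).const_mul _
  · intro k
    filter_upwards [ae_restrict_mem measurableSet_Ioo] with u hu
    rw [mul_left_comm, norm_mul]
    refine mul_le_mul_of_nonneg_left ?_ (norm_nonneg _)
    rw [norm_mul]
    refine mul_le_of_le_one_right (norm_nonneg _) ?_
    rw [norm_pow, Complex.norm_real, Real.norm_of_nonneg hu.1.le]
    exact pow_le_one₀ hu.1.le hu.2.le
  · exact ae_of_all _ fun u => hcs.mul_left _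
  · simp_rw [tsum_mul_left]
    exact hw.norm.mul_const _
  · filter_upwards [ae_restrict_mem measurableSet_Ioo] with u hu
    refine hasSum_congr_of_eq ((Complex.hasSum_cos (2 * x * (√u : ℝ))).mul_left _)
      (fun k => ?_) rfl
    have : ((√u : ℝ) : ℂ) ^ 2 = u := by exact_mod_cast Real.sq_sqrt hu.1.le
    simp only [c]
    rw [mul_pow (2 * (x : ℂ)), pow_mul ((√u : ℝ) : ℂ), this]
    ring

theorem integral_cpow_mul_exp_mul_cos {a : ℂ} (ha : 0 < a.re) {δ : ℝ} (hδ : 0 < δ) (y : ℝ) :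
    ∫ x in Ioi (0 : ℝ), (x : ℂ) ^ (a - 1) * Complex.exp (-(δ * x)) * Complex.cos (2 * x * y) =
      Complex.Gamma a / 2 * ((δ - 2 * y * Complex.I) ^ (-a) + (δ + 2 * y * Complex.I) ^ (-a)) := by
  have h1 : 0 < (δ - 2 * y * Complex.I : ℂ).re := by simpa using hδ
  have h2 : 0 < (δ + 2 * y * Complex.I : ℂ).re := by simpa using hδ
  have e1 := integral_cpow_mul_cexp_neg ha h1
  have e2 := integral_cpow_mul_cexp_neg ha h2
  have i1 := integrableOn_cpow_mul_cexp_neg ha h1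
  have i2 := integrableOn_cpow_mul_cexp_neg ha h2
  have e : ∀ x : ℝ, (x : ℂ) ^ (a - 1) * Complex.exp (-(δ * x)) * Complex.cos (2 * x * y) =
      ((x : ℂ) ^ (a - 1) * Complex.exp (-((δ - 2 * y * Complex.I) * x)) +
      (x : ℂ) ^ (a - 1) * Complex.exp (-((δ + 2 * y * Complex.I) * x))) / 2 := fun x => by
    rw [Complex.cos, show -((δ - 2 * y * Complex.I) * x) = -(δ * x) + 2 * x * y * Complex.I by ring,
      show -((δ + 2 * y * Complex.I) * x) = -(δ * x) + -(2 * x * y) * Complex.I by ring,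
      Complex.exp_add, Complex.exp_add]
    ring
  simp only [e]
  rw [integral_div, integral_add i1 i2, e1, e2]
  ring

theorem integrableOn_rpow_mul_norm_besselF {l : ℝ} (h0 : 1 / 2 < l) (h1 : l < 1) (s : ℝ) :
    IntegrableOn (fun x : ℝ => (x : ℂ) ^ (1 + Complex.I * s - l - 1) *
      besselF (Complex.I * s) ((x : ℂ) ^ 2)) (Ioi 0) := by
  have hi := (integrableOn_rpow_mul_min 1 h1 (by norm_num; linarith)).const_mul (besselJConst s)
  refine hi.mono' (ContinuousOn.aestronglyMeasurable (fun x hx => ?_) measurableSet_Ioi) ?_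
  · refine ContinuousAt.continuousWithinAt (ContinuousAt.mul
      (Complex.continuousAt_ofReal_cpow_const x _ (Or.inr (ne_of_gt hx))) ?_)
    exact ContinuousAt.comp (f := fun x : ℝ => (x : ℂ) ^ 2)
      (hasDerivAt_besselF (by simp) _).continuousAt (by fun_prop)
  · filter_upwards [ae_restrict_mem measurableSet_Ioi] with x hx
    have hx0 : 0 < x := hx
    have h2 : (0 : ℝ) < 2 * x := by positivity
    have hJ := norm_besselJ_le h2 s
    rw [norm_besselJ_eq h2, show (((2 * x : ℝ) : ℂ) / 2) = x by push_cast; ring] at hJ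
    rw [norm_mul, Complex.norm_cpow_eq_rpow_re_of_pos hx0,
      show (1 + Complex.I * s - l - 1 : ℂ).re = -l by simp, pow_one, mul_left_comm]
    refine mul_le_mul_of_nonneg_left (hJ.trans ?_) (by positivity)
    refine mul_le_mul_of_nonneg_left (min_le_min le_rfl ?_) (besselJConst_nonneg s)
    exact Real.rpow_le_rpow_of_nonpos hx0 (by linarith) (by norm_num)

theorem weber_abel {l : ℝ} (h1 : l < 1) (s : ℝ) {δ : ℝ} (hδ : 0 < δ) :
    Real.sqrt Real.pi * Complex.Gamma (Complex.I * s + 1 / 2) *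
      ∫ x in Ioi (0 : ℝ), Complex.exp (-(δ * x)) * ((x : ℂ) ^ (1 + Complex.I * s - l - 1) *
        besselF (Complex.I * s) ((x : ℂ) ^ 2)) =
    ∫ u in Ioo (0 : ℝ) 1, betaWeight (1 / 2) (Complex.I * s + 1 / 2) u *
      (Complex.Gamma (1 + Complex.I * s - l) / 2 *
        ((δ - 2 * (√u : ℝ) * Complex.I) ^ (-(1 + Complex.I * s - l)) +
          (δ + 2 * (√u : ℝ) * Complex.I) ^ (-(1 + Complex.I * s - l)))) := by
  set a : ℂ := 1 + Complex.I * s - l with ha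
  have hare : 0 < a.re := by simp [ha]; linarith
  have hq : 0 < (Complex.I * s + 1 / 2 : ℂ).re := by simp
  have hw := integrableOn_betaWeight (p := 1 / 2) (q := Complex.I * s + 1 / 2) (by simp) hq
  have hx := integrableOn_cpow_mul_cexp_neg (r := δ) hare (by simpa using hδ)
  let H : ℝ → ℝ → ℂ := fun u x => betaWeight (1 / 2) (Complex.I * s + 1 / 2) u *
    ((x : ℂ) ^ (a - 1) * Complex.exp (-(δ * x)) * Complex.cos (2 * x * (√u : ℝ)))
  have hH : Integrable (Function.uncurry H)
      ((volume.restrict (Ioo (0 : ℝ) 1)).prod (volume.restrict (Ioi (0 : ℝ)))) := by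
    have hc : Continuous fun z : ℝ × ℝ => Complex.cos (2 * z.2 * (√z.1 : ℝ)) := by fun_prop
    refine ((hw.mul_prod hx).bdd_mul (c := 1) hc.aestronglyMeasurable
      (ae_of_all _ fun z => ?_)).congr (ae_of_all _ fun z => ?_)
    · rw [show (2 * z.2 * (√z.1 : ℝ) : ℂ) = ((2 * z.2 * √z.1 : ℝ) : ℂ) by push_cast; rfl,
        ← Complex.ofReal_cos, Complex.norm_real]
      exact Real.abs_cos_le_one _
    · simp only [H, Function.uncurry]
      ring
  have hswap := integral_integral_swap hH
  simp only [H, integral_const_mul, integral_cpow_mul_exp_mul_cos hare hδ] at hswap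
  rw [hswap, ← integral_const_mul]
  congr 1; funext x
  have hP := besselF_poisson (σ := Complex.I * s) (by simp) x
  rw [show Real.sqrt Real.pi * Complex.Gamma (Complex.I * s + 1 / 2) * (Complex.exp (-(δ * x)) *
      ((x : ℂ) ^ (a - 1) * besselF (Complex.I * s) ((x : ℂ) ^ 2))) =
      (Complex.exp (-(δ * x)) * (x : ℂ) ^ (a - 1)) * (Real.sqrt Real.pi *
      Complex.Gamma (Complex.I * s + 1 / 2) * besselF (Complex.I * s) ((x : ℂ) ^ 2)) by ring, hP,
    ← integral_const_mul]
  congr 1; funext u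
  ring

theorem tendsto_weber_left {l : ℝ} (h0 : 1 / 2 < l) (h1 : l < 1) (s : ℝ) :
    Tendsto (fun δ : ℝ => ∫ x in Ioi (0 : ℝ), Complex.exp (-(δ * x)) *
      ((x : ℂ) ^ (1 + Complex.I * s - l - 1) * besselF (Complex.I * s) ((x : ℂ) ^ 2)))
      (𝓝[>] 0) (𝓝 (∫ x in Ioi (0 : ℝ), (x : ℂ) ^ (1 + Complex.I * s - l - 1) *
        besselF (Complex.I * s) ((x : ℂ) ^ 2))) := by
  have hi := integrableOn_rpow_mul_norm_besselF h0 h1 s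
  refine tendsto_integral_filter_of_dominated_convergence _ (Eventually.of_forall fun δ =>
    (Continuous.aestronglyMeasurable (by fun_prop)).mul hi.1) ?_ hi.norm ?_
  · filter_upwards [self_mem_nhdsWithin] with δ hδ
    filter_upwards [ae_restrict_mem measurableSet_Ioi] with x hx
    rw [norm_mul]
    refine mul_le_of_le_one_left (norm_nonneg _) ?_
    rw [Complex.norm_exp, Complex.neg_re, Complex.re_mul_ofReal, Complex.ofReal_re]
    exact Real.exp_le_one_iff.mpr (neg_nonpos.mpr (mul_nonneg (le_of_lt hδ) (le_of_lt hx)))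
  · refine ae_of_all _ fun x => ?_
    have hc : Continuous fun δ : ℝ => Complex.exp (-(δ * x)) * ((x : ℂ) ^
      (1 + Complex.I * s - l - 1) * besselF (Complex.I * s) ((x : ℂ) ^ 2)) := by fun_prop
    have := hc.tendsto 0
    simp only [Complex.ofReal_zero, zero_mul, neg_zero, Complex.exp_zero, one_mul] at this
    exact this.mono_left nhdsWithin_le_nhds

theorem norm_add_mul_I_cpow_le {l δ y : ℝ} (h1 : l < 1) (s : ℝ) {c : ℝ} (hc : |c| = 2)
    (hy : 0 < y) :
    ‖((δ : ℂ) + c * y * Complex.I) ^ (-(1 + Complex.I * s - l))‖ ≤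
      Real.exp (Real.pi * |s|) * y ^ (-(1 - l)) := by
  have hyn : y ≤ ‖((δ : ℂ) + c * y * Complex.I)‖ := by
    refine le_trans ?_ (Complex.abs_im_le_norm _)
    have : ((δ : ℂ) + c * y * Complex.I).im = c * y := by simp
    rw [this, abs_mul, hc, abs_of_pos hy]
    linarith
  have h0 : ((δ : ℂ) + c * y * Complex.I) ≠ 0 := norm_pos_iff.mp (hy.trans_le hyn)
  have h := norm_cpow_le_mul_exp h0 (-(1 + Complex.I * s - l))
  have hre : (-(1 + Complex.I * s - l) : ℂ).re = -(1 - l) := by simp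
  have him : |(-(1 + Complex.I * s - l) : ℂ).im| = |s| := by simp
  rw [hre, him] at h
  refine h.trans ?_
  rw [mul_comm]
  exact mul_le_mul_of_nonneg_left (Real.rpow_le_rpow_of_nonpos hy hyn (by linarith))
    (Real.exp_pos _).le

theorem tendsto_ofReal_add_mul_I_cpow (a : ℂ) {c : ℝ} (hc : c ≠ 0) :
    Tendsto (fun δ : ℝ => ((δ : ℂ) + c * Complex.I) ^ a) (𝓝[>] 0) (𝓝 ((c * Complex.I) ^ a)) := by
  have h1 : ContinuousAt (fun δ : ℝ => ((δ : ℂ) + c * Complex.I) ^ a) 0 := by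
    refine ContinuousAt.cpow (by fun_prop) continuousAt_const ?_
    right
    simpa using hc
  have := h1.tendsto
  simp only [Complex.ofReal_zero, zero_add] at this
  exact this.mono_left nhdsWithin_le_nhds

theorem ofReal_mul_I_cpow_add (a : ℂ) {c : ℝ} (hc : 0 < c) :
    (((-c : ℝ) : ℂ) * Complex.I) ^ (-a) + ((c : ℂ) * Complex.I) ^ (-a) =
      2 * Complex.cos (Real.pi * a / 2) * (c : ℂ) ^ (-a) := by
  have hc0 : (c : ℂ) ≠ 0 := by exact_mod_cast hc.ne'
  have e1 : Complex.log ((c : ℂ) * Complex.I) = Real.log c + Real.pi / 2 * Complex.I := by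
    rw [Complex.log_ofReal_mul hc Complex.I_ne_zero, Complex.log_I]
  have e2 : Complex.log (((-c : ℝ) : ℂ) * Complex.I) = Real.log c - Real.pi / 2 * Complex.I := by
    rw [show ((-c : ℝ) : ℂ) * Complex.I = (c : ℂ) * -Complex.I by push_cast; ring,
      Complex.log_ofReal_mul hc (neg_ne_zero.mpr Complex.I_ne_zero), Complex.log_neg_I]
    ring
  rw [Complex.cpow_def_of_ne_zero (mul_ne_zero hc0 Complex.I_ne_zero),
    Complex.cpow_def_of_ne_zero (mul_ne_zero (by simpa using hc.ne') Complex.I_ne_zero), e1, e2,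
    Complex.cpow_def_of_ne_zero hc0, ← Complex.ofReal_log hc.le, Complex.cos,
    show (Real.log c - Real.pi / 2 * Complex.I) * -a =
      Real.log c * -a + Real.pi * a / 2 * Complex.I by ring,
    show (Real.log c + Real.pi / 2 * Complex.I) * -a =
      Real.log c * -a + -(Real.pi * a / 2) * Complex.I by ring, Complex.exp_add, Complex.exp_add]
  ring

theorem tendsto_weber_right {l : ℝ} (h0 : 1 / 2 < l) (h1 : l < 1) (s : ℝ) :
    Tendsto (fun δ : ℝ => ∫ u in Ioo (0 : ℝ) 1, betaWeight (1 / 2) (Complex.I * s + 1 / 2) u *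
      (Complex.Gamma (1 + Complex.I * s - l) / 2 *
        ((δ - 2 * (√u : ℝ) * Complex.I) ^ (-(1 + Complex.I * s - l)) +
          (δ + 2 * (√u : ℝ) * Complex.I) ^ (-(1 + Complex.I * s - l)))))
      (𝓝[>] 0) (𝓝 (∫ u in Ioo (0 : ℝ) 1, Complex.Gamma (1 + Complex.I * s - l) *
        Complex.cos (Real.pi * (1 + Complex.I * s - l) / 2) * 2 ^ (-(1 + Complex.I * s - l)) *
        betaWeight (1 / 2 - (1 + Complex.I * s - l) / 2) (Complex.I * s + 1 / 2) u)) := by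
  set a : ℂ := 1 + Complex.I * s - l with ha
  have hare : a.re = 1 - l := by simp [ha]
  have hq : 0 < (Complex.I * s + 1 / 2 : ℂ).re := by simp
  have hw := integrableOn_betaWeight (p := 1 / 2) (q := Complex.I * s + 1 / 2) (by simp) hq
  have hb := integrableOn_betaWeight (p := 1 / 2 + ((-(1 - l) / 2 : ℝ) : ℂ))
    (q := Complex.I * s + 1 / 2)
    (by simp only [Complex.add_re, Complex.ofReal_re]; norm_num; linarith) hq
  have e1 : ∀ δ u : ℝ, (δ - 2 * (√u : ℝ) * Complex.I : ℂ) =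
      δ + ((-2 : ℝ) : ℂ) * (√u : ℝ) * Complex.I := fun δ u => by push_cast; ring
  have e2 : ∀ δ u : ℝ, (δ + 2 * (√u : ℝ) * Complex.I : ℂ) =
      δ + ((2 : ℝ) : ℂ) * (√u : ℝ) * Complex.I := fun δ u => by push_cast; ring
  refine tendsto_integral_filter_of_dominated_convergence
    (fun u => ‖betaWeight (1 / 2 + ((-(1 - l) / 2 : ℝ) : ℂ)) (Complex.I * s + 1 / 2) u‖ *
      (‖Complex.Gamma a‖ * Real.exp (Real.pi * |s|))) ?_ ?_ (hb.norm.mul_const _) ?_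
  · filter_upwards [self_mem_nhdsWithin] with δ hδ
    refine hw.1.mul (Continuous.aestronglyMeasurable ?_)
    have hδ0 : 0 < δ := hδ
    refine continuous_const.mul (Continuous.add ?_ ?_)
    · exact Continuous.cpow (by fun_prop) continuous_const fun u => Or.inl (by simpa using hδ0)
    · exact Continuous.cpow (by fun_prop) continuous_const fun u => Or.inl (by simpa using hδ0)
  · filter_upwards [self_mem_nhdsWithin] with δ hδ
    filter_upwards [ae_restrict_mem measurableSet_Ioo] with u hu
    have hsu : 0 < √u := Real.sqrt_pos.mpr hu.1
    have b1 := norm_add_mul_I_cpow_le (δ := δ) h1 s (c := -2) (by norm_num) hsu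
    have b2 := norm_add_mul_I_cpow_le (δ := δ) h1 s (c := 2) (by norm_num) hsu
    rw [← e1, ← ha] at b1
    rw [← e2, ← ha] at b2
    have e3 : (√u : ℝ) ^ (-(1 - l)) = ‖(u : ℂ) ^ ((-(1 - l) / 2 : ℝ) : ℂ)‖ := by
      rw [Complex.norm_cpow_eq_rpow_re_of_pos hu.1, Complex.ofReal_re, Real.sqrt_eq_rpow,
        ← Real.rpow_mul hu.1.le]
      congr 1; ring
    rw [e3] at b1 b2
    rw [← betaWeight_mul_cpow _ _ _ hu.1, norm_mul, norm_mul, norm_mul, norm_div, Complex.norm_ofNat]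
    have b3 := (norm_add_le _ _).trans (add_le_add b1 b2)
    calc _ ≤ ‖betaWeight (1 / 2) (Complex.I * s + 1 / 2) u‖ * (‖Complex.Gamma a‖ / 2 *
          (Real.exp (Real.pi * |s|) * ‖(u : ℂ) ^ ((-(1 - l) / 2 : ℝ) : ℂ)‖ +
          Real.exp (Real.pi * |s|) * ‖(u : ℂ) ^ ((-(1 - l) / 2 : ℝ) : ℂ)‖)) := by gcongr
      _ = _ := by ring
  · filter_upwards [ae_restrict_mem measurableSet_Ioo] with u hu
    have hsu : 0 < 2 * √u := mul_pos two_pos (Real.sqrt_pos.mpr hu.1)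
    have t1 := tendsto_ofReal_add_mul_I_cpow (-a) (c := -(2 * √u)) (neg_ne_zero.mpr hsu.ne')
    have t2 := tendsto_ofReal_add_mul_I_cpow (-a) (c := 2 * √u) hsu.ne'
    have t3 := ((t1.add t2).const_mul (Complex.Gamma a / 2)).const_mul
      (betaWeight (1 / 2) (Complex.I * s + 1 / 2) u)
    rw [ofReal_mul_I_cpow_add a hsu] at t3
    have e4 : ((2 * √u : ℝ) : ℂ) ^ (-a) = 2 ^ (-a) * (u : ℂ) ^ (-a / 2) := by
      rw [Complex.ofReal_mul, Complex.mul_cpow_ofReal_nonneg zero_le_two (Real.sqrt_nonneg u),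
        Real.sqrt_eq_rpow, Complex.ofReal_cpow hu.1.le, ← Complex.cpow_mul]
      · congr 2
        push_cast
        ring
      · rw [← Complex.ofReal_log hu.1.le, ← Complex.ofReal_mul, Complex.ofReal_im]
        linarith [Real.pi_pos]
      · rw [← Complex.ofReal_log hu.1.le, ← Complex.ofReal_mul, Complex.ofReal_im]
        exact Real.pi_pos.le
    rw [e4] at t3
    have e5 : Complex.Gamma a * Complex.cos (Real.pi * a / 2) * 2 ^ (-a) *
        betaWeight (1 / 2 - a / 2) (Complex.I * s + 1 / 2) u =
        betaWeight (1 / 2) (Complex.I * s + 1 / 2) u * (Complex.Gamma a / 2 *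
          (2 * Complex.cos (Real.pi * a / 2) * (2 ^ (-a) * (u : ℂ) ^ (-a / 2)))) := by
      rw [show 1 / 2 - a / 2 = 1 / 2 + -a / 2 by ring, ← betaWeight_mul_cpow _ _ _ hu.1]
      ring
    rw [e5]
    refine t3.congr fun δ => ?_
    push_cast
    rw [show (δ : ℂ) + -(2 * (√u : ℝ)) * Complex.I = δ - 2 * (√u : ℝ) * Complex.I by ring]

theorem weber_integral {l : ℝ} (h0 : 1 / 2 < l) (h1 : l < 1) (s : ℝ) :
    ∫ x in Ioi (0 : ℝ), (x : ℂ) ^ (1 + Complex.I * s - l - 1) *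
      besselF (Complex.I * s) ((x : ℂ) ^ 2) =
    Complex.Gamma ((1 + Complex.I * s - l) / 2) /
      (2 * Complex.Gamma ((1 + Complex.I * s + l) / 2)) := by
  have hL := (tendsto_weber_left h0 h1 s).const_mul
    (Real.sqrt Real.pi * Complex.Gamma (Complex.I * s + 1 / 2))
  have hR := tendsto_weber_right h0 h1 s
  have heq := tendsto_nhds_unique_of_eventuallyEq hL hR (by
    filter_upwards [self_mem_nhdsWithin] with δ hδ
    exact weber_abel h1 s hδ)
  set a : ℂ := 1 + Complex.I * s - l with ha
  have hare : a.re = 1 - l := by simp [ha]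
  have hq : 0 < (Complex.I * s + 1 / 2 : ℂ).re := by simp
  have hp : 0 < (1 / 2 - a / 2).re := by
    simp [hare]; linarith
  rw [integral_const_mul, integral_betaWeight hp hq,
    show 1 / 2 - a / 2 + (Complex.I * s + 1 / 2) = (1 + Complex.I * s + l) / 2 by rw [ha]; ring]
    at heq
  have hG1 := Complex.Gamma_ne_zero_of_re_pos hq
  have hG2 : Complex.Gamma ((1 + Complex.I * s + l) / 2) ≠ 0 := by
    apply Complex.Gamma_ne_zero_of_re_pos
    simp; linarith
  have hdup := Complex.Gamma_mul_Gamma_add_half (a / 2)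
  rw [mul_div_cancel₀ _ (two_ne_zero)] at hdup
  have hrefl := Complex.Gamma_mul_Gamma_one_sub (1 / 2 - a / 2)
  rw [show 1 - (1 / 2 - a / 2) = a / 2 + 1 / 2 by ring,
    show (Real.pi : ℂ) * (1 / 2 - a / 2) = Real.pi / 2 - Real.pi * a / 2 by ring,
    Complex.sin_pi_div_two_sub] at hrefl
  have hG3 : Complex.Gamma (a / 2 + 1 / 2) ≠ 0 := by
    apply Complex.Gamma_ne_zero_of_re_pos
    simp [hare]; linarith
  have hG4 := Complex.Gamma_ne_zero_of_re_pos hp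
  have hpi : (Real.pi : ℂ) ≠ 0 := by exact_mod_cast Real.pi_ne_zero
  have hspi : ((Real.sqrt Real.pi : ℝ) : ℂ) ≠ 0 := by
    exact_mod_cast (Real.sqrt_pos.mpr Real.pi_pos).ne'
  have hsq : ((Real.sqrt Real.pi : ℝ) : ℂ) ^ 2 = Real.pi := by
    exact_mod_cast Real.sq_sqrt Real.pi_pos.le
  have hcos : Complex.cos (Real.pi * a / 2) ≠ 0 := by
    intro h
    rw [h, div_zero] at hrefl
    exact mul_ne_zero hG4 hG3 hrefl
  have e2 : (2 : ℂ) ^ (1 - a) = 2 * 2 ^ (-a) := by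
    rw [show 1 - a = 1 + -a by ring, Complex.cpow_add _ _ two_ne_zero, Complex.cpow_one]
  rw [e2] at hdup
  rw [eq_div_iff hcos] at hrefl
  generalize (∫ x in Ioi (0 : ℝ), (x : ℂ) ^ (a - 1) * besselF (Complex.I * s) ((x : ℂ) ^ 2)) = V
    at heq ⊢
  generalize Complex.Gamma (Complex.I * s + 1 / 2) = g1 at *
  generalize Complex.Gamma ((1 + Complex.I * s + l) / 2) = g2 at *
  generalize Complex.Gamma (a / 2 + 1 / 2) = g3 at *
  generalize Complex.Gamma (1 / 2 - a / 2) = g4 at *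
  generalize Complex.Gamma (a / 2) = g5 at *
  generalize Complex.Gamma a = g6 at *
  generalize Complex.cos (Real.pi * a / 2) = cs at *
  generalize (2 : ℂ) ^ (-a) = T at *
  generalize ((Real.sqrt Real.pi : ℝ) : ℂ) = r at *
  have h1 : V * (2 * g2) = g5 := by
    have h2 : r * V * g2 = g6 * cs * T * g4 := by
      field_simp at heq
      linear_combination heq
    have h3 : r ^ 2 * (V * (2 * g2)) = r ^ 2 * g5 := by
      have : 2 * r * (r * V * g2) = (g6 * (2 * T) * r) * g4 * cs := by rw [h2]; ring
      rw [← hdup] at this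
      rw [hsq]
      linear_combination this + g5 * hrefl - (V * (2 * g2)) * hsq
    exact mul_left_cancel₀ (pow_ne_zero 2 hspi) h3
  rw [eq_div_iff (mul_ne_zero two_ne_zero hG2), h1]

theorem cauchyKernel_mul_norm_cpow (p q a : ℂ) (t : ℝ) :
    cauchyKernel p q t * ((‖1 + Complex.I * (t : ℂ)‖ : ℝ) : ℂ) ^ a =
      cauchyKernel (p - a / 2) (q - a / 2) t := by
  have n1 := Complex.slitPlane_ne_zero (one_add_I_mul_mem_slitPlane t)
  have n2 := Complex.slitPlane_ne_zero (one_sub_I_mul_mem_slitPlane t)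
  have hb : 0 < ‖1 + Complex.I * (t : ℂ)‖ := norm_pos_iff.mpr n1
  have hconj : 1 - Complex.I * (t : ℂ) = starRingEnd ℂ (1 + Complex.I * t) := by
    simp [sub_eq_add_neg]
  have hlog : ((Real.log ‖1 + Complex.I * (t : ℂ)‖ : ℝ) : ℂ) =
      (Complex.log (1 + Complex.I * t) + Complex.log (1 - Complex.I * t)) / 2 := by
    rw [hconj, Complex.log_conj _ (Complex.slitPlane_arg_ne_pi (one_add_I_mul_mem_slitPlane t)),
      Complex.add_conj, Complex.log_re]
    push_cast
    ring
  simp only [cauchyKernel]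
  rw [Complex.cpow_def_of_ne_zero (x := ((‖1 + Complex.I * (t : ℂ)‖ : ℝ) : ℂ))
    (by exact_mod_cast hb.ne'), ← Complex.ofReal_log hb.le, hlog,
    Complex.cpow_def_of_ne_zero n1, Complex.cpow_def_of_ne_zero n2, Complex.cpow_def_of_ne_zero n1,
    Complex.cpow_def_of_ne_zero n2, ← Complex.exp_add, ← Complex.exp_add, ← Complex.exp_add]
  congr 1
  ring

theorem norm_one_add_I_mul_sq (t : ℝ) : ‖1 + Complex.I * (t : ℂ)‖ ^ 2 = 1 + t ^ 2 := by
  rw [norm_one_add_I_mul, ← Real.sqrt_eq_rpow, Real.sq_sqrt (by positivity)]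

/-- The integrand `x^(a-1) F_σ(x² / (1+t²))` after rescaling `x` by `√(1+t²)`. -/
theorem weber_integrand_scaled (a σ : ℂ) {b x : ℝ} (hb : 0 < b) (hx : 0 < x) :
    (x : ℂ) ^ (a - 1) * besselF σ ((x : ℂ) ^ 2 * (1 / (b : ℂ) ^ 2)) =
      (b : ℂ) ^ (a - 1) * (((b⁻¹ * x : ℝ) : ℂ) ^ (a - 1) * besselF σ (((b⁻¹ * x : ℝ) : ℂ) ^ 2)) := by
  have hb0 : (b : ℂ) ≠ 0 := by exact_mod_cast hb.ne'
  have e : (x : ℂ) = (b : ℂ) * ((b⁻¹ * x : ℝ) : ℂ) := by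
    push_cast; field_simp
  have e2 : (x : ℂ) ^ 2 * (1 / (b : ℂ) ^ 2) = ((b⁻¹ * x : ℝ) : ℂ) ^ 2 := by
    push_cast; field_simp
  rw [e2]
  nth_rw 1 [e]
  rw [Complex.mul_cpow_ofReal_nonneg hb.le (by positivity)]
  ring

theorem integral_weber_scaled (a σ : ℂ) {b : ℝ} (hb : 0 < b) :
    ∫ x in Ioi (0 : ℝ), (x : ℂ) ^ (a - 1) * besselF σ ((x : ℂ) ^ 2 * (1 / (b : ℂ) ^ 2)) =
      (b : ℂ) ^ a * ∫ x in Ioi (0 : ℝ), (x : ℂ) ^ (a - 1) * besselF σ ((x : ℂ) ^ 2) := by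
  have hb0 : (b : ℂ) ≠ 0 := by exact_mod_cast hb.ne'
  rw [setIntegral_congr_fun measurableSet_Ioi fun x hx => weber_integrand_scaled a σ hb hx,
    integral_const_mul, integral_comp_mul_left_Ioi (fun x : ℝ => (x : ℂ) ^ (a - 1) *
      besselF σ ((x : ℂ) ^ 2)) 0 (inv_pos.mpr hb), mul_zero, inv_inv, Complex.real_smul, ← mul_assoc]
  congr 1
  rw [Complex.cpow_sub _ _ hb0, Complex.cpow_one, div_mul_cancel₀ _ hb0]

theorem integrableOn_weber_scaled {a σ : ℂ} {b : ℝ} (hb : 0 < b)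
    (h : IntegrableOn (fun x : ℝ => (x : ℂ) ^ (a - 1) * besselF σ ((x : ℂ) ^ 2)) (Ioi 0)) :
    IntegrableOn (fun x : ℝ => (x : ℂ) ^ (a - 1) *
      besselF σ ((x : ℂ) ^ 2 * (1 / (b : ℂ) ^ 2))) (Ioi 0) := by
  have h1 := (integrableOn_Ioi_comp_mul_left_iff (fun x : ℝ => (x : ℂ) ^ (a - 1) *
    besselF σ ((x : ℂ) ^ 2)) 0 (inv_pos.mpr hb)).mpr (by simpa using h)
  exact IntegrableOn.congr_fun (h1.const_mul ((b : ℂ) ^ (a - 1)))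
    (fun x hx => (weber_integrand_scaled a σ hb hx).symm) measurableSet_Ioi

theorem integral_norm_weber_scaled (a σ : ℂ) {b : ℝ} (hb : 0 < b) :
    ∫ x in Ioi (0 : ℝ), ‖(x : ℂ) ^ (a - 1) * besselF σ ((x : ℂ) ^ 2 * (1 / (b : ℂ) ^ 2))‖ =
      b ^ a.re * ∫ x in Ioi (0 : ℝ), ‖(x : ℂ) ^ (a - 1) * besselF σ ((x : ℂ) ^ 2)‖ := by
  rw [setIntegral_congr_fun measurableSet_Ioi fun x hx =>
    (congrArg norm (weber_integrand_scaled a σ hb hx)).trans (norm_mul _ _),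
    integral_const_mul, integral_comp_mul_left_Ioi (fun x : ℝ => ‖(x : ℂ) ^ (a - 1) *
      besselF σ ((x : ℂ) ^ 2)‖) 0 (inv_pos.mpr hb), mul_zero, inv_inv, smul_eq_mul, ← mul_assoc,
    Complex.norm_cpow_eq_rpow_re_of_pos hb]
  congr 1
  rw [Complex.sub_re, Complex.one_re, Real.rpow_sub_one hb.ne', div_mul_cancel₀ _ hb.ne']

theorem kernelJJ_eq {x : ℝ} (hx : 0 < x) (l α β : ℝ) :
    kernelJJ l α β x = ∫ t : ℝ, 1 / Real.pi *
      (cauchyKernel (1 + Complex.I * β) (1 + Complex.I * α) t *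
      ((x : ℂ) ^ (1 + Complex.I * (α + β : ℝ) - l - 1) *
        besselF (Complex.I * (α + β : ℝ)) ((x : ℂ) ^ 2 *
          (1 / ((‖1 + Complex.I * (t : ℂ)‖ : ℝ) : ℂ) ^ 2)))) := by
  have hx0 : (x : ℂ) ≠ 0 := by exact_mod_cast hx.ne'
  have hx2 : (x : ℂ) / 2 ≠ 0 := div_ne_zero hx0 two_ne_zero
  have hF := besselF_mul_eq_integral (μ := Complex.I * α) (ν := Complex.I * β) (by simp) (by simp)
    (((x : ℂ) / 2) ^ 2)
  rw [kernelJJ, besselJ_eq hx, besselJ_eq hx]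
  have e : ((x ^ (-l) : ℝ) : ℂ) * (((x : ℂ) / 2) ^ (Complex.I * (α : ℂ)) *
      besselF (Complex.I * α) (((x : ℂ) / 2) ^ 2)) * (((x : ℂ) / 2) ^ (Complex.I * (β : ℂ)) *
      besselF (Complex.I * β) (((x : ℂ) / 2) ^ 2)) =
      ((x ^ (-l) : ℝ) : ℂ) * (((x : ℂ) / 2) ^ (Complex.I * (α : ℂ)) *
      ((x : ℂ) / 2) ^ (Complex.I * (β : ℂ))) * (besselF (Complex.I * α) (((x : ℂ) / 2) ^ 2) *
      besselF (Complex.I * β) (((x : ℂ) / 2) ^ 2)) := by ring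
  rw [e, hF, ← Complex.cpow_add _ _ hx2, ← integral_const_mul, ← integral_const_mul]
  congr 1; funext t
  have hn : ((‖1 + Complex.I * (t : ℂ)‖ : ℝ) : ℂ) ^ 2 = 1 + (t : ℂ) ^ 2 := by
    exact_mod_cast norm_one_add_I_mul_sq t
  have h2 : ((x : ℂ) / 2) ^ (Complex.I * (α : ℂ) + Complex.I * β) *
      2 ^ (Complex.I * (α : ℂ) + Complex.I * β) = (x : ℂ) ^ (Complex.I * (α : ℂ) + Complex.I * β) := by
    have h := Complex.mul_cpow_ofReal_nonneg (a := x / 2) (b := 2) (by positivity) zero_le_two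
      (Complex.I * (α : ℂ) + Complex.I * β)
    push_cast at h
    rw [← h, div_mul_cancel₀ _ two_ne_zero]
  have h3 : ((x ^ (-l) : ℝ) : ℂ) * (x : ℂ) ^ (Complex.I * (α : ℂ) + Complex.I * β) =
      (x : ℂ) ^ (1 + Complex.I * (α + β : ℝ) - l - 1) := by
    rw [Complex.ofReal_cpow hx.le, ← Complex.cpow_add _ _ hx0]
    congr 1
    push_cast
    ring
  rw [hn, ← h3, ← h2, show 4 * ((x : ℂ) / 2) ^ 2 = (x : ℂ) ^ 2 by ring,
    show Complex.I * ((α + β : ℝ) : ℂ) = Complex.I * α + Complex.I * β by push_cast; ring]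
  ring

theorem integrable_doubleJJ {l : ℝ} (h0 : 1 / 2 < l) (h1 : l < 1) (α β : ℝ) :
    Integrable (Function.uncurry fun (t x : ℝ) => 1 / (Real.pi : ℂ) *
      (cauchyKernel (1 + Complex.I * β) (1 + Complex.I * α) t *
      ((x : ℂ) ^ (1 + Complex.I * (α + β : ℝ) - l - 1) *
        besselF (Complex.I * (α + β : ℝ)) ((x : ℂ) ^ 2 *
          (1 / ((‖1 + Complex.I * (t : ℂ)‖ : ℝ) : ℂ) ^ 2)))))
      ((volume : Measure ℝ).prod (volume.restrict (Ioi (0 : ℝ)))) := by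
  have hb : ∀ t : ℝ, 0 < ‖1 + Complex.I * (t : ℂ)‖ := fun t =>
    norm_pos_iff.mpr (Complex.slitPlane_ne_zero (one_add_I_mul_mem_slitPlane t))
  have hV := integrableOn_rpow_mul_norm_besselF h0 h1 (α + β)
  refine Integrable.const_mul (f := Function.uncurry fun (t x : ℝ) =>
      (cauchyKernel (1 + Complex.I * β) (1 + Complex.I * α) t *
      ((x : ℂ) ^ (1 + Complex.I * (α + β : ℝ) - l - 1) *
        besselF (Complex.I * (α + β : ℝ)) ((x : ℂ) ^ 2 *
          (1 / ((‖1 + Complex.I * (t : ℂ)‖ : ℝ) : ℂ) ^ 2))))) ?_ _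
  have hmeas : AEStronglyMeasurable (Function.uncurry fun (t x : ℝ) =>
      (cauchyKernel (1 + Complex.I * β) (1 + Complex.I * α) t *
      ((x : ℂ) ^ (1 + Complex.I * (α + β : ℝ) - l - 1) *
        besselF (Complex.I * (α + β : ℝ)) ((x : ℂ) ^ 2 *
          (1 / ((‖1 + Complex.I * (t : ℂ)‖ : ℝ) : ℂ) ^ 2)))))
      ((volume : Measure ℝ).prod (volume.restrict (Ioi (0 : ℝ)))) := by
    have hr : (volume : Measure ℝ).prod (volume.restrict (Ioi (0 : ℝ))) =
        ((volume : Measure ℝ).prod volume).restrict (univ ×ˢ Ioi 0) := by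
      rw [← Measure.prod_restrict, Measure.restrict_univ]
    rw [hr]
    refine ContinuousOn.aestronglyMeasurable (fun z hz => ?_)
      (MeasurableSet.univ.prod measurableSet_Ioi)
    have hz2 : 0 < z.2 := hz.2
    refine ContinuousAt.continuousWithinAt (ContinuousAt.mul ?_ (ContinuousAt.mul ?_ ?_))
    · exact ((continuous_cauchyKernel _ _).comp continuous_fst).continuousAt
    · exact ContinuousAt.comp (f := Prod.snd) (g := fun x : ℝ => (x : ℂ) ^
        (1 + Complex.I * (α + β : ℝ) - l - 1))
        (Complex.continuousAt_ofReal_cpow_const _ _ (Or.inr hz2.ne')) continuous_snd.continuousAt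
    · refine ContinuousAt.comp (f := fun z : ℝ × ℝ => (z.2 : ℂ) ^ 2 *
          (1 / ((‖1 + Complex.I * (z.1 : ℂ)‖ : ℝ) : ℂ) ^ 2))
        (hasDerivAt_besselF (by simp) _).continuousAt ?_
      have hne : (((‖1 + Complex.I * (z.1 : ℂ)‖ : ℝ) : ℂ) ^ 2) ≠ 0 :=
        pow_ne_zero _ (by exact_mod_cast (hb z.1).ne')
      exact ContinuousAt.mul (by fun_prop) (ContinuousAt.div (by fun_prop) (by fun_prop) hne)
  rw [integrable_prod_iff hmeas]
  constructor
  · refine ae_of_all _ fun t => ?_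
    change Integrable (fun x : ℝ => _) _
    exact (integrableOn_weber_scaled (hb t) hV).const_mul
      (cauchyKernel (1 + Complex.I * β) (1 + Complex.I * α) t)
  · simp only [Function.uncurry]
    have hint := ((integrable_cauchyKernel (a := 1 + Complex.I * β - (1 + Complex.I * (α + β : ℝ) - l) / 2)
      (b := 1 + Complex.I * α - (1 + Complex.I * (α + β : ℝ) - l) / 2) (by
        simp; linarith)).norm).mul_const
      (∫ x in Ioi (0 : ℝ), ‖(x : ℂ) ^ (1 + Complex.I * (α + β : ℝ) - l - 1) *
        besselF (Complex.I * (α + β : ℝ)) ((x : ℂ) ^ 2)‖)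
    refine hint.congr (ae_of_all _ fun t => ?_)
    simp only
    simp_rw [norm_mul (cauchyKernel (1 + Complex.I * β) (1 + Complex.I * α) t)]
    rw [integral_const_mul, integral_norm_weber_scaled _ _ (hb t),
      ← cauchyKernel_mul_norm_cpow, norm_mul, Complex.norm_cpow_eq_rpow_re_of_pos (hb t), mul_assoc]

theorem regJJ_eq {l : ℝ} (h0 : 1 / 2 < l) (h1 : l < 1) (α β : ℝ) :
    regJJ l α β = 2 ^ (-l : ℂ) * Complex.Gamma l *
      Complex.Gamma ((1 + Complex.I * (α + β) - l) / 2) /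
      (Complex.Gamma ((1 + Complex.I * (α + β) + l) / 2) *
        (Complex.Gamma ((1 + l - Complex.I * (α - β)) / 2) *
          Complex.Gamma ((1 + l + Complex.I * (α - β)) / 2))) := by
  have hb : ∀ t : ℝ, 0 < ‖1 + Complex.I * (t : ℂ)‖ := fun t =>
    norm_pos_iff.mpr (Complex.slitPlane_ne_zero (one_add_I_mul_mem_slitPlane t))
  rw [regJJ, setIntegral_congr_fun measurableSet_Ioi fun x hx => kernelJJ_eq hx l α β]
  have hswap := integral_integral_swap (integrable_doubleJJ h0 h1 α β)
  rw [← hswap]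
  simp only [integral_const_mul]
  simp_rw [integral_weber_scaled _ _ (hb _), weber_integral h0 h1, ← mul_assoc,
    cauchyKernel_mul_norm_cpow]
  rw [integral_mul_const, integral_cauchyKernel]
  · have e1 : (2 : ℂ) ^ (2 - (1 + Complex.I * β - (1 + Complex.I * (α + β : ℝ) - l) / 2) -
        (1 + Complex.I * α - (1 + Complex.I * (α + β : ℝ) - l) / 2)) = 2 * 2 ^ (-l : ℂ) := by
      rw [show 2 - (1 + Complex.I * β - (1 + Complex.I * (α + β : ℝ) - l) / 2) -
        (1 + Complex.I * α - (1 + Complex.I * (α + β : ℝ) - l) / 2) = 1 + (-l : ℂ) by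
          push_cast; ring, Complex.cpow_add _ _ two_ne_zero, Complex.cpow_one]
    have e2 : 1 + Complex.I * β - (1 + Complex.I * (α + β : ℝ) - l) / 2 +
        (1 + Complex.I * α - (1 + Complex.I * (α + β : ℝ) - l) / 2) - 1 = (l : ℂ) := by
      push_cast; ring
    have e3 : 1 + Complex.I * β - (1 + Complex.I * (α + β : ℝ) - l) / 2 =
        (1 + l - Complex.I * (α - β)) / 2 := by push_cast; ring
    have e4 : 1 + Complex.I * α - (1 + Complex.I * (α + β : ℝ) - l) / 2 =
        (1 + l + Complex.I * (α - β)) / 2 := by push_cast; ring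
    rw [e1, e2, e3, e4]
    have hpi : (Real.pi : ℂ) ≠ 0 := by exact_mod_cast Real.pi_ne_zero
    push_cast
    field_simp
  · simp; linarith
  · simp; linarith
  · simp; linarith

theorem sq_add_sq_ofReal_ne_zero {ε : ℝ} (hε : ε ≠ 0) (s : ℝ) : (ε : ℂ) ^ 2 + (s : ℂ) ^ 2 ≠ 0 := by
  have : 0 < ε ^ 2 + s ^ 2 := by positivity
  exact_mod_cast this.ne'

theorem exists_norm_le_of_continuousOn {G : ℝ × ℝ → ℂ} {M : ℝ}
    (hG : ContinuousOn G (Ioo (-1) 1 ×ˢ univ)) (hM : ∀ ε s, M < |s| → G (ε, s) = 0) :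
    ∃ C, 0 ≤ C ∧ ∀ ε ∈ Icc (0 : ℝ) (1 / 2), ∀ s, ‖G (ε, s)‖ ≤ C := by
  obtain ⟨C, hC⟩ := (isCompact_Icc (a := (0 : ℝ)) (b := 1 / 2)).prod
    (isCompact_Icc (a := -M) (b := M)) |>.exists_bound_of_continuousOn
    (hG.mono (prod_mono (fun x hx => ⟨by linarith [hx.1], by linarith [hx.2]⟩) (subset_univ _)))
  refine ⟨max C 0, le_max_right _ _, fun ε hε s => ?_⟩
  rcases lt_or_ge M |s| with h | h
  · rw [hM ε s h, norm_zero]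
    exact le_max_right _ _
  · exact (hC (ε, s) ⟨hε, abs_le.mp h⟩).trans (le_max_left _ _)

theorem continuous_slice {G : ℝ × ℝ → ℂ} (hG : ContinuousOn G (Ioo (-1) 1 ×ˢ univ)) {ε : ℝ}
    (hε : ε ∈ Ioo (-1 : ℝ) 1) : Continuous fun s => G (ε, s) :=
  hG.comp_continuous (by fun_prop) fun _ => ⟨hε, trivial⟩

theorem continuousAt_of_continuousOn_strip {X : Type*} [TopologicalSpace X] {G : ℝ × X → ℂ}
    (hG : ContinuousOn G (Ioo (-1) 1 ×ˢ univ)) {ε : ℝ} (hε : ε ∈ Ioo (-1 : ℝ) 1) (x : X) :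
    ContinuousAt G (ε, x) :=
  hG.continuousAt (prod_mem_nhds (Ioo_mem_nhds hε.1 hε.2) univ_mem)

theorem eventually_Ioc_half : ∀ᶠ ε : ℝ in 𝓝[>] 0, ε ∈ Ioc (0 : ℝ) (1 / 2) :=
  Ioc_mem_nhdsGT (by norm_num)

/-- The Poisson kernel is an approximate identity. -/
theorem tendsto_integral_poisson {G : ℝ × ℝ → ℂ} {M : ℝ}
    (hG : ContinuousOn G (Ioo (-1) 1 ×ˢ univ)) (hM : ∀ ε s, M < |s| → G (ε, s) = 0) :
    Tendsto (fun ε : ℝ => ∫ s : ℝ, (ε : ℂ) / ((ε : ℂ) ^ 2 + (s : ℂ) ^ 2) * G (ε, s)) (𝓝[>] 0)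
      (𝓝 (Real.pi * G (0, 0))) := by
  obtain ⟨C, hC0, hC⟩ := exists_norm_le_of_continuousOn hG hM
  have hscale : ∀ ε : ℝ, 0 < ε →
      ∫ s : ℝ, (ε : ℂ) / ((ε : ℂ) ^ 2 + (s : ℂ) ^ 2) * G (ε, s) =
        ∫ t : ℝ, (((1 + t ^ 2)⁻¹ : ℝ) : ℂ) * G (ε, ε * t) := by
    intro ε hε
    have hε0 : (ε : ℂ) ≠ 0 := by exact_mod_cast hε.ne'
    have h := Measure.integral_comp_mul_left
      (fun s : ℝ => (ε : ℂ) * ((ε : ℂ) / ((ε : ℂ) ^ 2 + (s : ℂ) ^ 2) * G (ε, s))) ε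
    rw [integral_const_mul (ε : ℂ) (fun s : ℝ => (ε : ℂ) / ((ε : ℂ) ^ 2 + (s : ℂ) ^ 2) * G (ε, s)),
      abs_of_pos (inv_pos.mpr hε), Complex.real_smul, Complex.ofReal_inv,
      inv_mul_cancel_left₀ hε0] at h
    rw [← h]
    refine integral_congr_ae (ae_of_all _ fun t => ?_)
    have h1 := sq_add_sq_ofReal_ne_zero hε.ne' (ε * t)
    have h2 := sq_add_sq_ofReal_ne_zero one_ne_zero t
    push_cast at h1 h2 ⊢
    rw [one_pow] at h2
    rw [← mul_assoc]
    congr 1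
    field_simp
  refine Tendsto.congr' (f₁ := fun ε : ℝ => ∫ t : ℝ, (((1 + t ^ 2)⁻¹ : ℝ) : ℂ) * G (ε, ε * t))
    (eventually_nhdsWithin_of_forall fun ε hε => (hscale ε hε).symm) ?_
  have hlim : (Real.pi : ℂ) * G (0, 0) = ∫ t : ℝ, (((1 + t ^ 2)⁻¹ : ℝ) : ℂ) * G (0, 0) := by
    rw [integral_mul_const, integral_complex_ofReal, integral_univ_inv_one_add_sq]
  rw [hlim]
  refine tendsto_integral_filter_of_dominated_convergence (fun t : ℝ => (1 + t ^ 2)⁻¹ * C) ?_ ?_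
    (integrable_inv_one_add_sq.mul_const C) ?_
  · filter_upwards [eventually_Ioc_half] with ε hε
    have h1 := continuous_slice hG (ε := ε) ⟨by linarith [hε.1], by linarith [hε.2]⟩
    have h2 : Continuous fun t : ℝ => (1 + t ^ 2)⁻¹ :=
      Continuous.inv₀ (by fun_prop) fun t => by positivity
    exact ((Complex.continuous_ofReal.comp h2).mul
      (h1.comp (continuous_const.mul continuous_id))).aestronglyMeasurable
  · filter_upwards [eventually_Ioc_half] with ε hε
    refine ae_of_all _ fun t => ?_
    have h0 : (0 : ℝ) ≤ (1 + t ^ 2)⁻¹ := by positivity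
    rw [norm_mul, Complex.norm_real, Real.norm_of_nonneg h0]
    exact mul_le_mul_of_nonneg_left (hC ε ⟨hε.1.le, hε.2⟩ _) h0
  · refine ae_of_all _ fun t => tendsto_const_nhds.mul ?_
    have h1 := continuousAt_of_continuousOn_strip hG (ε := 0) (by norm_num) (0 : ℝ)
    refine h1.tendsto.comp (Tendsto.mono_left ?_ nhdsWithin_le_nhds)
    have : ContinuousAt (fun ε : ℝ => (ε, ε * t)) 0 := by fun_prop
    simpa [ContinuousAt] using this

/-- The conjugate Poisson kernel converges to the principal value. -/
theorem tendsto_integral_conj_poisson {G : ℝ × ℝ → ℂ} {M C : ℝ}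
    (hG : ContinuousOn G (Ioo (-1) 1 ×ˢ univ)) (hM : ∀ ε s, M < |s| → G (ε, s) = 0)
    (hC : ∀ ε ∈ Icc (0 : ℝ) (1 / 2), ∀ s : ℝ, 0 < s → ‖G (ε, s) - G (ε, -s)‖ ≤ C * s) :
    Tendsto (fun ε : ℝ => ∫ s : ℝ, (s : ℂ) / ((ε : ℂ) ^ 2 + (s : ℂ) ^ 2) * G (ε, s)) (𝓝[>] 0)
      (𝓝 (pvInv fun s => G (0, s))) := by
  have hcont : ∀ ε : ℝ, ε ∈ Ioc (0 : ℝ) (1 / 2) →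
      Continuous fun s : ℝ => (s : ℂ) / ((ε : ℂ) ^ 2 + (s : ℂ) ^ 2) * G (ε, s) := fun ε hε =>
    (Continuous.div (by fun_prop) (by fun_prop)
      (sq_add_sq_ofReal_ne_zero hε.1.ne')).mul
      (continuous_slice hG ⟨by linarith [hε.1], by linarith [hε.2]⟩)
  have hint : ∀ ε : ℝ, ε ∈ Ioc (0 : ℝ) (1 / 2) →
      Integrable fun s : ℝ => (s : ℂ) / ((ε : ℂ) ^ 2 + (s : ℂ) ^ 2) * G (ε, s) := fun ε hε =>
    (hcont ε hε).integrable_of_hasCompactSupport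
      (HasCompactSupport.intro (isCompact_Icc (a := -M) (b := M)) fun s hs => by
        rw [hM ε s (not_le.mp fun h => hs (abs_le.mp h)), mul_zero])
  have hfold : ∀ ε : ℝ, ε ∈ Ioc (0 : ℝ) (1 / 2) →
      ∫ s : ℝ, (s : ℂ) / ((ε : ℂ) ^ 2 + (s : ℂ) ^ 2) * G (ε, s) =
        ∫ s in Ioi (0 : ℝ), (s : ℂ) / ((ε : ℂ) ^ 2 + (s : ℂ) ^ 2) * (G (ε, s) - G (ε, -s)) := by
    intro ε hε
    have hi := hint ε hε
    rw [← integral_add_compl measurableSet_Ioi hi (s := Ioi (0 : ℝ)), compl_Ioi]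
    have h := integral_comp_neg_Ioi 0
      (fun s : ℝ => (s : ℂ) / ((ε : ℂ) ^ 2 + (s : ℂ) ^ 2) * G (ε, s))
    rw [neg_zero] at h
    rw [← h, ← integral_add hi.integrableOn hi.comp_neg.integrableOn]
    refine integral_congr_ae (ae_of_all _ fun s => ?_)
    push_cast
    ring
  refine Tendsto.congr' (f₁ := fun ε : ℝ => ∫ s in Ioi (0 : ℝ),
    (s : ℂ) / ((ε : ℂ) ^ 2 + (s : ℂ) ^ 2) * (G (ε, s) - G (ε, -s))) ?_ ?_
  · filter_upwards [eventually_Ioc_half] with ε hε using (hfold ε hε).symm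
  refine tendsto_integral_filter_of_dominated_convergence ((Ioc 0 M).indicator fun _ => C) ?_ ?_ ?_
    ?_
  · filter_upwards [eventually_Ioc_half] with ε hε
    have h1 := continuous_slice hG (ε := ε) ⟨by linarith [hε.1], by linarith [hε.2]⟩
    exact ((Continuous.div (by fun_prop) (by fun_prop)
      (sq_add_sq_ofReal_ne_zero hε.1.ne')).mul
      (h1.sub (h1.comp continuous_neg))).aestronglyMeasurable
  · filter_upwards [eventually_Ioc_half] with ε hε
    filter_upwards [ae_restrict_mem measurableSet_Ioi] with s hs
    have hs : 0 < s := hs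
    rcases le_or_gt s M with h | h
    · rw [indicator_of_mem (show s ∈ Ioc 0 M from ⟨hs, h⟩), norm_mul]
      have hk : ‖(s : ℂ) / ((ε : ℂ) ^ 2 + (s : ℂ) ^ 2)‖ ≤ s⁻¹ := by
        have e : (s : ℂ) / ((ε : ℂ) ^ 2 + (s : ℂ) ^ 2) = ((s / (ε ^ 2 + s ^ 2) : ℝ) : ℂ) := by
          push_cast; rfl
        rw [e, Complex.norm_real, Real.norm_of_nonneg (by positivity), div_le_iff₀ (by positivity),
          inv_mul_eq_div, le_div_iff₀ hs]
        nlinarith [sq_nonneg ε]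
      calc _ ≤ s⁻¹ * (C * s) :=
            mul_le_mul hk (hC ε ⟨hε.1.le, hε.2⟩ s hs) (norm_nonneg _) (by positivity)
        _ = C := by field_simp
    · rw [indicator_of_notMem (fun h' : s ∈ Ioc 0 M => h'.2.not_gt h),
        hM ε s (h.trans_le (le_abs_self s)), hM ε (-s) (by rw [abs_neg]; exact h.trans_le (le_abs_self s))]
      simp
  · refine IntegrableOn.integrable_indicator ?_ measurableSet_Ioc
    refine (integrableOn_const (by simp)).mono_measure Measure.restrict_le_self
  · filter_upwards [ae_restrict_mem measurableSet_Ioi] with s hs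
    have hs0 : (s : ℂ) ≠ 0 := by exact_mod_cast (show (0 : ℝ) < s from hs).ne'
    have e : (G (0, s) - G (0, -s)) / (s : ℂ) =
        (s : ℂ) / (((0 : ℝ) : ℂ) ^ 2 + (s : ℂ) ^ 2) * (G (0, s) - G (0, -s)) := by
      rw [Complex.ofReal_zero]; field_simp; ring
    rw [e]
    refine Tendsto.mono_left ?_ nhdsWithin_le_nhds
    have h1 : ∀ x : ℝ, ContinuousAt (fun ε : ℝ => G (ε, x)) 0 := fun x =>
      ContinuousAt.comp (f := fun ε : ℝ => (ε, x)) (g := G)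
        (continuousAt_of_continuousOn_strip hG (by norm_num) x) (by fun_prop)
    have h2 : ContinuousAt (fun ε : ℝ => (s : ℂ) / ((ε : ℂ) ^ 2 + (s : ℂ) ^ 2) *
        (G (ε, s) - G (ε, -s))) 0 := by
      refine ContinuousAt.mul (ContinuousAt.div (by fun_prop) (by fun_prop) ?_) ((h1 s).sub (h1 (-s)))
      simpa using hs0
    exact h2.tendsto

theorem measurePreserving_shear :
    MeasurePreserving (fun z : ℝ × ℝ => (z.1 - z.2, z.2)) volume volume := by
  have h := (Measure.measurePreserving_swap (μ := (volume : Measure ℝ)) (ν := volume)).comp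
    ((measurePreserving_prod_sub (volume : Measure ℝ) volume).comp
      (Measure.measurePreserving_swap (μ := (volume : Measure ℝ)) (ν := volume)))
  exact h

theorem integral_shear {f : ℝ × ℝ → ℂ} (hf : Integrable f) :
    ∫ p, f p = ∫ s : ℝ, ∫ b : ℝ, f (s - b, b) := by
  have hm := measurePreserving_shear
  have h1 : Integrable (fun z : ℝ × ℝ => f (z.1 - z.2, z.2)) :=
    (hm.integrable_comp hf.aestronglyMeasurable).mpr hf
  have h2 : ∫ p, f p = ∫ z : ℝ × ℝ, f (z.1 - z.2, z.2) := by
    conv_lhs => rw [← hm.map_eq]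
    exact integral_map hm.measurable.aemeasurable (by rw [hm.map_eq]; exact hf.aestronglyMeasurable)
  rw [h2]
  exact integral_prod _ h1

/-- The integral of `F(ε, ·)` over the line `α + β = s`. -/
noncomputable def lineIntegral (F : ℝ × ℝ × ℝ → ℂ) (z : ℝ × ℝ) : ℂ := ∫ b : ℝ, F (z.1, z.2 - b, b)

section
variable {F : ℝ × ℝ × ℝ → ℂ} {M : ℝ}

theorem continuousOn_lineIntegral (hF : ContinuousOn F (Ioo (-1) 1 ×ˢ univ))
    (hM : ∀ ε p, M < |p.1| ∨ M < |p.2| → F (ε, p) = 0) :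
    ContinuousOn (lineIntegral F) (Ioo (-1) 1 ×ˢ univ) := by
  refine continuousOn_integral_of_compact_support (k := Icc (-M) M)
    (f := fun z : ℝ × ℝ => fun b : ℝ => F (z.1, z.2 - b, b)) isCompact_Icc ?_ ?_
  · exact hF.comp (f := fun w : (ℝ × ℝ) × ℝ => (w.1.1, w.1.2 - w.2, w.2)) (by fun_prop)
      fun w hw => ⟨hw.1.1, trivial⟩
  · intro z b _ hb
    exact hM _ _ (Or.inr (not_le.mp fun h => hb (abs_le.mp h)))

theorem lineIntegral_eq_zero (hM : ∀ ε p, M < |p.1| ∨ M < |p.2| → F (ε, p) = 0) (ε s : ℝ)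
    (hs : 2 * M < |s|) : lineIntegral F (ε, s) = 0 := by
  rw [lineIntegral, ← integral_zero ℝ ℂ]
  refine integral_congr_ae (ae_of_all _ fun b => hM _ _ ?_)
  by_contra! h
  have := abs_add_le (s - b) b
  rw [sub_add_cancel] at this
  simp only at h
  linarith [h.1, h.2]

theorem integral_mul_eq_lineIntegral (hF : ContinuousOn F (Ioo (-1) 1 ×ˢ univ))
    (hM : ∀ ε p, M < |p.1| ∨ M < |p.2| → F (ε, p) = 0) {k : ℝ → ℂ} (hk : Continuous k) {ε : ℝ}
    (hε : ε ∈ Ioo (-1 : ℝ) 1) :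
    ∫ p : ℝ × ℝ, k (p.1 + p.2) * F (ε, p) = ∫ s : ℝ, k s * lineIntegral F (ε, s) := by
  have hc : Continuous fun p : ℝ × ℝ => F (ε, p) :=
    hF.comp_continuous (by fun_prop) fun _ => ⟨hε, trivial⟩
  rw [integral_shear]
  · refine integral_congr_ae (ae_of_all _ fun s => ?_)
    simp only [sub_add_cancel]
    rw [integral_const_mul]
    rfl
  · refine Continuous.integrable_of_hasCompactSupport
      ((hk.comp (by fun_prop)).mul hc)
      (HasCompactSupport.intro ((isCompact_Icc (a := -M) (b := M)).prod
        (isCompact_Icc (a := -M) (b := M))) fun p hp => ?_)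
    rw [hM, mul_zero]
    by_contra! h
    exact hp ⟨abs_le.mp h.1, abs_le.mp h.2⟩

theorem tendsto_integral_poisson_add (hF : ContinuousOn F (Ioo (-1) 1 ×ˢ univ))
    (hM : ∀ ε p, M < |p.1| ∨ M < |p.2| → F (ε, p) = 0) :
    Tendsto (fun ε : ℝ => ∫ p : ℝ × ℝ,
      (ε : ℂ) / ((ε : ℂ) ^ 2 + ((p.1 + p.2 : ℝ) : ℂ) ^ 2) * F (ε, p)) (𝓝[>] 0)
      (𝓝 (Real.pi * ∫ b : ℝ, F (0, -b, b))) := by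
  have h := tendsto_integral_poisson (continuousOn_lineIntegral hF hM) (lineIntegral_eq_zero hM)
  simp only [lineIntegral, zero_sub] at h
  refine h.congr' ?_
  filter_upwards [eventually_Ioc_half] with ε hε
  exact (integral_mul_eq_lineIntegral hF hM
    (k := fun s => (ε : ℂ) / ((ε : ℂ) ^ 2 + (s : ℂ) ^ 2))
    (Continuous.div (by fun_prop) (by fun_prop) (sq_add_sq_ofReal_ne_zero hε.1.ne'))
    ⟨by linarith [hε.1], by linarith [hε.2]⟩).symm

theorem exists_norm_sub_le (hF : ContDiffOn ℝ 1 F (Ioo (-1) 1 ×ˢ univ))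
    (hM : ∀ ε p, M < |p.1| ∨ M < |p.2| → F (ε, p) = 0) :
    ∃ C : ℝ, 0 ≤ C ∧ ∀ ε ∈ Icc (0 : ℝ) (1 / 2), ∀ s : ℝ, 0 < s → ∀ b : ℝ,
      ‖F (ε, s - b, b) - F (ε, -s - b, b)‖ ≤ C * s := by
  have hK : IsCompact (Icc (0 : ℝ) (1 / 2) ×ˢ (Icc (-(3 * M)) (3 * M) ×ˢ Icc (-M) M)) :=
    isCompact_Icc.prod (isCompact_Icc.prod isCompact_Icc)
  have hconv : Convex ℝ (Icc (0 : ℝ) (1 / 2) ×ˢ (Icc (-(3 * M)) (3 * M) ×ˢ Icc (-M) M)) :=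
    (convex_Icc _ _).prod ((convex_Icc _ _).prod (convex_Icc _ _))
  obtain ⟨L, hL⟩ := (hF.mono (prod_mono (fun x hx => ⟨by linarith [hx.1], by linarith [hx.2]⟩)
    (subset_univ _))).exists_lipschitzOnWith one_ne_zero hconv hK
  refine ⟨2 * L, by positivity, fun ε hε s hs b => ?_⟩
  rcases lt_or_ge M |b| with hb | hb
  · rw [hM _ _ (Or.inr hb), hM _ _ (Or.inr hb), sub_zero, norm_zero]
    positivity
  have hb' := abs_le.mp hb
  rcases lt_or_ge (2 * M) s with h | h
  · have h1 : M < |s - b| := lt_of_lt_of_le (by linarith) (le_abs_self _)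
    have h2 : M < |-s - b| := lt_of_lt_of_le (by linarith) (neg_le_abs _)
    rw [hM _ _ (Or.inl h1), hM _ _ (Or.inl h2), sub_zero, norm_zero]
    positivity
  · have h1 := hL.dist_le_mul (ε, s - b, b) ⟨hε, ⟨by linarith, by linarith⟩, hb'⟩
      (ε, -s - b, b) ⟨hε, ⟨by linarith, by linarith⟩, hb'⟩
    rw [dist_eq_norm] at h1
    refine h1.trans (le_of_eq ?_)
    rw [Prod.dist_eq, Prod.dist_eq, dist_self, dist_self, Real.dist_eq]
    have e : s - b - (-s - b) = 2 * s := by ring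
    simp only [e, abs_of_pos (show 0 < 2 * s by linarith)]
    rw [max_eq_right (le_max_of_le_left (by linarith)), max_eq_left (by linarith)]
    ring

theorem integrable_lineSlice (hF : ContinuousOn F (Ioo (-1) 1 ×ˢ univ))
    (hM : ∀ ε p, M < |p.1| ∨ M < |p.2| → F (ε, p) = 0) {ε : ℝ} (hε : ε ∈ Ioo (-1 : ℝ) 1) (s : ℝ) :
    Integrable fun b : ℝ => F (ε, s - b, b) :=
  (hF.comp_continuous (f := fun b : ℝ => (ε, s - b, b)) (by fun_prop)
    fun _ => ⟨hε, trivial⟩).integrable_of_hasCompactSupport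
    (HasCompactSupport.intro (isCompact_Icc (a := -M) (b := M)) fun b hb =>
      hM _ _ (Or.inr (not_le.mp fun h => hb (abs_le.mp h))))

theorem pvInv_lineIntegral (hF : ContDiffOn ℝ 1 F (Ioo (-1) 1 ×ˢ univ))
    (hM : ∀ ε p, M < |p.1| ∨ M < |p.2| → F (ε, p) = 0) :
    pvInv (fun s => lineIntegral F (0, s)) = pvInvSum fun p => F (0, p) := by
  obtain ⟨C, hC0, hC⟩ := exists_norm_sub_le hF hM
  have hc : Continuous fun p : ℝ × ℝ => F (0, p) :=
    hF.continuousOn.comp_continuous (by fun_prop) fun _ => ⟨by norm_num, trivial⟩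
  have hi : Integrable (Function.uncurry fun (s b : ℝ) =>
      (F (0, s - b, b) - F (0, -s - b, b)) / (s : ℂ))
      ((volume.restrict (Ioi (0 : ℝ))).prod (volume : Measure ℝ)) := by
    have hr : (volume.restrict (Ioi (0 : ℝ))).prod (volume : Measure ℝ) =
        ((volume : Measure ℝ).prod volume).restrict (Ioi 0 ×ˢ univ) := by
      rw [← Measure.prod_restrict, Measure.restrict_univ]
    have hms : MeasurableSet (Ioi (0 : ℝ) ×ˢ (univ : Set ℝ)) :=
      measurableSet_Ioi.prod MeasurableSet.univ
    rw [hr]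
    have hmb : MeasurableSet (Icc 0 (2 * M) ×ˢ Icc (-M) M) :=
      measurableSet_Icc.prod measurableSet_Icc
    have hbound : Integrable ((Icc 0 (2 * M) ×ˢ Icc (-M) M).indicator fun _ : ℝ × ℝ => C)
        (((volume : Measure ℝ).prod volume).restrict (Ioi 0 ×ˢ univ)) :=
      (IntegrableOn.integrable_indicator (integrableOn_const
        (isCompact_Icc.prod isCompact_Icc).measure_lt_top.ne) hmb).mono_measure
        Measure.restrict_le_self
    refine hbound.mono' ?_ ?_
    · refine ContinuousOn.aestronglyMeasurable (fun z hz => ?_) hms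
      have hz0 : (z.1 : ℂ) ≠ 0 := by exact_mod_cast (show (0 : ℝ) < z.1 from hz.1).ne'
      refine ContinuousAt.continuousWithinAt (ContinuousAt.div (ContinuousAt.sub ?_ ?_)
        (by fun_prop) hz0)
      · exact (hc.comp (f := fun z : ℝ × ℝ => (z.1 - z.2, z.2)) (by fun_prop)).continuousAt
      · exact (hc.comp (f := fun z : ℝ × ℝ => (-z.1 - z.2, z.2)) (by fun_prop)).continuousAt
    · filter_upwards [ae_restrict_mem hms] with z hz
      have hz1 : 0 < z.1 := hz.1
      by_cases hmem : z ∈ Icc 0 (2 * M) ×ˢ Icc (-M) M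
      · rw [indicator_of_mem hmem, Function.uncurry, norm_div, Complex.norm_real,
          Real.norm_of_nonneg hz1.le, div_le_iff₀ hz1]
        exact hC 0 (by norm_num) z.1 hz1 z.2
      · rw [indicator_of_notMem hmem, Function.uncurry]
        have hz2 : ∀ s, |s| = z.1 → F (0, s - z.2, z.2) = 0 := by
          intro s hs
          refine hM _ _ ?_
          by_contra! h
          have h3 := abs_add_le (s - z.2) z.2
          rw [sub_add_cancel, hs] at h3
          exact hmem ⟨⟨hz1.le, by linarith [h.1, h.2]⟩, abs_le.mp h.2⟩
        rw [hz2 z.1 (abs_of_pos hz1), hz2 (-z.1) (by rw [abs_neg, abs_of_pos hz1])]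
        simp
  have h0 : (0 : ℝ) ∈ Ioo (-1 : ℝ) 1 := by norm_num
  calc pvInv (fun s => lineIntegral F (0, s))
      = ∫ s in Ioi (0 : ℝ), ∫ b : ℝ, (F (0, s - b, b) - F (0, -s - b, b)) / (s : ℂ) := by
        refine integral_congr_ae (ae_of_all _ fun s => ?_)
        simp only [lineIntegral]
        rw [integral_div, integral_sub (integrable_lineSlice hF.continuousOn hM h0 s)
          (integrable_lineSlice hF.continuousOn hM h0 (-s))]
    _ = _ := integral_integral_swap hi

theorem tendsto_integral_cauchy_add (hF : ContDiffOn ℝ 1 F (Ioo (-1) 1 ×ˢ univ))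
    (hM : ∀ ε p, M < |p.1| ∨ M < |p.2| → F (ε, p) = 0) :
    Tendsto (fun ε : ℝ => ∫ p : ℝ × ℝ,
      1 / ((ε : ℂ) + Complex.I * ((p.1 + p.2 : ℝ) : ℂ)) * F (ε, p)) (𝓝[>] 0)
      (𝓝 (Real.pi * (∫ b : ℝ, F (0, -b, b)) - Complex.I * pvInvSum fun p => F (0, p))) := by
  obtain ⟨C, hC0, hC⟩ := exists_norm_sub_le hF hM
  have hG := continuousOn_lineIntegral hF.continuousOn hM
  have h1 := tendsto_integral_poisson hG (lineIntegral_eq_zero hM)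
  have h2 := tendsto_integral_conj_poisson hG (lineIntegral_eq_zero hM)
    (C := volume.real (Icc (-M) M) * C) (by
      intro ε hε s hs
      have hε' : ε ∈ Ioo (-1 : ℝ) 1 := ⟨by linarith [hε.1], by linarith [hε.2]⟩
      simp only [lineIntegral]
      rw [← integral_sub (integrable_lineSlice hF.continuousOn hM hε' s)
        (integrable_lineSlice hF.continuousOn hM hε' (-s)),
        ← setIntegral_eq_integral_of_forall_compl_eq_zero (s := Icc (-M) M) (fun b hb => by
          have hb' : M < |b| := not_le.mp fun h => hb (abs_le.mp h)
          rw [hM _ _ (Or.inr hb'), hM _ _ (Or.inr hb'), sub_zero])]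
      refine (norm_setIntegral_le_of_norm_le_const isCompact_Icc.measure_lt_top
        fun b _ => hC ε hε s hs b).trans (le_of_eq (by ring)))
  rw [pvInv_lineIntegral hF hM] at h2
  have h3 := h1.sub (h2.const_mul Complex.I)
  have e0 : lineIntegral F (0, 0) = ∫ b : ℝ, F (0, -b, b) := by simp [lineIntegral]
  rw [e0] at h3
  refine h3.congr' ?_
  filter_upwards [eventually_Ioc_half] with ε hε
  have hε' : ε ∈ Ioo (-1 : ℝ) 1 := ⟨by linarith [hε.1], by linarith [hε.2]⟩
  have hne : ∀ s : ℝ, (ε : ℂ) + Complex.I * (s : ℂ) ≠ 0 := fun s h => by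
    have := congrArg Complex.re h
    simp at this
    exact hε.1.ne' this
  have hcs : HasCompactSupport fun s : ℝ => lineIntegral F (ε, s) :=
    HasCompactSupport.intro (isCompact_Icc (a := -(2 * M)) (b := 2 * M)) fun s hs =>
      lineIntegral_eq_zero hM ε s (not_le.mp fun h => hs (abs_le.mp h))
  have hgc := continuous_slice hG hε'
  rw [integral_mul_eq_lineIntegral hF.continuousOn hM
    (k := fun s => 1 / ((ε : ℂ) + Complex.I * (s : ℂ)))
    (Continuous.div (by fun_prop) (by fun_prop) hne) hε', ← integral_const_mul, ← integral_sub]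
  · refine integral_congr_ae (ae_of_all _ fun s => ?_)
    have h4 := sq_add_sq_ofReal_ne_zero hε.1.ne' s
    have h5 := hne s
    have h6 : 1 / ((ε : ℂ) + Complex.I * (s : ℂ)) =
        ((ε : ℂ) - Complex.I * s) / ((ε : ℂ) ^ 2 + (s : ℂ) ^ 2) := by
      rw [div_eq_div_iff h5 h4]
      linear_combination (s : ℂ) ^ 2 * Complex.I_sq
    simp only [h6]
    ring
  · exact Continuous.integrable_of_hasCompactSupport
      ((Continuous.div (by fun_prop) (by fun_prop) (sq_add_sq_ofReal_ne_zero hε.1.ne')).mul hgc)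
      hcs.mul_left
  · exact (Continuous.integrable_of_hasCompactSupport
      ((Continuous.div (by fun_prop) (by fun_prop) (sq_add_sq_ofReal_ne_zero hε.1.ne')).mul hgc)
      hcs.mul_left).const_mul _

end

theorem contDiffAt_Gamma {z : ℂ} (hz : 0 < z.re) : ContDiffAt ℝ 1 Complex.Gamma z := by
  have ho : IsOpen {w : ℂ | 0 < w.re} := isOpen_lt continuous_const Complex.continuous_re
  have hd : DifferentiableOn ℂ Complex.Gamma {w : ℂ | 0 < w.re} := fun w hw =>
    (Complex.differentiableAt_Gamma w fun m h => by
      have h1 := congrArg Complex.re h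
      have h2 : 0 < w.re := hw
      simp only [Complex.neg_re, Complex.natCast_re] at h1
      linarith [(Nat.cast_nonneg m : (0 : ℝ) ≤ m)]).differentiableWithinAt
  exact ((hd.contDiffOn ho).contDiffAt (ho.mem_nhds hz)).restrict_scalars ℝ

theorem contDiff_inv_Gamma : ContDiff ℝ 1 fun z : ℂ => (Complex.Gamma z)⁻¹ :=
  (Complex.differentiable_one_div_Gamma.contDiff (n := 1)).restrict_scalars ℝ

theorem ContDiffAt.Gamma_comp {E : Type*} [NormedAddCommGroup E] [NormedSpace ℝ E] {f : E → ℂ}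
    {x : E} (hf : ContDiffAt ℝ 1 f x) (hx : 0 < (f x).re) :
    ContDiffAt ℝ 1 (fun y => Complex.Gamma (f y)) x :=
  (contDiffAt_Gamma hx).comp x hf

theorem ContDiff.inv_Gamma_comp {E : Type*} [NormedAddCommGroup E] [NormedSpace ℝ E] {f : E → ℂ}
    (hf : ContDiff ℝ 1 f) : ContDiff ℝ 1 fun y => (Complex.Gamma (f y))⁻¹ :=
  contDiff_inv_Gamma.comp hf

theorem contDiff_ofReal_comp {E : Type*} [NormedAddCommGroup E] [NormedSpace ℝ E] {f : E → ℝ}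
    (hf : ContDiff ℝ 1 f) : ContDiff ℝ 1 fun y => (f y : ℂ) :=
  Complex.ofRealCLM.contDiff.comp hf

theorem contDiff_two_cpow {E : Type*} [NormedAddCommGroup E] [NormedSpace ℝ E] {f : E → ℂ}
    (hf : ContDiff ℝ 1 f) : ContDiff ℝ 1 fun y => (2 : ℂ) ^ f y := by
  simp_rw [Complex.cpow_def_of_ne_zero two_ne_zero]
  exact (contDiff_const.mul hf).cexp

/-- Euler's reflection formula on the line `1 + iℝ`. -/
theorem Gamma_one_add_mul_Gamma_one_sub {d : ℝ} (hd : d ≠ 0) :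
    Complex.Gamma (1 + Complex.I * d / 2) * Complex.Gamma (1 - Complex.I * d / 2) =
      ((Real.pi * d / 2 / Real.sinh (Real.pi * d / 2) : ℝ) : ℂ) := by
  have hz : Complex.I * d / 2 ≠ 0 := by simp [hd]
  have hdc : (d : ℂ) ≠ 0 := by exact_mod_cast hd
  have hs : Real.sinh (Real.pi * d / 2) ≠ 0 := by
    rw [Ne, Real.sinh_eq_zero]
    have := Real.pi_ne_zero
    positivity
  have hs' : Complex.sinh ((Real.pi : ℂ) * d / 2) ≠ 0 := by
    have : ((Real.sinh (Real.pi * d / 2) : ℝ) : ℂ) ≠ 0 := by exact_mod_cast hs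
    simpa using this
  rw [add_comm, Complex.Gamma_add_one _ hz, mul_assoc, Complex.Gamma_mul_Gamma_one_sub,
    show (Real.pi : ℂ) * (Complex.I * d / 2) = ((Real.pi : ℂ) * d / 2) * Complex.I by ring,
    Complex.sin_mul_I]
  push_cast
  field_simp

/-- The regular factor of `regJJ (1 - ε) α β`. -/
noncomputable def factorJJ (z : ℝ × ℝ × ℝ) : ℂ :=
  (2 : ℂ) ^ (z.1 : ℂ) * Complex.Gamma ((1 - z.1 : ℝ) : ℂ) *
    Complex.Gamma (1 + (((z.1 : ℝ) : ℂ) + Complex.I * ((z.2.1 + z.2.2 : ℝ) : ℂ)) / 2) *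
    (Complex.Gamma (1 + (Complex.I * ((z.2.1 + z.2.2 : ℝ) : ℂ) - ((z.1 : ℝ) : ℂ)) / 2))⁻¹ *
    (Complex.Gamma (1 - (((z.1 : ℝ) : ℂ) + Complex.I * ((z.2.1 - z.2.2 : ℝ) : ℂ)) / 2))⁻¹ *
    (Complex.Gamma (1 + (Complex.I * ((z.2.1 - z.2.2 : ℝ) : ℂ) - ((z.1 : ℝ) : ℂ)) / 2))⁻¹

theorem contDiffOn_factorJJ : ContDiffOn ℝ 1 factorJJ (Ioo (-1) 1 ×ˢ univ) := by
  intro z hz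
  have h1 : z.1 ∈ Ioo (-1 : ℝ) 1 := hz.1
  have c1 : ContDiff ℝ 1 fun z : ℝ × ℝ × ℝ => (z.1 : ℂ) := contDiff_ofReal_comp contDiff_fst
  have cs : ContDiff ℝ 1 fun z : ℝ × ℝ × ℝ => Complex.I * ((z.2.1 + z.2.2 : ℝ) : ℂ) :=
    contDiff_const.mul (contDiff_ofReal_comp (by fun_prop))
  have cd : ContDiff ℝ 1 fun z : ℝ × ℝ × ℝ => Complex.I * ((z.2.1 - z.2.2 : ℝ) : ℂ) :=
    contDiff_const.mul (contDiff_ofReal_comp (by fun_prop))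
  refine ContDiffAt.contDiffWithinAt ?_
  refine ((((ContDiffAt.mul ?_ ?_).mul ?_).mul ?_).mul ?_).mul ?_
  · exact (contDiff_two_cpow c1).contDiffAt
  · exact ContDiffAt.Gamma_comp (contDiff_ofReal_comp (by fun_prop)).contDiffAt (by
      simpa using h1.2)
  · exact ContDiffAt.Gamma_comp
      (contDiff_const.add ((c1.add cs).div_const 2)).contDiffAt (by
        simp; linarith [h1.1])
  · exact (ContDiff.inv_Gamma_comp (contDiff_const.add ((cs.sub c1).div_const 2))).contDiffAt
  · exact (ContDiff.inv_Gamma_comp (contDiff_const.sub ((c1.add cd).div_const 2))).contDiffAt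
  · exact (ContDiff.inv_Gamma_comp (contDiff_const.add ((cd.sub c1).div_const 2))).contDiffAt

theorem regJJ_eq_factorJJ {ε : ℝ} (h0 : 0 < ε) (h1 : ε < 1 / 2) (p : ℝ × ℝ) :
    regJJ (1 - ε) p.1 p.2 =
      1 / ((ε : ℂ) + Complex.I * ((p.1 + p.2 : ℝ) : ℂ)) * factorJJ (ε, p) := by
  have hne : (ε : ℂ) + Complex.I * ((p.1 + p.2 : ℝ) : ℂ) ≠ 0 := fun h => by
    have := congrArg Complex.re h
    simp at this
    exact h0.ne' this
  have hG := Complex.Gamma_add_one (((ε : ℂ) + Complex.I * ((p.1 + p.2 : ℝ) : ℂ)) / 2)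
    (div_ne_zero hne two_ne_zero)
  rw [regJJ_eq (by linarith) (by linarith), factorJJ]
  have e0 : (2 : ℂ) ^ (-((1 - ε : ℝ) : ℂ)) = 2 ^ (ε : ℂ) / 2 := by
    rw [show -((1 - ε : ℝ) : ℂ) = (ε : ℂ) - 1 by push_cast; ring, Complex.cpow_sub _ _ two_ne_zero,
      Complex.cpow_one]
  have e1 : (1 + Complex.I * ((p.1 : ℂ) + p.2) - ((1 - ε : ℝ) : ℂ)) / 2 =
      ((ε : ℂ) + Complex.I * ((p.1 + p.2 : ℝ) : ℂ)) / 2 := by push_cast; ring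
  have e2 : (1 + Complex.I * ((p.1 : ℂ) + p.2) + ((1 - ε : ℝ) : ℂ)) / 2 =
      1 + (Complex.I * ((p.1 + p.2 : ℝ) : ℂ) - (ε : ℂ)) / 2 := by push_cast; ring
  have e3 : (1 + ((1 - ε : ℝ) : ℂ) - Complex.I * ((p.1 : ℂ) - p.2)) / 2 =
      1 - ((ε : ℂ) + Complex.I * ((p.1 - p.2 : ℝ) : ℂ)) / 2 := by push_cast; ring
  have e4 : (1 + ((1 - ε : ℝ) : ℂ) + Complex.I * ((p.1 : ℂ) - p.2)) / 2 =
      1 + (Complex.I * ((p.1 - p.2 : ℝ) : ℂ) - (ε : ℂ)) / 2 := by push_cast; ring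
  rw [e0, e1, e2, e3, e4, add_comm (1 : ℂ) (((ε : ℂ) + Complex.I * ((p.1 + p.2 : ℝ) : ℂ)) / 2), hG]
  generalize (ε : ℂ) + Complex.I * ((p.1 + p.2 : ℝ) : ℂ) = w at *
  simp only [div_eq_mul_inv, mul_inv]
  field_simp

theorem factorJJ_zero (p : ℝ × ℝ) : factorJJ (0, p) = sinhQuot p / Real.pi := by
  have hpi : (Real.pi : ℂ) ≠ 0 := by exact_mod_cast Real.pi_ne_zero
  have hG : Complex.Gamma (1 + Complex.I * ((p.1 + p.2 : ℝ) : ℂ) / 2) ≠ 0 :=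
    Complex.Gamma_ne_zero_of_re_pos (by simp)
  have hf : factorJJ (0, p) = (Complex.Gamma (1 + Complex.I * ((p.1 - p.2 : ℝ) : ℂ) / 2) *
      Complex.Gamma (1 - Complex.I * ((p.1 - p.2 : ℝ) : ℂ) / 2))⁻¹ := by
    simp only [factorJJ, Complex.ofReal_zero, sub_zero, zero_add, Complex.cpow_zero,
      Complex.ofReal_one, Complex.Gamma_one, one_mul, mul_inv_cancel₀ hG]
    rw [mul_inv, mul_comm]
  rw [hf, sinhQuot]
  split_ifs with h
  · simp [h, hpi]
  · have hd : p.1 - p.2 ≠ 0 := sub_ne_zero.mpr h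
    rw [Gamma_one_add_mul_Gamma_one_sub hd, ← Complex.ofReal_inv, ← Complex.ofReal_div]
    congr 1
    have := Real.pi_ne_zero
    rw [mul_comm (p.1 - p.2) Real.pi]
    field_simp

theorem pvInvSum_div_const (f : ℝ × ℝ → ℂ) (c : ℂ) :
    pvInvSum (fun p => f p / c) = pvInvSum f / c := by
  simp only [pvInvSum, pvInv]
  rw [← integral_div]
  refine integral_congr_ae (ae_of_all _ fun b => ?_)
  simp only
  rw [← integral_div]
  refine integral_congr_ae (ae_of_all _ fun y => ?_)
  ring

theorem exists_bound_support {φ : ℝ × ℝ → ℂ} (hs : HasCompactSupport φ) :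
    ∃ M : ℝ, ∀ p : ℝ × ℝ, M < |p.1| ∨ M < |p.2| → φ p = 0 := by
  obtain ⟨M, hM⟩ := hs.isCompact.isBounded.exists_norm_le
  refine ⟨M, fun p hp => ?_⟩
  by_contra h
  have h1 := hM p (subset_tsupport _ h)
  rw [Prod.norm_def, Real.norm_eq_abs, Real.norm_eq_abs] at h1
  rcases hp with hp | hp
  · linarith [le_max_left |p.1| |p.2|]
  · linarith [le_max_right |p.1| |p.2|]

theorem tendsto_one_sub_nhdsLT : Tendsto (fun ν : ℝ => 1 - ν) (𝓝[<] 1) (𝓝[>] 0) := by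
  refine tendsto_nhdsWithin_iff.mpr ⟨Tendsto.mono_left ?_ nhdsWithin_le_nhds,
    eventually_nhdsWithin_of_forall fun ν hν =>
      mem_Ioi.mpr (sub_pos.mpr (mem_Iio.mp hν))⟩
  have : ContinuousAt (fun ν : ℝ => 1 - ν) 1 := by fun_prop
  simpa [ContinuousAt] using this

theorem tendsto_integral_regJJ {φ : ℝ × ℝ → ℂ} (hφ : ContDiff ℝ 1 φ) (hs : HasCompactSupport φ) :
    Tendsto (fun ν : ℝ => ∫ p : ℝ × ℝ, regJJ ν p.1 p.2 * φ p) (𝓝[<] 1) (𝓝 (limitJJ φ)) := by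
  obtain ⟨M, hM⟩ := exists_bound_support hs
  have hpi : (Real.pi : ℂ) ≠ 0 := by exact_mod_cast Real.pi_ne_zero
  have hF : ContDiffOn ℝ 1 (fun z : ℝ × ℝ × ℝ => factorJJ z * φ z.2) (Ioo (-1) 1 ×ˢ univ) :=
    contDiffOn_factorJJ.mul (hφ.comp contDiff_snd).contDiffOn
  have h := (tendsto_integral_cauchy_add hF (M := M) fun ε p hp => by
    simp only [hM p hp, mul_zero]).comp tendsto_one_sub_nhdsLT
  have hlim : limitJJ φ = Real.pi * (∫ b : ℝ, factorJJ (0, -b, b) * φ (-b, b)) -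
      Complex.I * pvInvSum fun p => factorJJ (0, p) * φ p := by
    have e : ∀ p, factorJJ (0, p) * φ p = (sinhQuot p * φ p) / Real.pi := fun p => by
      rw [factorJJ_zero]; ring
    simp only [e]
    rw [pvInvSum_div_const, integral_div, limitJJ, deltaSum, mul_div_cancel₀ _ hpi,
      ← integral_neg_eq_self (fun a : ℝ => sinhQuot (a, -a) * φ (a, -a))]
    simp only [neg_neg]
    ring
  rw [hlim]
  refine h.congr' ?_
  have hev : ∀ᶠ ν : ℝ in 𝓝[<] 1, ν ∈ Ioo (1 / 2 : ℝ) 1 := Ioo_mem_nhdsLT (by norm_num)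
  filter_upwards [hev] with ν hν
  refine integral_congr_ae (ae_of_all _ fun p => ?_)
  have := regJJ_eq_factorJJ (ε := 1 - ν) (by linarith [hν.2]) (by linarith [hν.1]) p
  rw [sub_sub_cancel] at this
  simp only [this]
  ring

/-- The regular factor of `regKK (1 - ε) α β`. -/
noncomputable def factorKK (z : ℝ × ℝ × ℝ) : ℂ :=
  2 * 2 ^ (z.1 : ℂ) * (Complex.Gamma ((1 + z.1 : ℝ) : ℂ))⁻¹ *
    (Complex.Gamma (1 + (((z.1 : ℝ) : ℂ) + Complex.I * ((z.2.1 + z.2.2 : ℝ) : ℂ)) / 2) *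
      Complex.Gamma (1 + (((z.1 : ℝ) : ℂ) - Complex.I * ((z.2.1 + z.2.2 : ℝ) : ℂ)) / 2)) *
    (Complex.Gamma (1 + (((z.1 : ℝ) : ℂ) + Complex.I * ((z.2.1 - z.2.2 : ℝ) : ℂ)) / 2) *
      Complex.Gamma (1 + (((z.1 : ℝ) : ℂ) - Complex.I * ((z.2.1 - z.2.2 : ℝ) : ℂ)) / 2))

theorem contDiffOn_factorKK : ContDiffOn ℝ 1 factorKK (Ioo (-1) 1 ×ˢ univ) := by
  intro z hz
  have h1 : z.1 ∈ Ioo (-1 : ℝ) 1 := hz.1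
  have c1 : ContDiff ℝ 1 fun z : ℝ × ℝ × ℝ => (z.1 : ℂ) := contDiff_ofReal_comp contDiff_fst
  have cs : ContDiff ℝ 1 fun z : ℝ × ℝ × ℝ => Complex.I * ((z.2.1 + z.2.2 : ℝ) : ℂ) :=
    contDiff_const.mul (contDiff_ofReal_comp (by fun_prop))
  have cd : ContDiff ℝ 1 fun z : ℝ × ℝ × ℝ => Complex.I * ((z.2.1 - z.2.2 : ℝ) : ℂ) :=
    contDiff_const.mul (contDiff_ofReal_comp (by fun_prop))
  refine ContDiffAt.contDiffWithinAt ?_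
  refine (((ContDiffAt.mul ?_ ?_).mul (ContDiffAt.mul ?_ ?_))).mul (ContDiffAt.mul ?_ ?_)
  · exact (contDiff_const.mul (contDiff_two_cpow c1)).contDiffAt
  · exact (ContDiff.inv_Gamma_comp (contDiff_ofReal_comp (by fun_prop))).contDiffAt
  · exact ContDiffAt.Gamma_comp
      (contDiff_const.add ((c1.add cs).div_const 2)).contDiffAt (by simp; linarith [h1.1])
  · exact ContDiffAt.Gamma_comp
      (contDiff_const.add ((c1.sub cs).div_const 2)).contDiffAt (by simp; linarith [h1.1])
  · exact ContDiffAt.Gamma_comp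
      (contDiff_const.add ((c1.add cd).div_const 2)).contDiffAt (by simp; linarith [h1.1])
  · exact ContDiffAt.Gamma_comp
      (contDiff_const.add ((c1.sub cd).div_const 2)).contDiffAt (by simp; linarith [h1.1])

theorem Gamma_half_mul_Gamma_half {ε : ℝ} (hε : 0 < ε) (s : ℝ) :
    Complex.Gamma ((ε + Complex.I * s) / 2) * Complex.Gamma ((ε - Complex.I * s) / 2) =
      4 / ((ε : ℂ) ^ 2 + (s : ℂ) ^ 2) * (Complex.Gamma (1 + (ε + Complex.I * s) / 2) *
        Complex.Gamma (1 + (ε - Complex.I * s) / 2)) := by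
  have h1 : (ε : ℂ) + Complex.I * s ≠ 0 := fun h => by
    have := congrArg Complex.re h
    simp at this
    exact hε.ne' this
  have h2 : (ε : ℂ) - Complex.I * s ≠ 0 := fun h => by
    have := congrArg Complex.re h
    simp at this
    exact hε.ne' this
  have h3 : (ε : ℂ) ^ 2 + (s : ℂ) ^ 2 = (ε + Complex.I * s) * (ε - Complex.I * s) := by
    linear_combination (s : ℂ) ^ 2 * Complex.I_sq
  rw [add_comm (1 : ℂ), add_comm (1 : ℂ), Complex.Gamma_add_one _ (div_ne_zero h1 two_ne_zero),
    Complex.Gamma_add_one _ (div_ne_zero h2 two_ne_zero), h3]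
  field_simp
  ring

theorem regKK_eq_factorKK {ε : ℝ} (hε : 0 < ε) (p : ℝ × ℝ) :
    regKK (1 - ε) p.1 p.2 =
      ((ε : ℂ) / ((ε : ℂ) ^ 2 + ((p.1 + p.2 : ℝ) : ℂ) ^ 2) +
        (ε : ℂ) / ((ε : ℂ) ^ 2 + ((p.1 - p.2 : ℝ) : ℂ) ^ 2)) *
      (factorKK (ε, p) / (2 * ((ε : ℂ) ^ 2 + (p.1 : ℂ) ^ 2 + (p.2 : ℂ) ^ 2))) := by
  have hε0 : (ε : ℂ) ≠ 0 := by exact_mod_cast hε.ne'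
  have h1 := sq_add_sq_ofReal_ne_zero hε.ne' (p.1 + p.2)
  have h2 := sq_add_sq_ofReal_ne_zero hε.ne' (p.1 - p.2)
  have h3 : (ε : ℂ) ^ 2 + (p.1 : ℂ) ^ 2 + (p.2 : ℂ) ^ 2 ≠ 0 := by
    have : 0 < ε ^ 2 + p.1 ^ 2 + p.2 ^ 2 := by positivity
    exact_mod_cast this.ne'
  have hG : Complex.Gamma (ε : ℂ) ≠ 0 := Complex.Gamma_ne_zero_of_re_pos (by simpa using hε)
  have e0 : (2 : ℂ) ^ ((ε : ℂ) - 3) = 2 ^ (ε : ℂ) / 8 := by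
    rw [Complex.cpow_sub _ _ two_ne_zero, Complex.cpow_ofNat]
    norm_num
  have e1 : Complex.Gamma ((1 + ε : ℝ) : ℂ) = ε * Complex.Gamma ε := by
    rw [Complex.ofReal_add, add_comm, Complex.ofReal_one, Complex.Gamma_add_one _ hε0]
  have e2 : (ε : ℂ) / ((ε : ℂ) ^ 2 + ((p.1 + p.2 : ℝ) : ℂ) ^ 2) +
      (ε : ℂ) / ((ε : ℂ) ^ 2 + ((p.1 - p.2 : ℝ) : ℂ) ^ 2) =
      ε * (2 * ((ε : ℂ) ^ 2 + (p.1 : ℂ) ^ 2 + (p.2 : ℂ) ^ 2)) /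
      (((ε : ℂ) ^ 2 + ((p.1 + p.2 : ℝ) : ℂ) ^ 2) *
        ((ε : ℂ) ^ 2 + ((p.1 - p.2 : ℝ) : ℂ) ^ 2)) := by
    rw [div_add_div _ _ h1 h2]
    congr 1
    push_cast
    ring
  rw [regKK_eq hε, ← Complex.ofReal_add, ← Complex.ofReal_sub, Gamma_half_mul_Gamma_half hε,
    Gamma_half_mul_Gamma_half hε, e0, e2, factorKK, e1]
  simp only
  generalize ((p.1 + p.2 : ℝ) : ℂ) = s at *
  generalize ((p.1 - p.2 : ℝ) : ℂ) = d at *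
  field_simp
  ring

theorem integrable_regKK_mul {ν : ℝ} (hν : ν < 1) {φ : ℝ × ℝ → ℂ} (hφ : Continuous φ)
    (hs : HasCompactSupport φ) : Integrable fun p : ℝ × ℝ => regKK ν p.1 p.2 * φ p := by
  have hG : ∀ f : ℝ × ℝ → ℂ, Continuous f → (∀ p, 0 < (f p).re) →
      Continuous fun p => Complex.Gamma (f p) := fun f hf hp =>
    continuous_iff_continuousAt.mpr fun p =>
      ContinuousAt.comp (contDiffAt_Gamma (hp p)).continuousAt hf.continuousAt
  have hr : Continuous fun p : ℝ × ℝ => regKK ν p.1 p.2 := by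
    have hε : 0 < 1 - ν := sub_pos.mpr hν
    have h := fun p : ℝ × ℝ => regKK_eq hε p.1 p.2
    simp only [sub_sub_cancel] at h
    simp only [h]
    refine continuous_const.mul ((Continuous.mul ?_ ?_).mul (Continuous.mul ?_ ?_))
    all_goals exact hG _ (by fun_prop) fun p => by simpa using hν
  exact (hr.mul hφ).integrable_of_hasCompactSupport hs.mul_left

theorem continuousOn_factorKK_div {φ : ℝ × ℝ → ℂ} (hφ : Continuous φ)
    (h0 : (0, 0) ∉ tsupport φ) :
    ContinuousOn (fun z : ℝ × ℝ × ℝ => factorKK z /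
      (2 * ((z.1 : ℂ) ^ 2 + (z.2.1 : ℂ) ^ 2 + (z.2.2 : ℂ) ^ 2)) * φ z.2)
      (Ioo (-1) 1 ×ˢ univ) := by
  intro z hz
  by_cases h : z.2 ∈ tsupport φ
  · have hne : 2 * ((z.1 : ℂ) ^ 2 + (z.2.1 : ℂ) ^ 2 + (z.2.2 : ℂ) ^ 2) ≠ 0 := by
      refine mul_ne_zero two_ne_zero ?_
      have h1 : ¬(z.2.1 = 0 ∧ z.2.2 = 0) := fun hh =>
        h0 (by rwa [show ((0 : ℝ), (0 : ℝ)) = z.2 from Prod.ext hh.1.symm hh.2.symm])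
      have h2 : z.1 ^ 2 + z.2.1 ^ 2 + z.2.2 ^ 2 ≠ 0 := fun hh => h1
        ⟨by nlinarith [sq_nonneg z.1, sq_nonneg z.2.1, sq_nonneg z.2.2],
          by nlinarith [sq_nonneg z.1, sq_nonneg z.2.1, sq_nonneg z.2.2]⟩
      exact_mod_cast h2
    exact ((contDiffOn_factorKK.continuousOn z hz).div (by fun_prop) hne).mul (by fun_prop)
  · refine ContinuousAt.continuousWithinAt ?_
    have hev : ∀ᶠ w : ℝ × ℝ × ℝ in 𝓝 z, φ w.2 = 0 :=
      continuous_snd.continuousAt.eventually (notMem_tsupport_iff_eventuallyEq.mp h)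
    refine (continuousAt_const (y := (0 : ℂ))).congr ?_
    filter_upwards [hev] with w hw
    rw [hw, mul_zero]

theorem measurePreserving_neg_snd :
    MeasurePreserving (fun p : ℝ × ℝ => (p.1, -p.2)) volume volume :=
  (MeasurePreserving.id (volume : Measure ℝ)).prod
    (Measure.measurePreserving_neg (volume : Measure ℝ))

theorem integral_comp_neg_snd (f : ℝ × ℝ → ℂ) : ∫ p : ℝ × ℝ, f (p.1, -p.2) = ∫ p, f p :=
  measurePreserving_neg_snd.integral_comp
    ((MeasurableEquiv.refl ℝ).prodCongr (MeasurableEquiv.neg ℝ)).measurableEmbedding f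

theorem factorKK_zero_of_eq_zero {p : ℝ × ℝ} (hs : p.1 + p.2 = 0) (hd : p.1 - p.2 ≠ 0) :
    factorKK (0, p) = ((Real.pi * (p.1 - p.2) / Real.sinh (Real.pi * (p.1 - p.2) / 2) : ℝ) : ℂ) := by
  have h := Gamma_one_add_mul_Gamma_one_sub hd
  simp only [factorKK, hs, Complex.ofReal_zero, mul_zero, add_zero, sub_zero, zero_add,
    Complex.cpow_zero, zero_div, Complex.ofReal_one, Complex.Gamma_one, zero_sub, neg_div,
    ← sub_eq_add_neg, h]
  push_cast
  ring

theorem factorKK_neg_snd (ε a b : ℝ) : factorKK (ε, a, -b) = factorKK (ε, a, b) := by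
  simp only [factorKK, sub_neg_eq_add, ← sub_eq_add_neg]
  ring

theorem pi_mul_factorKK_div (b : ℝ) :
    (Real.pi : ℂ) * (factorKK (0, -b, b) /
      (2 * (((0 : ℝ) : ℂ) ^ 2 + ((-b : ℝ) : ℂ) ^ 2 + (b : ℂ) ^ 2))) =
      ((Real.pi ^ 2 / (2 * b * Real.sinh (b * Real.pi)) : ℝ) : ℂ) := by
  rcases eq_or_ne b 0 with rfl | hb
  · simp
  rw [factorKK_zero_of_eq_zero (by simp) (by simp; intro h; exact hb (by linarith))]
  have e : Real.pi * ((-b, b).1 - (-b, b).2) / 2 = -(b * Real.pi) := by simp; ring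
  rw [e, Real.sinh_neg]
  have hs : Real.sinh (b * Real.pi) ≠ 0 := by
    rw [Ne, Real.sinh_eq_zero]
    exact mul_ne_zero hb Real.pi_ne_zero
  norm_cast
  field_simp
  ring

theorem tendsto_integral_regKK {φ : ℝ × ℝ → ℂ} (hφ : Continuous φ) (hs : HasCompactSupport φ)
    (h0 : (0, 0) ∉ tsupport φ) :
    Tendsto (fun ν : ℝ => ∫ p : ℝ × ℝ, regKK ν p.1 p.2 * φ p) (𝓝[<] 1) (𝓝 (limitKK φ)) := by
  obtain ⟨M, hM⟩ := exists_bound_support hs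
  have hF := continuousOn_factorKK_div hφ h0
  set F : ℝ × ℝ × ℝ → ℂ := fun z => factorKK z /
      (2 * ((z.1 : ℂ) ^ 2 + (z.2.1 : ℂ) ^ 2 + (z.2.2 : ℂ) ^ 2)) * φ z.2 with hFdef
  have hFM : ∀ (ε : ℝ) (p : ℝ × ℝ), M < |p.1| ∨ M < |p.2| → F (ε, p) = 0 := fun ε p hp => by
    simp only [hFdef, hM p hp, mul_zero]
  have hF' : ContinuousOn (fun z : ℝ × ℝ × ℝ => F (z.1, z.2.1, -z.2.2)) (Ioo (-1) 1 ×ˢ univ) :=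
    hF.comp (f := fun z : ℝ × ℝ × ℝ => (z.1, z.2.1, -z.2.2)) (by fun_prop) fun z hz =>
      ⟨hz.1, trivial⟩
  have hFM' : ∀ (ε : ℝ) (p : ℝ × ℝ), M < |p.1| ∨ M < |p.2| → F (ε, p.1, -p.2) = 0 :=
    fun ε p hp => hFM ε (p.1, -p.2) (by simpa using hp)
  have h1 := tendsto_integral_poisson_add hF hFM
  have h2 := tendsto_integral_poisson_add (F := fun z => F (z.1, z.2.1, -z.2.2)) hF' hFM'
  have h := (h1.add h2).comp tendsto_one_sub_nhdsLT
  have hlim : limitKK φ = Real.pi * (∫ b : ℝ, F (0, -b, b)) + Real.pi * ∫ b : ℝ, F (0, -b, -b) := by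
    simp only [limitKK, deltaDiff, deltaSum]
    rw [add_comm, ← integral_const_mul, ← integral_const_mul]
    congr 1
    · rw [← integral_neg_eq_self]
      refine integral_congr_ae (ae_of_all _ fun b => ?_)
      simp only [hFdef, neg_neg]
      rw [← mul_assoc, pi_mul_factorKK_div]
      simp [Real.sinh_neg]
    · rw [← integral_neg_eq_self]
      refine integral_congr_ae (ae_of_all _ fun b => ?_)
      have hb := pi_mul_factorKK_div b
      rw [← factorKK_neg_snd] at hb
      simp only [Complex.ofReal_neg, neg_sq] at hb
      simp only [hFdef, Complex.ofReal_neg, neg_sq]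
      rw [← mul_assoc, hb]
      simp [Real.sinh_neg]
  rw [hlim]
  refine h.congr' ?_
  have hev : ∀ᶠ ν : ℝ in 𝓝[<] 1, ν ∈ Ioo (1 / 2 : ℝ) 1 := Ioo_mem_nhdsLT (by norm_num)
  filter_upwards [hev] with ν hν
  have hε : 0 < 1 - ν := by linarith [hν.2]
  have hε' : 1 - ν ∈ Ioo (-1 : ℝ) 1 := ⟨by linarith, by linarith [hν.1]⟩
  have hFc : Continuous fun p : ℝ × ℝ => F (1 - ν, p) :=
    hF.comp_continuous (by fun_prop) fun _ => ⟨hε', trivial⟩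
  have hFs : HasCompactSupport fun p : ℝ × ℝ => F (1 - ν, p) := hs.mul_left
  have hk : ∀ g : ℝ × ℝ → ℝ, Continuous g → Integrable fun p : ℝ × ℝ =>
      ((1 - ν : ℝ) : ℂ) / (((1 - ν : ℝ) : ℂ) ^ 2 + (g p : ℂ) ^ 2) * F (1 - ν, p) := fun g hg =>
    Continuous.integrable_of_hasCompactSupport
      ((Continuous.div (by fun_prop) (by fun_prop) fun p =>
        sq_add_sq_ofReal_ne_zero hε.ne' (g p)).mul hFc) hFs.mul_left
  have hn := integral_comp_neg_snd fun p : ℝ × ℝ =>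
    ((1 - ν : ℝ) : ℂ) / (((1 - ν : ℝ) : ℂ) ^ 2 + ((p.1 - p.2 : ℝ) : ℂ) ^ 2) * F (1 - ν, p)
  simp only [sub_neg_eq_add] at hn
  simp only [Function.comp_apply]
  rw [hn, ← integral_add (hk (fun p => p.1 + p.2) (by fun_prop))
    (hk (fun p => p.1 - p.2) (by fun_prop))]
  refine integral_congr_ae (ae_of_all _ fun p => ?_)
  have := regKK_eq_factorKK hε p
  rw [sub_sub_cancel] at this
  simp only [this, hFdef]
  ring

theorem mainTheorem5 :
    ((∀ ν α β : ℝ, ν < 1 → IntegrableOn (kernelKK ν α β) (Ioi 0)) ∧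
      ∀ φ : 𝓓(puncturedPlane, ℂ),
        (∀ ν : ℝ, ν < 1 → Integrable (fun p : ℝ × ℝ => regKK ν p.1 p.2 * φ p)) ∧
        Tendsto (fun ν : ℝ => ∫ p : ℝ × ℝ, regKK ν p.1 p.2 * φ p) (𝓝[<] 1)
          (𝓝 (limitKK φ))) ∧
    ((∀ ν α β : ℝ, 0 < ν → ν < 1 → IntegrableOn (kernelJJ ν α β) (Ioi 0)) ∧
      ∀ φ : 𝓓((⊤ : Opens (ℝ × ℝ)), ℂ),
        (∀ ν : ℝ, 0 < ν → ν < 1 → Integrable (fun p : ℝ × ℝ => regJJ ν p.1 p.2 * φ p)) ∧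
        Tendsto (fun ν : ℝ => ∫ p : ℝ × ℝ, regJJ ν p.1 p.2 * φ p) (𝓝[<] 1)
          (𝓝 (limitJJ φ))) := by
  refine ⟨⟨fun ν α β hν => integrableOn_kernelKK hν α β, fun φ => ⟨fun ν hν =>
    integrable_regKK_mul hν φ.continuous φ.hasCompactSupport,
    tendsto_integral_regKK φ.continuous φ.hasCompactSupport fun h =>
      φ.tsupport_subset h rfl⟩⟩, fun ν α β h0 h1 => integrableOn_kernelJJ h0 h1 α β,
    fun φ => ⟨fun ν h0 h1 => integrable_regJJ_mul h0 h1 φ.continuous φ.hasCompactSupport,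
    tendsto_integral_regJJ (φ.contDiff.of_le (by exact_mod_cast le_top)) φ.hasCompactSupport⟩⟩
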